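/- **Theorem.** Let $n\ge 2$, $1\le k\le n-1$, $\sigma,D\in\mathbb R$. There is a constant $C>0$, depending only on $n,k,\sigma,D$, such that the following holds. Let $\Omega\subset\mathbb R^n$ be open and let $\mathcal G_h$ be a finite subdivision of $\Omega$ into $n$-simplices (the open simplices are pairwise disjoint subsets of $\Omega$, and the closed ones cover $\Omega$) such that every $T\in\mathcal G_h$ has diameter at most $D$ and contains a closed ball of some radius $\rho>0$ with $\operatorname{diam}T\le\sigma\rho$. *Spaces.* $H\Lambda^j=H(\mathbf d^j)$ consists of the $\mathbf u\in L^2\Lambda^j(\Omega)$ with weak exterior derivative $\mathbf d^j\mathbf u\in L^2\Lambda^{j+1}(\Omega)$; $H^*\Lambda^j=H(\boldsymbol\delta_j)$ consists of those with weak codifferential $\boldsymbol\delta_j\mathbf u\in L^2\Lambda^{j-1}(\Omega)$, where $\boldsymbol\delta_j$ is the formal $L^2$-adjoint of $\mathbf d^{j-1}$; $H^*_0\Lambda^j$ is the closure of $C_0^\infty\Lambda^j(\Omega)$ in $H(\boldsymbol\delta_j)$. The subscript $h$ in $\mathbf d^k_h,\boldsymbol\delta_{k,h}$ means that the operator is applied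 simplex by simplex; unmarked norms and inner products are those of $L^2(\Omega)$. For a vector $v$ put $v^\flat=\sum_j v_j\,dx^j$, and let $\iota_v$ denote contraction with $v$. Let $\mathcal P_0\Lambda^j$ be the constant $j$-forms, and $$\mathcal P_1^-\Lambda^j=\mathcal P_0\Lambda^j+\{\iota_x\alpha:\alpha\in\mathcal P_0\Lambda^{j+1}\},\qquad \mathcal P_1^{*,-}\Lambda^{j}=\mathcal P_0\Lambda^{j}+\{x^\flat\wedge\alpha:\alpha\in\mathcal P_0\Lambda^{j-1}\}.$$ For a simplex $T$ with barycenter $c$ put $\tilde x=x-c$ and $c^j=|T|^{-1}\int_T\tilde x_j^2\,dx$, and let $$\mathbf P\Lambda^k(T)=\mathcal P_0\Lambda^k\oplus\{\iota_{\tilde x}\alpha:\alpha\in\mathcal P_0\Lambda^{k+1}\}\oplus\{\tilde x^\flat\wedge\alpha:\alpha\in\mathcal P_0\Lambda^{k-1}\}\oplus\operatorname{span}\Big\{\sum_{j\notin I}(\tilde x_j^2-c^j)\,dx^{I}:|I|=k\Big\}$$ be the enriched trimmed space. $\mathbf P\Lambda^k(\mathcal G_h)$, $\mathcal P_1^-\Lambda^j(\mathcal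 G_h)$, $\mathcal P_1^{*,-}\Lambda^j(\mathcal G_h)$ are the corresponding spaces of piecewise forms (no continuity imposed). Let $$\boldsymbol W_h\Lambda^{k-1}=\mathcal P_1^-\Lambda^{k-1}(\mathcal G_h)\cap H\Lambda^{k-1},\qquad \boldsymbol W^*_{h0}\Lambda^{k+1}=\mathcal P_1^{*,-}\Lambda^{k+1}(\mathcal G_h)\cap H^*_0\Lambda^{k+1},$$ and let $\boldsymbol V_h$ be the set of $\mu_h\in\mathbf P\Lambda^k(\mathcal G_h)$ such that $$\langle\mathbf d^k_h\mu_h,\eta_h\rangle=\langle\mu_h,\boldsymbol\delta_{k+1}\eta_h\rangle\ \ \forall\,\eta_h\in\boldsymbol W^*_{h0}\Lambda^{k+1},\qquad \langle\boldsymbol\delta_{k,h}\mu_h,\tau_h\rangle=\langle\mu_h,\mathbf d^{k-1}\tau_h\rangle\ \ \forall\,\tau_h\in\boldsymbol W_h\Lambda^{k-1}.$$ *Problems.* Let $f\in L^2\Lambda^k(\Omega)$. Let $\omega\in H\Lambda^k\cap H^*_0\Lambda^k$ satisfy $$\langle\mathbf d^k\omega,\mathbf d^k\mu\rangle+\langle\boldsymbol\delta_k\omega,\boldsymbol\delta_k\mu\rangle+\langle\omega,\mu\rangle=\langle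 f,\mu\rangle\quad\forall\,\mu\in H\Lambda^k\cap H^*_0\Lambda^k,$$ and let $\omega_h\in\boldsymbol V_h$ satisfy $$\langle\mathbf d^k_h\omega_h,\mathbf d^k_h\mu_h\rangle+\langle\boldsymbol\delta_{k,h}\omega_h,\boldsymbol\delta_{k,h}\mu_h\rangle+\langle\omega_h,\mu_h\rangle=\langle f,\mu_h\rangle\quad\forall\,\mu_h\in\boldsymbol V_h.$$ *Conclusion.* Then $\mathbf d^k\omega\in H^*_0\Lambda^{k+1}$ and $\boldsymbol\delta_k\omega\in H\Lambda^{k-1}$. With $$E_1=\inf_{\mu_h\in\mathbf P\Lambda^k(\mathcal G_h)}\big[\|\omega-\mu_h\|+\|\mathbf d^k_h(\omega-\mu_h)\|+\|\boldsymbol\delta_{k,h}(\omega-\mu_h)\|\big],$$ $$E_2=\inf_{\eta_h\in\boldsymbol W^*_{h0}\Lambda^{k+1}}\big[\|\mathbf d^k\omega-\eta_h\|+\|\boldsymbol\delta_{k+1}(\mathbf d^k\omega-\eta_h)\|\big],\qquad E_3=\inf_{\tau_h\in\boldsymbol W_h\Lambda^{k-1}}\big[\|\boldsymbol\delta_k\omega-\tau_h\|+\|\mathbf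 d^{k-1}(\boldsymbol\delta_k\omega-\tau_h)\|\big],$$ we have $$\|\omega-\omega_h\|+\|\mathbf d^k_h(\omega-\omega_h)\|+\|\boldsymbol\delta_{k,h}(\omega-\omega_h)\|\le C\,E_1+\tfrac{1+\sqrt3}{2}\,(E_2+E_3),$$ and, for the energy norm, $$\big(\|\omega-\omega_h\|^2+\|\mathbf d^k_h(\omega-\omega_h)\|^2+\|\boldsymbol\delta_{k,h}(\omega-\omega_h)\|^2\big)^{1/2}\le C\,E_1+E_2+E_3.$$ -/

import Mathlib

open Set MeasureTheory

noncomputable section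

namespace HodgeFEM

/-! ### Constant-coefficient algebra of alternating forms on `ℝⁿ` -/

/-- Euclidean space `ℝⁿ`. -/
abbrev E (n : ℕ) : Type := EuclideanSpace ℝ (Fin n)

/-- Alternating `k`-forms on `ℝⁿ` (the value of a differential form at a point). A differential
`k`-form is a function `E n → Form n k`. -/
abbrev Form (n k : ℕ) : Type := E n [⋀^Fin k]→L[ℝ] ℝ

/-- The standard basis vector `e_i`. -/
def stdVec (n : ℕ) (i : Fin n) : E n := EuclideanSpace.single i 1

/-- The coefficient of `dx^{I₁} ∧ ⋯ ∧ dx^{I_k}`, for `I₁ < ⋯ < I_k`. -/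
def coeff {n k : ℕ} (α : Form n k) (I : Fin k ↪o Fin n) : ℝ := α fun j => stdVec n (I j)

/-- The basis form `dx^{I₁} ∧ ⋯ ∧ dx^{I_k}`, `(v₁, …, v_k) ↦ det ((v_a)_{I_b})`. -/
def dxForm {n k : ℕ} (I : Fin k ↪o Fin n) : Form n k where
  toMultilinearMap :=
    ((Matrix.detRowAlternating : (Fin k → ℝ) [⋀^Fin k]→ₗ[ℝ] ℝ).compLinearMap
      (LinearMap.pi fun b : Fin k =>
        (EuclideanSpace.proj (𝕜 := ℝ) (I b) : E n →L[ℝ] ℝ).toLinearMap)).toMultilinearMap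
  cont := by
    change Continuous fun v : Fin k → E n => Matrix.det (fun a b => v a (I b))
    refine Continuous.matrix_det ?_
    fun_prop
  map_eq_zero_of_eq' := fun v i j hv hij =>
    ((Matrix.detRowAlternating : (Fin k → ℝ) [⋀^Fin k]→ₗ[ℝ] ℝ).compLinearMap
      (LinearMap.pi fun b : Fin k =>
        (EuclideanSpace.proj (𝕜 := ℝ) (I b) : E n →L[ℝ] ℝ).toLinearMap)).map_eq_zero_of_eq v hv hij

/-- The Euclidean inner product of `k`-forms, for which the `dx^I` are orthonormal. -/
def formInner {n k : ℕ} (α β : Form n k) : ℝ := ∑ I : Fin k ↪o Fin n, coeff α I * coeff β I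

/-- Contraction `ι_v α` of a form with a vector. -/
def contract {n k : ℕ} (v : E n) (α : Form n (k + 1)) : Form n k := α.curryLeft v

/-- Exterior product `v^♭ ∧ α`, where `v^♭ = ∑ v_i dx^i`. -/
def flatWedge {n k : ℕ} (v : E n) (α : Form n k) : Form n (k + 1) :=
  ContinuousAlternatingMap.alternatizeUncurryFin ((innerSL ℝ v).smulRight α)

/-- The classical codifferential `δ φ = - ∑ᵢ ι_{eᵢ} ∂ᵢ φ`, the formal adjoint of the exterior
derivative. -/
def codiff {n k : ℕ} (φ : E n → Form n (k + 1)) (x : E n) : Form n k :=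
  -∑ i : Fin n, contract (stdVec n i) (fderiv ℝ φ x (stdVec n i))

/-! ### `L²` forms, weak exterior derivative and weak codifferential -/

/-- `u ∈ L²Λᵏ(U)`. -/
def MemL2 {n k : ℕ} (U : Set (E n)) (u : E n → Form n k) : Prop :=
  MemLp u 2 (volume.restrict U)

/-- The inner product of `L²Λᵏ(U)`. -/
def l2Inner {n k : ℕ} (U : Set (E n)) (u v : E n → Form n k) : ℝ :=
  ∫ x in U, formInner (u x) (v x)

/-- The norm of `L²Λᵏ(U)`. -/
def l2Norm {n k : ℕ} (U : Set (E n)) (u : E n → Form n k) : ℝ := √(l2Inner U u u)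

/-- `φ ∈ C₀^∞Λᵏ(U)`: smooth with compact support contained in `U`. -/
def IsTestForm {n k : ℕ} (U : Set (E n)) (φ : E n → Form n k) : Prop :=
  ContDiff ℝ (⊤ : ℕ∞) φ ∧ HasCompactSupport φ ∧ tsupport φ ⊆ U

/-- `ξ ∈ L²Λ^{k+1}(U)` is the weak exterior derivative of `u` on `U`. -/
def IsWeakD {n k : ℕ} (U : Set (E n)) (u : E n → Form n k) (ξ : E n → Form n (k + 1)) : Prop :=
  MemL2 U ξ ∧ ∀ φ : E n → Form n (k + 1), IsTestForm U φ → l2Inner U u (codiff φ) = l2Inner U ξ φ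

/-- `ζ ∈ L²Λᵏ(U)` is the weak codifferential of the `(k+1)`-form `u` on `U`. -/
def IsWeakCodiff {n k : ℕ} (U : Set (E n)) (u : E n → Form n (k + 1)) (ζ : E n → Form n k) :
    Prop :=
  MemL2 U ζ ∧ ∀ φ : E n → Form n k, IsTestForm U φ → l2Inner U u (extDeriv φ) = l2Inner U ζ φ

/-- `u ∈ HΛᵏ(U) = H(d, U)`. -/
def MemHd {n k : ℕ} (U : Set (E n)) (u : E n → Form n k) : Prop :=
  MemL2 U u ∧ ∃ ξ, IsWeakD U u ξ

/-- `u ∈ H*Λ^{k+1}(U) = H(δ, U)`. -/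
def MemHdelta {n k : ℕ} (U : Set (E n)) (u : E n → Form n (k + 1)) : Prop :=
  MemL2 U u ∧ ∃ ζ, IsWeakCodiff U u ζ

open Classical in
/-- The exterior derivative `d u` on `U` of `u ∈ H(d, U)` (a representative; it is unique
almost everywhere on `U`). -/
def weakD {n k : ℕ} (U : Set (E n)) (u : E n → Form n k) : E n → Form n (k + 1) :=
  if h : ∃ ξ, IsWeakD U u ξ then h.choose else 0

open Classical in
/-- The codifferential `δ u` on `U` of `u ∈ H(δ, U)` (a representative; it is unique almost
everywhere on `U`). -/
def weakCodiff {n k : ℕ} (U : Set (E n)) (u : E n → Form n (k + 1)) : E n → Form n k :=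
  if h : ∃ ζ, IsWeakCodiff U u ζ then h.choose else 0

/-- `u ∈ H*₀Λ^{k+1}(U)`, the closure of `C₀^∞Λ^{k+1}(U)` in `H(δ, U)`. -/
def MemHdeltaZero {n k : ℕ} (U : Set (E n)) (u : E n → Form n (k + 1)) : Prop :=
  MemHdelta U u ∧ ∀ ε : ℝ, 0 < ε → ∃ φ : E n → Form n (k + 1), IsTestForm U φ ∧
    l2Norm U (u - φ) + l2Norm U (weakCodiff U u - codiff φ) < ε

/-! ### Polynomial spaces -/

/-- The (closed) simplex as a set. -/
def body {n : ℕ} (T : Affine.Simplex ℝ (E n) n) : Set (E n) := convexHull ℝ (range T.points)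

/-- The open simplex as a set. -/
def cell {n : ℕ} (T : Affine.Simplex ℝ (E n) n) : Set (E n) := interior (body T)

/-- The point `c` with `∫_T (x - c) = 0`. -/
def center {n : ℕ} (T : Affine.Simplex ℝ (E n) n) : E n := ⨍ x in cell T, x

/-- The constant with `∫_T [(x_j - c_j)² - secondMoment T j] = 0`. -/
def secondMoment {n : ℕ} (T : Affine.Simplex ℝ (E n) n) (j : Fin n) : ℝ :=
  ⨍ x in cell T, (x j - center T j) ^ 2

/-- `P₀Λᵏ`: constant forms. -/
def constForms (n k : ℕ) : Submodule ℝ (E n → Form n k) :=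
  Submodule.span ℝ (range fun (α : Form n k) (_ : E n) => α)

/-- `κ(P₀Λ^{k+1})`, with the Koszul operator `κ α = ι_{x - c} α` centred at `c`. -/
def koszulForms (n k : ℕ) (c : E n) : Submodule ℝ (E n → Form n k) :=
  Submodule.span ℝ (range fun (α : Form n (k + 1)) (x : E n) => contract (x - c) α)

/-- `⋆κ⋆(P₀Λᵏ)`, with the Koszul operator centred at `c`. Because `⋆ ι_v ⋆ α = ± v^♭ ∧ α`, with a
sign that depends on the degrees only, this is the space of the forms `(x - c)^♭ ∧ α`. -/
def starKoszulStarForms (n k : ℕ) (c : E n) : Submodule ℝ (E n → Form n (k + 1)) :=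
  Submodule.span ℝ (range fun (α : Form n k) (x : E n) => flatWedge (x - c) α)

/-- `H²_d Λᵏ(T)`: the span of the forms
`∑_{j ∉ I} [(x_j - c_j)² - secondMoment T j] dx^{I₁} ∧ ⋯ ∧ dx^{I_k}`. -/
def quadForms {n : ℕ} (k : ℕ) (T : Affine.Simplex ℝ (E n) n) : Submodule ℝ (E n → Form n k) :=
  Submodule.span ℝ (range fun (I : Fin k ↪o Fin n) (x : E n) =>
    (∑ j ∈ (Finset.univ.map I.toEmbedding)ᶜ,
      ((x j - center T j) ^ 2 - secondMoment T j)) • dxForm I)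

/-- The trimmed space `P₁⁻Λᵏ = P₀Λᵏ + κ(P₀Λ^{k+1})`. -/
def trimmed (n k : ℕ) : Submodule ℝ (E n → Form n k) := constForms n k ⊔ koszulForms n k 0

/-- The trimmed space `P₁^{*,-}Λ^{k+1} = ⋆P₁⁻Λ^{n-k-1} = P₀Λ^{k+1} + ⋆κ⋆(P₀Λᵏ)`. -/
def trimmedStar (n k : ℕ) : Submodule ℝ (E n → Form n (k + 1)) :=
  constForms n (k + 1) ⊔ starKoszulStarForms n k 0

/-- The enriched trimmed space of `(m+1)`-forms on `T`,
`P₀Λ^{m+1} ⊕ κ_T(P₀Λ^{m+2}) ⊕ ⋆κ_T⋆(P₀Λᵐ) ⊕ H²_d Λ^{m+1}(T)`. -/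
def enriched {n : ℕ} (m : ℕ) (T : Affine.Simplex ℝ (E n) n) :
    Submodule ℝ (E n → Form n (m + 1)) :=
  constForms n (m + 1) ⊔ koszulForms n (m + 1) (center T) ⊔
    starKoszulStarForms n m (center T) ⊔ quadForms (m + 1) T

/-! ### Simplicial subdivisions and finite element spaces -/

/-- A finite subdivision of `Ω` by `n`-simplices: the open simplices are pairwise disjoint subsets
of `Ω` and the closed simplices cover `Ω`. -/
structure Subdivision {n : ℕ} (Ω : Set (E n)) where
  cells : Finset (Affine.Simplex ℝ (E n) n)
  cell_subset : ∀ T ∈ cells, cell T ⊆ Ω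
  disjoint : ∀ S ∈ cells, ∀ T ∈ cells, S ≠ T → Disjoint (cell S) (cell T)
  covers : Ω ⊆ ⋃ T ∈ cells, body T

variable {n : ℕ} {Ω : Set (E n)}

/-- Shape regularity with constant `σ`: every simplex `T` contains a ball of some radius `ρ > 0`
with `diam T ≤ σ ρ`. -/
def Subdivision.ShapeRegular (𝒢 : Subdivision Ω) (σ : ℝ) : Prop :=
  ∀ T ∈ 𝒢.cells, ∃ (x : E n) (ρ : ℝ), 0 < ρ ∧ Metric.closedBall x ρ ⊆ body T ∧
    Metric.diam (body T) ≤ σ * ρ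

/-- All simplices have diameter at most `D`. -/
def Subdivision.DiamLE (𝒢 : Subdivision Ω) (D : ℝ) : Prop :=
  ∀ T ∈ 𝒢.cells, Metric.diam (body T) ≤ D

/-- The piecewise exterior derivative `d_h`. -/
def Subdivision.brokenD {k : ℕ} (𝒢 : Subdivision Ω) (u : E n → Form n k) :
    E n → Form n (k + 1) :=
  ∑ T ∈ 𝒢.cells, (cell T).indicator (weakD (cell T) u)

/-- The piecewise codifferential `δ_h`. -/
def Subdivision.brokenCodiff {k : ℕ} (𝒢 : Subdivision Ω) (u : E n → Form n (k + 1)) :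
    E n → Form n k :=
  ∑ T ∈ 𝒢.cells, (cell T).indicator (weakCodiff (cell T) u)

/-- The forms which on every open simplex `T` of the subdivision agree with a member of `S T`.
(Values off the open simplices are irrelevant: the open simplices fill `Ω` up to a null set.) -/
def Subdivision.piecewise {k : ℕ} (𝒢 : Subdivision Ω)
    (S : Affine.Simplex ℝ (E n) n → Submodule ℝ (E n → Form n k)) : Set (E n → Form n k) :=
  {u | ∀ T ∈ 𝒢.cells, ∃ p ∈ S T, EqOn u p (cell T)}

/-- The piecewise enriched trimmed space of `(m+1)`-forms. -/
def Subdivision.enrichedSpace (𝒢 : Subdivision Ω) (m : ℕ) : Set (E n → Form n (m + 1)) :=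
  𝒢.piecewise (enriched m)

/-- The conforming Whitney space `W_hΛᵏ = P₁⁻Λᵏ(𝒢) ∩ HΛᵏ(Ω)`. -/
def Subdivision.whitney (𝒢 : Subdivision Ω) (k : ℕ) : Set (E n → Form n k) :=
  {τ | τ ∈ 𝒢.piecewise (fun _ => trimmed n k) ∧ MemHd Ω τ}

/-- The conforming Whitney space `W*_{h0}Λ^{k+1} = P₁^{*,-}Λ^{k+1}(𝒢) ∩ H*₀Λ^{k+1}(Ω)`. -/
def Subdivision.whitneyStarZero (𝒢 : Subdivision Ω) (k : ℕ) : Set (E n → Form n (k + 1)) :=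
  {η | η ∈ 𝒢.piecewise (fun _ => trimmedStar n k) ∧ MemHdeltaZero Ω η}

/-- The nonconforming finite element space `V^{m,+d}_{d∩δ}` of `(m+1)`-forms: piecewise enriched
trimmed forms with the dual continuity conditions. -/
def Subdivision.femSpace (𝒢 : Subdivision Ω) (m : ℕ) : Set (E n → Form n (m + 1)) :=
  {μ | μ ∈ 𝒢.enrichedSpace m ∧
    (∀ η ∈ 𝒢.whitneyStarZero (m + 1),
      l2Inner Ω (𝒢.brokenD μ) η - l2Inner Ω μ (weakCodiff Ω η) = 0) ∧
    (∀ τ ∈ 𝒢.whitney m,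
      l2Inner Ω (𝒢.brokenCodiff μ) τ - l2Inner Ω μ (weakD Ω τ) = 0)}

/-! ### The continuous and the discrete problem -/

/-- `ω` solves the primal weak problem in `HΛ^{m+1}(Ω) ∩ H*₀Λ^{m+1}(Ω)` with datum `f`. -/
def IsSolution {n m : ℕ} (Ω : Set (E n)) (f ω : E n → Form n (m + 1)) : Prop :=
  MemHd Ω ω ∧ MemHdeltaZero Ω ω ∧ ∀ μ : E n → Form n (m + 1), MemHd Ω μ → MemHdeltaZero Ω μ →
    l2Inner Ω (weakD Ω ω) (weakD Ω μ) + l2Inner Ω (weakCodiff Ω ω) (weakCodiff Ω μ)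
      + l2Inner Ω ω μ = l2Inner Ω f μ

/-- `ωh` solves the nonconforming discrete problem with datum `f`. -/
def Subdivision.IsDiscreteSolution {m : ℕ} (𝒢 : Subdivision Ω) (f ωh : E n → Form n (m + 1)) :
    Prop :=
  ωh ∈ 𝒢.femSpace m ∧ ∀ μ ∈ 𝒢.femSpace m,
    l2Inner Ω (𝒢.brokenD ωh) (𝒢.brokenD μ) + l2Inner Ω (𝒢.brokenCodiff ωh) (𝒢.brokenCodiff μ)
      + l2Inner Ω ωh μ = l2Inner Ω f μ

/-! ### The three best approximation errors -/

/-- Best approximation of `ω` from the piecewise enriched trimmed space in the broken norm. -/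
def Subdivision.enrichedError {m : ℕ} (𝒢 : Subdivision Ω) (ω : E n → Form n (m + 1)) : ℝ :=
  ⨅ μ : 𝒢.enrichedSpace m, (l2Norm Ω (ω - μ.1) + l2Norm Ω (𝒢.brokenD (ω - μ.1))
    + l2Norm Ω (𝒢.brokenCodiff (ω - μ.1)))

/-- Best approximation of `ξ` from `W*_{h0}Λ^{k+1}` in the `H(δ)` norm. -/
def Subdivision.whitneyStarZeroError {k : ℕ} (𝒢 : Subdivision Ω) (ξ : E n → Form n (k + 1)) : ℝ :=
  ⨅ η : 𝒢.whitneyStarZero k, (l2Norm Ω (ξ - η.1) + l2Norm Ω (weakCodiff Ω (ξ - η.1)))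

/-- Best approximation of `ζ` from `W_hΛᵏ` in the `H(d)` norm. -/
def Subdivision.whitneyError {k : ℕ} (𝒢 : Subdivision Ω) (ζ : E n → Form n k) : ℝ :=
  ⨅ τ : 𝒢.whitney k, (l2Norm Ω (ζ - τ.1) + l2Norm Ω (weakD Ω (ζ - τ.1)))

end HodgeFEM

end

noncomputable section

namespace HodgeFEM

/-! ### Algebra of alternating forms -/

/-! The form degree is `k = m + 1`, so `m + 2 ≤ n` encodes `1 ≤ k ≤ n - 1`. The proof combines a
regularity result for the continuous problem, a stable quasi-interpolation into the nonconforming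
space, and a Strang-type argument with sharp handling of the consistency terms.

Regularity. The graph of the codifferential on test forms has as closure a closed relation
`zeroGraph`, whose domain is `H*₀` and whose adjoint is the weak exterior derivative. Since these
relations form a Hilbert complex, projecting the datum `f - ω` onto the kernel of one operator
isolates one of the two second-order terms (`exists_adjoint_of_hodge_weak`). This puts `dω` in `H*₀`
and `δω` in `H(d)`, and gives the strong equation `f = ω + δdω + dδω` (`IsSolution.l2Inner_eq`).

Interpolation. Both continuity conditions on the discrete space say that an integration-by-parts
defect against Whitney forms vanishes, and for `ω` itself it does vanish. Given any piecewise
enriched `μ`, it therefore suffices to add on each simplex a correction with the same defects as `ω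
- μ`. Centring at the barycentre makes constants `L²`-orthogonal to the other summands of the
enriched space, so the local system is triangular and solved by Riesz representation
(`exists_local_interpolant`). Uniform stability rests on the coercivity of `q ↦ (x - c)^♭ ∧ q` on a
shape regular simplex (`diam_mul_norm_le_wedgeForm`). Hence `V_h` approximates `ω` as well as the
broken space does, up to a constant (`exists_femSpace_approx`).

Strang argument. For `w = ωh - v` with `v` in `V_h`, subtracting Whitney forms `η`, `τ` from `dω`,
`δω` costs nothing because `w` satisfies the dual continuity conditions. This gives `x² + y² + z² ≤
a x + b y + c z` for the three parts of the energy of `w` (`energy_sq_le`). Completing the square in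
`ℝ³` yields `(1 + √3)/2` for the sum of the norms, and Cauchy–Schwarz yields `1` for the energy
norm. Infima over `μ`, `η`, `τ` finish the proof. -/

theorem sum_fun_eq_factorial_mul_sum_orderEmb {n k : ℕ} (G : (Fin k → Fin n) → ℝ)
    (hperm : ∀ (f : Fin k → Fin n) (s : Equiv.Perm (Fin k)), G (f ∘ s) = G f)
    (hinj : ∀ f : Fin k → Fin n, ¬ Function.Injective f → G f = 0) :
    ∑ f, G f = (k.factorial : ℝ) * ∑ I : Fin k ↪o Fin n, G I := by
  -- Sorting writes an injective index function uniquely as an increasing one composed with a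
  -- permutation, so each `I` is met `k!` times.
  have h1 : ∑ p : (Fin k ↪o Fin n) × Equiv.Perm (Fin k), G (p.1 ∘ p.2) = ∑ f, G f := by
    refine Finset.sum_of_injOn (fun p : (Fin k ↪o Fin n) × Equiv.Perm (Fin k) => p.1 ∘ p.2)
      ?_ (fun _ _ => Finset.mem_coe.2 (Finset.mem_univ _)) ?_ (fun _ _ => rfl)
    · rintro ⟨I, s⟩ - ⟨J, t⟩ - h
      have h' : (I : Fin k → Fin n) ∘ s = J ∘ t := h
      have hIJ : I = J := by
        apply OrderEmbedding.range_inj.1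
        rw [← s.surjective.range_comp I, h', t.surjective.range_comp]
      subst hIJ
      refine Prod.ext rfl (Equiv.ext fun x => I.injective (congrFun h' x))
    · intro f _ hf
      apply hinj
      intro hfi
      apply hf
      have hm : StrictMono (f ∘ Tuple.sort f) :=
        (Tuple.monotone_sort f).strictMono_of_injective (hfi.comp (Tuple.sort f).injective)
      refine ⟨⟨OrderEmbedding.ofStrictMono _ hm, (Tuple.sort f).symm⟩, by simp, ?_⟩
      funext x
      simp
  rw [← h1, Fintype.sum_prod_type]
  simp [hperm, Fintype.card_perm, Finset.mul_sum]

theorem form_comp_perm_mul {n k : ℕ} (α β : Form n k) (v : Fin k → E n)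
    (s : Equiv.Perm (Fin k)) : α (v ∘ s) * β (v ∘ s) = α v * β v := by
  have h1 : α (v ∘ s) = Equiv.Perm.sign s • α v := α.toAlternatingMap.map_perm v s
  have h2 : β (v ∘ s) = Equiv.Perm.sign s • β v := β.toAlternatingMap.map_perm v s
  rw [h1, h2]
  rcases Int.units_eq_one_or (Equiv.Perm.sign s) with h | h <;> simp [h]

/-- Summing over all index functions, not only increasing ones, lets an index be inserted or removed
at any position, as the adjointness of wedge and contraction requires. -/
theorem factorial_mul_formInner {n k : ℕ} (α β : Form n k) :
    (k.factorial : ℝ) * formInner α β =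
      ∑ f : Fin k → Fin n, α (fun j => stdVec n (f j)) * β (fun j => stdVec n (f j)) := by
  rw [sum_fun_eq_factorial_mul_sum_orderEmb]
  · rfl
  · intro f s
    exact form_comp_perm_mul α β (fun j => stdVec n (f j)) s
  · intro f hf
    rw [Function.Injective] at hf
    push Not at hf
    obtain ⟨i, j, hij, hne⟩ := hf
    rw [α.map_eq_zero_of_eq _ (by simp [hij] : stdVec n (f i) = stdVec n (f j)) hne, zero_mul]

theorem inner_stdVec {n : ℕ} (v : E n) (i : Fin n) : inner ℝ v (stdVec n i) = v i := by
  simp [stdVec, EuclideanSpace.inner_single_right]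

theorem sum_smul_stdVec {n : ℕ} (v : E n) : ∑ i, v i • stdVec n i = v := by
  simpa [stdVec] using (EuclideanSpace.basisFun (Fin n) ℝ).sum_repr v

theorem form_ext_stdVec {n k : ℕ} {α β : Form n k}
    (h : ∀ f : Fin k → Fin n, α (fun j => stdVec n (f j)) = β (fun j => stdVec n (f j))) :
    α = β := by
  apply ContinuousAlternatingMap.toAlternatingMap_injective
  refine Module.Basis.ext_alternating (EuclideanSpace.basisFun (Fin n) ℝ).toBasis fun f _ => ?_
  simpa [stdVec] using h f

theorem formInner_self_eq_zero {n k : ℕ} {α : Form n k} (h : formInner α α = 0) : α = 0 := by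
  have h1 := factorial_mul_formInner α α
  rw [h, mul_zero, eq_comm, Finset.sum_eq_zero_iff_of_nonneg fun _ _ => mul_self_nonneg _] at h1
  exact form_ext_stdVec fun f => by simpa using h1 f (Finset.mem_univ _)

theorem coeff_dxForm {n k : ℕ} (I J : Fin k ↪o Fin n) :
    coeff (dxForm I) J = if I = J then 1 else 0 := by
  have h : coeff (dxForm I) J = Matrix.det (fun a b => if I b = J a then (1 : ℝ) else 0) := by
    change Matrix.det (fun a b => stdVec n (J a) (I b)) = _
    simp [stdVec]
  rw [h]
  split_ifs with hIJ
  · subst hIJ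
    have : (fun a b => if I b = I a then (1 : ℝ) else 0) = (1 : Matrix (Fin k) (Fin k) ℝ) := by
      ext a b
      simp [Matrix.one_apply, eq_comm]
    rw [this, Matrix.det_one]
  -- If every `J a` lay in the range of `I`, the ranges would agree by cardinality, and an
  -- increasing map is determined by its range. A missing `J a` gives a zero row.
  · have : ∃ a, ∀ b, I b ≠ J a := by
      by_contra! hc
      apply hIJ
      apply OrderEmbedding.range_inj.1
      symm
      have hsub : range J ⊆ range I := by
        rintro _ ⟨a, rfl⟩
        obtain ⟨b, hb⟩ := hc a
        exact ⟨b, hb⟩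
      refine Set.eq_of_subset_of_ncard_le hsub ?_ (Set.toFinite _)
      rw [← Set.image_univ, ← Set.image_univ, Set.ncard_image_of_injective _ I.injective,
        Set.ncard_image_of_injective _ J.injective]
    obtain ⟨a, ha⟩ := this
    exact Matrix.det_eq_zero_of_row_eq_zero a fun b => by simp [ha b]

/-- The coefficients with respect to the `dx^I`, as a linear map. -/
def coeffLin (n k : ℕ) : Form n k →ₗ[ℝ] EuclideanSpace ℝ (Fin k ↪o Fin n) where
  toFun α := WithLp.toLp 2 fun I => coeff α I
  map_add' α β := by ext I; rfl
  map_smul' c α := by ext I; rfl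

theorem formInner_eq_inner_coeffLin {n k : ℕ} (α β : Form n k) :
    formInner α β = inner ℝ (coeffLin n k α) (coeffLin n k β) := by
  simp [formInner, coeffLin, PiLp.inner_apply, mul_comm]

theorem coeffLin_injective (n k : ℕ) : Function.Injective (coeffLin n k) := by
  rw [← LinearMap.ker_eq_bot, LinearMap.ker_eq_bot']
  intro α h
  apply formInner_self_eq_zero
  rw [formInner_eq_inner_coeffLin, h, inner_zero_left]

instance (n k : ℕ) : FiniteDimensional ℝ (Form n k) :=
  FiniteDimensional.of_injective _ (coeffLin_injective n k)

theorem coeffLin_surjective (n k : ℕ) : Function.Surjective (coeffLin n k) := by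
  intro c
  refine ⟨∑ I, c I • dxForm I, ?_⟩
  ext J
  simp only [map_sum, map_smul, WithLp.ofLp_sum, WithLp.ofLp_smul, Finset.sum_apply,
    Pi.smul_apply, smul_eq_mul]
  have h : ∀ I : Fin k ↪o Fin n, (coeffLin n k (dxForm I)) J = if I = J then 1 else 0 :=
    fun I => coeff_dxForm I J
  simp [h]

/-- The coefficients with respect to the `dx^I`: an isometry from the inner product of forms to
Euclidean space. -/
def vec (n k : ℕ) : Form n k ≃L[ℝ] EuclideanSpace ℝ (Fin k ↪o Fin n) :=
  (LinearEquiv.ofBijective (coeffLin n k)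
    ⟨coeffLin_injective n k, coeffLin_surjective n k⟩).toContinuousLinearEquiv

theorem formInner_eq_inner {n k : ℕ} (α β : Form n k) :
    formInner α β = inner ℝ (vec n k α) (vec n k β) :=
  formInner_eq_inner_coeffLin α β

theorem formInner_self {n k : ℕ} (α : Form n k) : formInner α α = ‖vec n k α‖ ^ 2 := by
  rw [formInner_eq_inner, real_inner_self_eq_norm_sq]

theorem formInner_comm {n k : ℕ} (α β : Form n k) : formInner α β = formInner β α := by
  rw [formInner_eq_inner, formInner_eq_inner, real_inner_comm]

theorem formInner_smul_left {n k : ℕ} (c : ℝ) (α β : Form n k) :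
    formInner (c • α) β = c * formInner α β := by
  simp [formInner_eq_inner, real_inner_smul_left]

theorem formInner_smul_right {n k : ℕ} (c : ℝ) (α β : Form n k) :
    formInner α (c • β) = c * formInner α β := by
  simp [formInner_eq_inner, real_inner_smul_right]

theorem formInner_neg_right {n k : ℕ} (α β : Form n k) :
    formInner α (-β) = -formInner α β := by
  simp [formInner_eq_inner]

theorem formInner_sum_left {n k : ℕ} {ι : Type*} (s : Finset ι) (α : ι → Form n k)
    (β : Form n k) : formInner (∑ i ∈ s, α i) β = ∑ i ∈ s, formInner (α i) β := by
  simp [formInner_eq_inner, sum_inner]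

theorem formInner_sum_right {n k : ℕ} {ι : Type*} (s : Finset ι) (α : Form n k)
    (β : ι → Form n k) : formInner α (∑ i ∈ s, β i) = ∑ i ∈ s, formInner α (β i) := by
  simp [formInner_eq_inner, inner_sum]

theorem formInner_zero_left {n k : ℕ} (β : Form n k) : formInner 0 β = 0 := by
  simp [formInner_eq_inner]

theorem formInner_zero_right {n k : ℕ} (β : Form n k) : formInner β 0 = 0 := by
  simp [formInner_eq_inner]

theorem form_ext_formInner {n k : ℕ} {α β : Form n k}
    (h : ∀ γ, formInner α γ = formInner β γ) : α = β := by
  apply (vec n k).injective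
  refine ext_inner_right ℝ fun w => ?_
  obtain ⟨γ, rfl⟩ := (vec n k).surjective w
  simpa only [formInner_eq_inner] using h γ

theorem formInner_dxForm_left {n k : ℕ} (I : Fin k ↪o Fin n) (β : Form n k) :
    formInner (dxForm I) β = coeff β I := by
  simp [formInner, coeff_dxForm]

theorem sum_coeff_smul_dxForm {n k : ℕ} (α : Form n k) : ∑ I, coeff α I • dxForm I = α :=
  form_ext_formInner fun γ => by
    simp only [formInner_sum_left, formInner_smul_left, formInner_dxForm_left]
    rfl

/-! ### Contraction and exterior product. -/

theorem contract_apply {n k : ℕ} (v : E n) (α : Form n (k + 1)) (w : Fin k → E n) :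
    contract v α w = α (Fin.cons v w) := rfl

theorem flatWedge_apply {n k : ℕ} (v : E n) (α : Form n k) (w : Fin (k + 1) → E n) :
    flatWedge v α w = ∑ i : Fin (k + 1), (-1) ^ (i : ℕ) * (inner ℝ v (w i) * α (i.removeNth w)) := by
  simp [flatWedge, ContinuousAlternatingMap.alternatizeUncurryFin_apply]

theorem contract_sub_left {n k : ℕ} (v w : E n) (α : Form n (k + 1)) :
    contract (v - w) α = contract v α - contract w α := map_sub α.curryLeft v w

theorem contract_add_right {n k : ℕ} (v : E n) (α β : Form n (k + 1)) :
    contract v (α + β) = contract v α + contract v β := rfl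

theorem contract_smul_right {n k : ℕ} (c : ℝ) (v : E n) (α : Form n (k + 1)) :
    contract v (c • α) = c • contract v α := rfl

theorem flatWedge_add_left {n k : ℕ} (v w : E n) (α : Form n k) :
    flatWedge (v + w) α = flatWedge v α + flatWedge w α := by
  ext u
  simp [flatWedge_apply, inner_add_left, mul_add, add_mul, Finset.sum_add_distrib]

theorem flatWedge_smul_left {n k : ℕ} (c : ℝ) (v : E n) (α : Form n k) :
    flatWedge (c • v) α = c • flatWedge v α := by
  ext u
  simp only [flatWedge_apply, real_inner_smul_left, ContinuousAlternatingMap.smul_apply,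
    smul_eq_mul, Finset.mul_sum]
  exact Finset.sum_congr rfl fun i _ => by ring

theorem flatWedge_add_right {n k : ℕ} (v : E n) (α β : Form n k) :
    flatWedge v (α + β) = flatWedge v α + flatWedge v β := by
  ext u
  simp [flatWedge_apply, mul_add, Finset.sum_add_distrib]

theorem flatWedge_smul_right {n k : ℕ} (c : ℝ) (v : E n) (α : Form n k) :
    flatWedge v (c • α) = c • flatWedge v α := by
  ext u
  simp only [flatWedge_apply, ContinuousAlternatingMap.smul_apply, smul_eq_mul, Finset.mul_sum]
  exact Finset.sum_congr rfl fun i _ => by ring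

/-- Moving the argument in slot `i` to the front passes `i` others, each at the cost of a sign. -/
theorem neg_one_pow_mul_form_removeNth {n k : ℕ} (β : Form n (k + 1)) (w : Fin (k + 1) → E n)
    (i : Fin (k + 1)) : (-1) ^ (i : ℕ) * β w = β (Fin.cons (w i) (i.removeNth w)) := by
  have h := β.neg_one_pow_smul_map_insertNth i (w i) (i.removeNth w)
  rw [Fin.insertNth_self_removeNth] at h
  rw [← Matrix.vecCons, ← h]
  simp

/-- Wedging with `v^♭` is adjoint to contraction with `v`. -/
theorem formInner_flatWedge {n k : ℕ} (v : E n) (α : Form n k) (β : Form n (k + 1)) :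
    formInner (flatWedge v α) β = formInner α (contract v β) := by
  have hk : ((k + 1).factorial : ℝ) ≠ 0 := by positivity
  apply mul_left_cancel₀ hk
  rw [factorial_mul_formInner, Nat.factorial_succ, Nat.cast_mul, mul_assoc,
    factorial_mul_formInner]
  have h1 : ∀ f : Fin (k + 1) → Fin n,
      flatWedge v α (fun j => stdVec n (f j)) * β (fun j => stdVec n (f j)) =
        ∑ i : Fin (k + 1), v (f i) * α (fun j => stdVec n (i.removeNth f j)) *
          β (Fin.cons (stdVec n (f i)) (fun j => stdVec n (i.removeNth f j))) := by
    intro f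
    rw [flatWedge_apply, Finset.sum_mul]
    refine Finset.sum_congr rfl fun i _ => ?_
    have := neg_one_pow_mul_form_removeNth β (fun j => stdVec n (f j)) i
    change _ = v (f i) * α (i.removeNth fun j => stdVec n (f j)) *
      β (Fin.cons (stdVec n (f i)) (i.removeNth fun j => stdVec n (f j)))
    rw [← this, inner_stdVec]
    ring
  simp only [h1]
  rw [Finset.sum_comm]
  -- Splitting `f` into its value at `i` and the remaining indices, the sum over that value rebuilds
  -- `v`. All `k + 1` positions contribute equally, which matches `(k + 1)! = (k + 1) k!`.
  have h2 : ∀ i : Fin (k + 1), ∑ f : Fin (k + 1) → Fin n,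
      v (f i) * α (fun j => stdVec n (i.removeNth f j)) *
          β (Fin.cons (stdVec n (f i)) (fun j => stdVec n (i.removeNth f j))) =
      ∑ g : Fin k → Fin n, α (fun j => stdVec n (g j)) *
        contract v β (fun j => stdVec n (g j)) := by
    intro i
    rw [← (Fin.insertNthEquiv (fun _ => Fin n) i).sum_comp, Fintype.sum_prod_type, Finset.sum_comm]
    refine Finset.sum_congr rfl fun g _ => ?_
    conv_rhs => rw [← sum_smul_stdVec v]
    have h3 : contract (∑ j, v j • stdVec n j) β = ∑ j, v j • contract (stdVec n j) β := by
      change β.curryLeft _ = _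
      rw [map_sum]
      exact Finset.sum_congr rfl fun j _ => map_smul _ _ _
    rw [h3, ContinuousAlternatingMap.sum_apply, Finset.mul_sum]
    refine Finset.sum_congr rfl fun j _ => ?_
    simp [contract_apply, Fin.insertNthEquiv]
    ring
  simp only [h2]
  simp

theorem formInner_contract {n k : ℕ} (v : E n) (α : Form n k) (β : Form n (k + 1)) :
    formInner (contract v β) α = formInner β (flatWedge v α) := by
  rw [formInner_comm, ← formInner_flatWedge, formInner_comm]

theorem contract_contract_self {n k : ℕ} (v : E n) (α : Form n (k + 2)) :
    contract v (contract v α) = 0 := by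
  ext w
  exact α.map_eq_zero_of_eq _ (i := 0) (j := 1) (by simp) (by simp)

theorem flatWedge_flatWedge_self {n k : ℕ} (v : E n) (α : Form n k) :
    flatWedge v (flatWedge v α) = 0 :=
  form_ext_formInner fun γ => by
    rw [formInner_flatWedge, formInner_flatWedge, contract_contract_self, formInner_zero_left,
      formInner_zero_right]

/-- In the expansion of the wedge, slot `0` contributes `|e_i|² α`, in total `n α`. In each of the
other `k` slots the sum over `i` puts `w j` back into `α` in front of the other arguments, and
reordering leaves `-α`. -/
theorem sum_contract_flatWedge {n k : ℕ} (α : Form n k) :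
    ∑ i, contract (stdVec n i) (flatWedge (stdVec n i) α) = ((n : ℝ) - k) • α := by
  ext w
  rw [ContinuousAlternatingMap.sum_apply]
  simp only [contract_apply, flatWedge_apply]
  simp only [Fin.sum_univ_succ, Fin.cons_zero, Fin.cons_succ, Fin.removeNth_zero, Fin.tail_cons]
  rw [Finset.sum_add_distrib]
  have h1 : ∑ i : Fin n, (-1) ^ ((0 : Fin (k + 1)) : ℕ) *
      (inner ℝ (stdVec n i) (stdVec n i) * α w) = n * α w := by
    simp [stdVec]
  have h2 : ∀ j : Fin k, ∑ i : Fin n, (-1) ^ (j.succ : ℕ) * (inner ℝ (stdVec n i) (w j) *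
      α (j.succ.removeNth (Fin.cons (stdVec n i) w : Fin (k + 1) → E n))) = - α w := by
    intro j
    obtain ⟨k, rfl⟩ : ∃ l, k = l + 1 := ⟨k - 1, by have := j.2; omega⟩
    have h3 : ∀ i : Fin n, j.succ.removeNth (Fin.cons (stdVec n i) w : Fin (k + 2) → E n) =
        Fin.cons (stdVec n i) (j.removeNth w) := by
      intro i
      funext a
      refine Fin.cases ?_ (fun b => ?_) a
      · simp [Fin.removeNth]
      · simp [Fin.removeNth]
    simp only [h3]
    have h4 : ∑ i : Fin n, inner ℝ (stdVec n i) (w j) * α (Fin.cons (stdVec n i) (j.removeNth w))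
        = α (Fin.cons (w j) (j.removeNth w)) := by
      change _ = α.curryLeft (w j) (j.removeNth w)
      conv_rhs => rw [← sum_smul_stdVec (w j)]
      rw [map_sum, ContinuousAlternatingMap.sum_apply]
      refine Finset.sum_congr rfl fun i _ => ?_
      rw [real_inner_comm, inner_stdVec, map_smul]
      rfl
    rw [← Finset.mul_sum, h4, ← neg_one_pow_mul_form_removeNth, Fin.val_succ, ← mul_assoc,
      pow_succ]
    have : (-1 : ℝ) ^ (j : ℕ) * -1 * (-1) ^ (j : ℕ) = -1 := by
      rcases Nat.even_or_odd (j : ℕ) with hj | hj <;> simp [hj.neg_one_pow]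
    rw [this, neg_one_mul]
  rw [Finset.sum_comm, Finset.sum_congr rfl fun j _ => h2 j, h1]
  simp
  ring

theorem sum_norm_sq_flatWedge_stdVec {n k : ℕ} (α : Form n k) :
    ∑ i, ‖vec n (k + 1) (flatWedge (stdVec n i) α)‖ ^ 2 = ((n : ℝ) - k) * ‖vec n k α‖ ^ 2 := by
  simp only [← formInner_self, formInner_flatWedge]
  rw [← formInner_sum_right, sum_contract_flatWedge, formInner_smul_right]

/-- `|v^♭ ∧ α| ≤ √n |v| |α|`. -/
theorem norm_flatWedge_le {n k : ℕ} (v : E n) (α : Form n k) :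
    ‖vec n (k + 1) (flatWedge v α)‖ ≤ √n * ‖v‖ * ‖vec n k α‖ := by
  have h1 : flatWedge v α = ∑ i, v i • flatWedge (stdVec n i) α := by
    conv_lhs => rw [← sum_smul_stdVec v]
    ext w
    simp only [flatWedge_apply, sum_inner, real_inner_smul_left, ContinuousAlternatingMap.sum_apply,
      ContinuousAlternatingMap.smul_apply, smul_eq_mul, Finset.mul_sum, Finset.sum_mul]
    rw [Finset.sum_comm]
    exact Finset.sum_congr rfl fun i _ => Finset.sum_congr rfl fun j _ => by ring
  have h2 : ‖vec n (k + 1) (flatWedge v α)‖ ≤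
      ∑ i, |v i| * ‖vec n (k + 1) (flatWedge (stdVec n i) α)‖ := by
    rw [h1, map_sum]
    refine (norm_sum_le _ _).trans (Finset.sum_le_sum fun i _ => ?_)
    rw [map_smul, norm_smul, Real.norm_eq_abs]
  have h3 := Finset.sum_mul_sq_le_sq_mul_sq Finset.univ (fun i => |v i|)
    (fun i => ‖vec n (k + 1) (flatWedge (stdVec n i) α)‖)
  rw [sum_norm_sq_flatWedge_stdVec] at h3
  have h4 : ∑ i, |v i| ^ 2 = ‖v‖ ^ 2 := by simp [EuclideanSpace.norm_sq_eq]
  rw [h4] at h3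
  have h5 : ((n : ℝ) - k) ≤ n := by
    have : (0 : ℝ) ≤ k := by positivity
    linarith
  refine abs_le_of_sq_le_sq' ?_ (by positivity) |>.2
  calc ‖vec n (k + 1) (flatWedge v α)‖ ^ 2
      ≤ (∑ i, |v i| * ‖vec n (k + 1) (flatWedge (stdVec n i) α)‖) ^ 2 := by gcongr
    _ ≤ ‖v‖ ^ 2 * (((n : ℝ) - k) * ‖vec n k α‖ ^ 2) := h3
    _ ≤ ‖v‖ ^ 2 * (n * ‖vec n k α‖ ^ 2) := by gcongr
    _ = (√n * ‖v‖ * ‖vec n k α‖) ^ 2 := by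
      rw [mul_pow, mul_pow, Real.sq_sqrt (Nat.cast_nonneg n)]
      ring

/-- `|ι_v α| ≤ √n |v| |α|`. -/
theorem norm_contract_le {n k : ℕ} (v : E n) (α : Form n (k + 1)) :
    ‖vec n k (contract v α)‖ ≤ √n * ‖v‖ * ‖vec n (k + 1) α‖ := by
  -- By adjointness `|ι_v α|² = ⟨v^♭ ∧ ι_v α, α⟩`, so the wedge bound transfers.
  have h1 : ‖vec n k (contract v α)‖ ^ 2 ≤
      (√n * ‖v‖ * ‖vec n k (contract v α)‖) * ‖vec n (k + 1) α‖ := by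
    rw [← formInner_self, ← formInner_flatWedge, formInner_eq_inner]
    refine (real_inner_le_norm _ _).trans ?_
    gcongr
    exact norm_flatWedge_le v _
  by_cases h : ‖vec n k (contract v α)‖ = 0
  · rw [h]; positivity
  · have : 0 < ‖vec n k (contract v α)‖ := lt_of_le_of_ne (norm_nonneg _) (Ne.symm h)
    refine le_of_mul_le_mul_right ?_ this
    linarith [h1]

theorem flatWedge_dxForm_of_mem {n k : ℕ} (I : Fin k ↪o Fin n) (b : Fin k) :
    flatWedge (stdVec n (I b)) (dxForm I) = 0 :=
  form_ext_formInner fun γ => by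
    rw [formInner_flatWedge, formInner_dxForm_left, formInner_zero_left]
    exact γ.map_eq_zero_of_eq _ (i := 0) (j := b.succ) (by simp) (by simp [Fin.ext_iff])

theorem contract_dxForm_of_notMem {n k : ℕ} (I : Fin (k + 1) ↪o Fin n) (i : Fin n)
    (hi : i ∉ range I) : contract (stdVec n i) (dxForm I) = 0 :=
  form_ext_formInner fun γ => by
    rw [formInner_contract, formInner_dxForm_left, formInner_zero_left, coeff, flatWedge_apply]
    refine Finset.sum_eq_zero fun b _ => ?_
    have : inner ℝ (stdVec n i) (stdVec n (I b)) = 0 := by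
      rw [inner_stdVec]
      simp only [stdVec, PiLp.single_apply]
      rw [if_neg]
      exact fun h => hi ⟨b, h⟩
    rw [this]
    simp

/-- Riesz representation for a positive definite bilinear form on forms. -/
theorem exists_form_of_posDef {n k : ℕ} (G : Form n k →ₗ[ℝ] Form n k →ₗ[ℝ] ℝ)
    (hG : ∀ q, G q q = 0 → q = 0) (l : Form n k →ₗ[ℝ] ℝ) : ∃ q, ∀ γ, G q γ = l γ := by
  have hinj : Function.Injective G := by
    rw [← LinearMap.ker_eq_bot, LinearMap.ker_eq_bot']
    intro q hq
    exact hG q (by rw [hq]; rfl)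
  have hsurj : Function.Surjective G :=
    (LinearMap.injective_iff_surjective_of_finrank_eq_finrank
      (Subspace.dual_finrank_eq (K := ℝ) (V := Form n k)).symm).1 hinj
  obtain ⟨q, hq⟩ := hsurj l
  exact ⟨q, fun γ => by rw [hq]⟩

/-! ### The Hilbert space `L²Λᵏ` -/

section L2

variable {n k : ℕ} {U V : Set (E n)} {u v w : E n → Form n k}

theorem MemL2.add (hu : MemL2 U u) (hv : MemL2 U v) : MemL2 U (u + v) := by
  unfold MemL2 at *
  have h : u + v = u - (-v) := by rw [sub_neg_eq_add]
  rw [h]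
  exact MemLp.sub hu (MemLp.neg hv)

theorem MemL2.sub (hu : MemL2 U u) (hv : MemL2 U v) : MemL2 U (u - v) := by
  unfold MemL2 at *
  exact MemLp.sub hu hv

theorem MemL2.smul (c : ℝ) (hu : MemL2 U u) : MemL2 U (c • u) := by
  unfold MemL2 at *
  exact MemLp.const_smul hu c

theorem memL2_zero : MemL2 U (0 : E n → Form n k) := by
  unfold MemL2
  exact (continuous_const.memLp_of_hasCompactSupport HasCompactSupport.zero).restrict U

theorem MemL2.mono (hu : MemL2 U u) (h : V ⊆ U) : MemL2 V u :=
  MemLp.mono_measure (Measure.restrict_mono h le_rfl) hu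

theorem MemL2.congr (hu : MemL2 U u) (h : u =ᵐ[volume.restrict U] v) : MemL2 U v :=
  (memLp_congr_ae h).1 hu

theorem MemL2.memLp_vec (hu : MemL2 U u) :
    MemLp (fun x => vec n k (u x)) 2 (volume.restrict U) :=
  (vec n k : Form n k →L[ℝ] EuclideanSpace ℝ (Fin k ↪o Fin n)).comp_memLp' hu

/-- The Hilbert space `L²Λᵏ(U)`, in coordinates. -/
abbrev LTwo (U : Set (E n)) (k : ℕ) : Type :=
  Lp (EuclideanSpace ℝ (Fin k ↪o Fin n)) 2 (volume.restrict U)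

open Classical in
/-- The class in `L²Λᵏ(U)` of a square integrable form. -/
def cls (U : Set (E n)) (u : E n → Form n k) : LTwo U k :=
  if h : MemL2 U u then h.memLp_vec.toLp else 0

theorem coeFn_cls (hu : MemL2 U u) :
    cls U u =ᵐ[volume.restrict U] fun x => vec n k (u x) := by
  rw [cls, dif_pos hu]
  exact MemLp.coeFn_toLp _

theorem cls_eq_cls_iff (hu : MemL2 U u) (hv : MemL2 U v) :
    cls U u = cls U v ↔ u =ᵐ[volume.restrict U] v := by
  rw [cls, cls, dif_pos hu, dif_pos hv, MemLp.toLp_eq_toLp_iff]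
  constructor
  · intro h
    filter_upwards [h] with x hx using (vec n k).injective hx
  · intro h
    filter_upwards [h] with x hx
    rw [hx]

theorem cls_add (hu : MemL2 U u) (hv : MemL2 U v) : cls U (u + v) = cls U u + cls U v := by
  rw [cls, cls, cls, dif_pos hu, dif_pos hv, dif_pos (hu.add hv), ← MemLp.toLp_add]
  rfl

theorem cls_sub (hu : MemL2 U u) (hv : MemL2 U v) : cls U (u - v) = cls U u - cls U v := by
  rw [cls, cls, cls, dif_pos hu, dif_pos hv, dif_pos (hu.sub hv), ← MemLp.toLp_sub]
  rfl

theorem cls_smul (c : ℝ) (hu : MemL2 U u) : cls U (c • u) = c • cls U u := by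
  rw [cls, cls, dif_pos hu, dif_pos (hu.smul c), ← MemLp.toLp_const_smul]
  rfl

theorem cls_zero : cls U (0 : E n → Form n k) = 0 := by
  have := cls_smul (U := U) (0 : ℝ) (memL2_zero (U := U) (n := n) (k := k))
  simpa using this

theorem exists_cls_eq (F : LTwo U k) : ∃ u : E n → Form n k, MemL2 U u ∧ cls U u = F := by
  have hu : MemL2 U (fun x => (vec n k).symm (F x)) :=
    ((vec n k).symm : EuclideanSpace ℝ (Fin k ↪o Fin n) →L[ℝ] Form n k).comp_memLp' (Lp.memLp F)
  refine ⟨_, hu, Lp.ext ?_⟩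
  filter_upwards [coeFn_cls hu] with x hx
  simp [hx]

/-- `Form` carries an operator norm, not the Euclidean one. In the coordinates `vec` the inner
product of forms is Euclidean, so bilinearity, Cauchy–Schwarz and the triangle inequality are
inherited from a genuine Hilbert space. -/
theorem inner_cls (hu : MemL2 U u) (hv : MemL2 U v) :
    inner ℝ (cls U u) (cls U v) = l2Inner U u v := by
  rw [L2.inner_def, l2Inner]
  refine integral_congr_ae ?_
  filter_upwards [coeFn_cls hu, coeFn_cls hv] with x hx hy
  rw [hx, hy, formInner_eq_inner]

theorem norm_cls (hu : MemL2 U u) : ‖cls U u‖ = l2Norm U u := by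
  rw [l2Norm, ← inner_cls hu hu, real_inner_self_eq_norm_sq, Real.sqrt_sq (norm_nonneg _)]

theorem l2Norm_nonneg : 0 ≤ l2Norm U u := Real.sqrt_nonneg _

theorem MemL2.integrable_formInner (hu : MemL2 U u) (hv : MemL2 U v) :
    IntegrableOn (fun x => formInner (u x) (v x)) U := by
  refine (L2.integrable_inner (𝕜 := ℝ) (cls U u) (cls U v)).congr ?_
  filter_upwards [coeFn_cls hu, coeFn_cls hv] with x hx hy
  rw [hx, hy, formInner_eq_inner]

theorem l2Inner_congr {u' v' : E n → Form n k} (h : u =ᵐ[volume.restrict U] u')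
    (h' : v =ᵐ[volume.restrict U] v') : l2Inner U u v = l2Inner U u' v' := by
  refine integral_congr_ae ?_
  filter_upwards [h, h'] with x hx hx'
  rw [hx, hx']

theorem l2Norm_congr {u' : E n → Form n k} (h : u =ᵐ[volume.restrict U] u') :
    l2Norm U u = l2Norm U u' := by
  rw [l2Norm, l2Norm, l2Inner_congr h h]

theorem l2Inner_add_left (hu : MemL2 U u) (hv : MemL2 U v) (hw : MemL2 U w) :
    l2Inner U (u + v) w = l2Inner U u w + l2Inner U v w := by
  rw [← inner_cls (hu.add hv) hw, cls_add hu hv, inner_add_left, inner_cls hu hw, inner_cls hv hw]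

theorem l2Inner_sub_left (hu : MemL2 U u) (hv : MemL2 U v) (hw : MemL2 U w) :
    l2Inner U (u - v) w = l2Inner U u w - l2Inner U v w := by
  rw [← inner_cls (hu.sub hv) hw, cls_sub hu hv, inner_sub_left, inner_cls hu hw, inner_cls hv hw]

theorem l2Inner_comm (u v : E n → Form n k) : l2Inner U u v = l2Inner U v u := by
  simp only [l2Inner, formInner_comm]

theorem l2Inner_le (hu : MemL2 U u) (hv : MemL2 U v) :
    |l2Inner U u v| ≤ l2Norm U u * l2Norm U v := by
  rw [← inner_cls hu hv, ← norm_cls hu, ← norm_cls hv]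
  exact abs_real_inner_le_norm _ _

theorem l2Norm_sub_le (hu : MemL2 U u) (hv : MemL2 U v) :
    l2Norm U (u - v) ≤ l2Norm U u + l2Norm U v := by
  rw [← norm_cls hu, ← norm_cls hv, ← norm_cls (hu.sub hv), cls_sub hu hv]
  exact norm_sub_le _ _

theorem l2Inner_self (u : E n → Form n k) : l2Inner U u u = l2Norm U u ^ 2 := by
  rw [l2Norm, Real.sq_sqrt]
  exact integral_nonneg fun x => by
    change 0 ≤ formInner (u x) (u x)
    rw [formInner_self]
    positivity

end L2

/-! ### Test forms and integration by parts -/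

/-- Contraction with a fixed vector, as a continuous linear map. -/
def contractCLM {n : ℕ} (k : ℕ) (v : E n) : Form n (k + 1) →L[ℝ] Form n k :=
  LinearMap.toContinuousLinearMap
    { toFun := contract v
      map_add' := contract_add_right v
      map_smul' := fun c => contract_smul_right c v }

theorem contractCLM_apply {n k : ℕ} (v : E n) (α : Form n (k + 1)) :
    contractCLM k v α = contract v α := rfl

/-- Wedging with a fixed vector, as a continuous linear map. -/
def flatWedgeCLM {n : ℕ} (k : ℕ) (v : E n) : Form n k →L[ℝ] Form n (k + 1) :=
  LinearMap.toContinuousLinearMap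
    { toFun := flatWedge v
      map_add' := flatWedge_add_right v
      map_smul' := fun c => flatWedge_smul_right c v }

theorem flatWedgeCLM_apply {n k : ℕ} (v : E n) (α : Form n k) :
    flatWedgeCLM k v α = flatWedge v α := rfl

theorem alternatizeUncurryFin_eq_sum {n k : ℕ} (f : E n →L[ℝ] Form n k) :
    ContinuousAlternatingMap.alternatizeUncurryFin f =
      ∑ i, flatWedge (stdVec n i) (f (stdVec n i)) := by
  ext w
  rw [ContinuousAlternatingMap.alternatizeUncurryFin_apply, ContinuousAlternatingMap.sum_apply]
  simp only [flatWedge_apply]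
  rw [Finset.sum_comm]
  refine Finset.sum_congr rfl fun j _ => ?_
  conv_lhs => rw [← sum_smul_stdVec (w j)]
  rw [map_sum, ContinuousAlternatingMap.sum_apply, Finset.smul_sum]
  refine Finset.sum_congr rfl fun i _ => ?_
  rw [real_inner_comm, inner_stdVec, map_smul]
  rcases Nat.even_or_odd (j : ℕ) with hj | hj <;> simp [hj.neg_one_pow]

theorem extDeriv_eq_sum {n k : ℕ} (A : E n → Form n k) (x : E n) :
    extDeriv A x = ∑ i, flatWedge (stdVec n i) (fderiv ℝ A x (stdVec n i)) :=
  alternatizeUncurryFin_eq_sum _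

section Smooth

variable {n k : ℕ} {U V : Set (E n)}

theorem contDiff_extDeriv {A : E n → Form n k} (hA : ContDiff ℝ (⊤ : ℕ∞) A) :
    ContDiff ℝ (⊤ : ℕ∞) (extDeriv A) := by
  have h : extDeriv A = fun x => ∑ i, flatWedgeCLM k (stdVec n i) (fderiv ℝ A x (stdVec n i)) := by
    ext1 x
    rw [extDeriv_eq_sum]
    rfl
  rw [h]
  have hA' : ContDiff ℝ (⊤ : ℕ∞) (fderiv ℝ A) := hA.fderiv_right (by simp)
  fun_prop

theorem contDiff_codiff {B : E n → Form n (k + 1)} (hB : ContDiff ℝ (⊤ : ℕ∞) B) :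
    ContDiff ℝ (⊤ : ℕ∞) (codiff B) := by
  have h : codiff B = fun x => -∑ i, contractCLM k (stdVec n i) (fderiv ℝ B x (stdVec n i)) := rfl
  rw [h]
  have hA' : ContDiff ℝ (⊤ : ℕ∞) (fderiv ℝ B) := hB.fderiv_right (by simp)
  fun_prop

theorem tsupport_extDeriv_subset (A : E n → Form n k) : tsupport (extDeriv A) ⊆ tsupport A := by
  refine closure_minimal (fun x hx => ?_) (isClosed_tsupport A)
  refine support_fderiv_subset ℝ (f := A) fun h => hx ?_
  simp only [extDeriv_eq_sum, h]
  exact Finset.sum_eq_zero fun i _ => (flatWedgeCLM k (stdVec n i)).map_zero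

theorem tsupport_codiff_subset (B : E n → Form n (k + 1)) : tsupport (codiff B) ⊆ tsupport B := by
  refine closure_minimal (fun x hx => ?_) (isClosed_tsupport B)
  refine support_fderiv_subset ℝ (f := B) fun h => hx ?_
  simp only [codiff, h]
  exact neg_eq_zero.2 (Finset.sum_eq_zero fun i _ => (contractCLM k (stdVec n i)).map_zero)

theorem IsTestForm.extDeriv {φ : E n → Form n k} (h : IsTestForm U φ) :
    IsTestForm U (extDeriv φ) :=
  ⟨contDiff_extDeriv h.1, h.2.1.of_isClosed_subset (isClosed_tsupport _)
    (tsupport_extDeriv_subset φ), (tsupport_extDeriv_subset φ).trans h.2.2⟩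

theorem IsTestForm.codiff {φ : E n → Form n (k + 1)} (h : IsTestForm U φ) :
    IsTestForm U (codiff φ) :=
  ⟨contDiff_codiff h.1, h.2.1.of_isClosed_subset (isClosed_tsupport _)
    (tsupport_codiff_subset φ), (tsupport_codiff_subset φ).trans h.2.2⟩

theorem IsTestForm.memL2 {φ : E n → Form n k} (h : IsTestForm U φ) : MemL2 V φ :=
  (h.1.continuous.memLp_of_hasCompactSupport h.2.1).restrict _

theorem IsTestForm.mono {φ : E n → Form n k} (h : IsTestForm U φ) (hUV : U ⊆ V) :
    IsTestForm V φ := ⟨h.1, h.2.1, h.2.2.trans hUV⟩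

theorem IsTestForm.add {φ ψ : E n → Form n k} (h : IsTestForm U φ) (h' : IsTestForm U ψ) :
    IsTestForm U (φ + ψ) :=
  ⟨h.1.add h'.1, h.2.1.add h'.2.1, (tsupport_add φ ψ).trans (union_subset h.2.2 h'.2.2)⟩

theorem IsTestForm.smul {φ : E n → Form n k} (c : ℝ) (h : IsTestForm U φ) :
    IsTestForm U (c • φ) :=
  have hs : tsupport (c • φ) ⊆ tsupport φ :=
    closure_mono fun x hx hφ => hx (by simp [hφ])
  ⟨contDiff_const.smul h.1, h.2.1.of_isClosed_subset (isClosed_tsupport _) hs, hs.trans h.2.2⟩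

theorem isTestForm_zero : IsTestForm U (0 : E n → Form n k) :=
  ⟨contDiff_const, HasCompactSupport.zero, by simp [tsupport]⟩

theorem codiff_add {φ ψ : E n → Form n (k + 1)} (h : Differentiable ℝ φ)
    (h' : Differentiable ℝ ψ) : codiff (φ + ψ) = codiff φ + codiff ψ := by
  ext1 x
  simp only [codiff, Pi.add_apply]
  rw [fderiv_add (h x) (h' x)]
  simp only [add_apply, contract_add_right, Finset.sum_add_distrib, neg_add]

theorem codiff_smul {φ : E n → Form n (k + 1)} (c : ℝ) (h : Differentiable ℝ φ) :
    codiff (c • φ) = c • codiff φ := by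
  ext1 x
  simp only [codiff, Pi.smul_apply]
  rw [fderiv_const_smul (h x) c]
  simp only [smul_apply, contract_smul_right, smul_neg,
    Finset.smul_sum]

/-- Contraction with `e_i` is adjoint to wedging with `e_i`, so this is integration by parts in each
coordinate direction. Compact support of one factor suffices for all integrands. -/
theorem integral_formInner_codiff {A : E n → Form n k} {B : E n → Form n (k + 1)}
    (hA : ContDiff ℝ (⊤ : ℕ∞) A) (hB : ContDiff ℝ (⊤ : ℕ∞) B)
    (hc : HasCompactSupport A ∨ HasCompactSupport B) :
    ∫ x, formInner (A x) (codiff B x) = ∫ x, formInner (extDeriv A x) (B x) := by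
  have hA' : ContDiff ℝ (⊤ : ℕ∞) (fderiv ℝ A) := hA.fderiv_right (by simp)
  have hB' : ContDiff ℝ (⊤ : ℕ∞) (fderiv ℝ B) := hB.fderiv_right (by simp)
  have hint : ∀ {a b : E n → EuclideanSpace ℝ (Fin k ↪o Fin n)}, Continuous a → Continuous b →
      (∀ x, (A =ᶠ[nhds x] 0 ∨ B =ᶠ[nhds x] 0) → a x = 0 ∨ b x = 0) →
      Integrable (fun x => inner ℝ (a x) (b x)) := by
    intro a b ha hb h
    refine (ha.inner hb).integrable_of_hasCompactSupport ?_
    rcases hc with hc | hc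
    · refine HasCompactSupport.intro hc fun x hx => ?_
      rcases h x (Or.inl (notMem_tsupport_iff_eventuallyEq.1 hx)) with h | h <;> simp [h]
    · refine HasCompactSupport.intro hc fun x hx => ?_
      rcases h x (Or.inr (notMem_tsupport_iff_eventuallyEq.1 hx)) with h | h <;> simp [h]
  have hfd : ∀ {j : ℕ} {F : E n → Form n j} {x}, F =ᶠ[nhds x] 0 → fderiv ℝ F x = 0 := by
    intro j F x h
    rw [h.fderiv_eq]
    simp
  let c (i : Fin n) : Form n (k + 1) →L[ℝ] EuclideanSpace ℝ (Fin k ↪o Fin n) :=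
    (vec n k : Form n k →L[ℝ] EuclideanSpace ℝ (Fin k ↪o Fin n)).comp (contractCLM k (stdVec n i))
  let ve : Form n k →L[ℝ] EuclideanSpace ℝ (Fin k ↪o Fin n) := vec n k
  have i1 : ∀ i : Fin n, Integrable fun x =>
      inner ℝ (ve (fderiv ℝ A x (stdVec n i))) (c i (B x)) := by
    intro i
    refine hint (a := fun x => ve (fderiv ℝ A x (stdVec n i))) (b := fun x => c i (B x))
      (by have := hA'.continuous; fun_prop) (by have := hB.continuous; fun_prop) ?_
    rintro x (h | h)
    · left; simp [hfd h]
    · right; simp [h.eq_of_nhds]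
  have i2 : ∀ i : Fin n, Integrable fun x =>
      inner ℝ (ve (A x)) (c i (fderiv ℝ B x (stdVec n i))) := by
    intro i
    refine hint (a := fun x => ve (A x)) (b := fun x => c i (fderiv ℝ B x (stdVec n i)))
      (by have := hA.continuous; fun_prop) (by have := hB'.continuous; fun_prop) ?_
    rintro x (h | h)
    · left; simp [h.eq_of_nhds]
    · right; simp [hfd h]
  have i3 : ∀ i : Fin n, Integrable fun x => inner ℝ (ve (A x)) (c i (B x)) := by
    intro i
    refine hint (a := fun x => ve (A x)) (b := fun x => c i (B x))
      (by have := hA.continuous; fun_prop) (by have := hB.continuous; fun_prop) ?_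
    rintro x (h | h)
    · left; simp [h.eq_of_nhds]
    · right; simp [h.eq_of_nhds]
  have hi : ∀ i : Fin n, ∫ x, inner ℝ (ve (A x)) (c i (fderiv ℝ B x (stdVec n i))) =
      -∫ x, inner ℝ (ve (fderiv ℝ A x (stdVec n i))) (c i (B x)) := by
    intro i
    exact integral_bilinear_hasFDerivAt_right_eq_neg_left_of_integrable
      (f := fun x => ve (A x)) (f' := fun x => ve.comp (fderiv ℝ A x))
      (g := fun x => c i (B x)) (g' := fun x => (c i).comp (fderiv ℝ B x)) (v := stdVec n i)
      (B := innerSL ℝ) (i1 i) (i2 i) (i3 i)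
      (fun x _ => ve.hasFDerivAt.comp x (hA.differentiable (by simp) x).hasFDerivAt)
      (fun x _ => (c i).hasFDerivAt.comp x (hB.differentiable (by simp) x).hasFDerivAt)
  calc ∫ x, formInner (A x) (codiff B x)
      = ∫ x, -∑ i, inner ℝ (ve (A x)) (c i (fderiv ℝ B x (stdVec n i))) := by
        refine integral_congr_ae (Filter.Eventually.of_forall fun x => ?_)
        simp only [codiff, formInner_neg_right, formInner_sum_right]
        simp only [formInner_eq_inner]
        rfl
    _ = ∫ x, ∑ i, inner ℝ (ve (fderiv ℝ A x (stdVec n i))) (c i (B x)) := by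
        rw [integral_neg, integral_finsetSum _ fun i _ => i2 i,
          integral_finsetSum _ fun i _ => i1 i, ← Finset.sum_neg_distrib]
        exact Finset.sum_congr rfl fun i _ => by rw [hi i, neg_neg]
    _ = ∫ x, formInner (extDeriv A x) (B x) := by
        refine integral_congr_ae (Filter.Eventually.of_forall fun x => ?_)
        simp only [extDeriv_eq_sum, formInner_sum_left, formInner_flatWedge]
        simp only [formInner_eq_inner]
        rfl

theorem l2Inner_eq_integral_of_tsupport_subset {u φ : E n → Form n k} (h : tsupport φ ⊆ U) :
    l2Inner U u φ = ∫ x, formInner (u x) (φ x) := by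
  refine setIntegral_eq_integral_of_forall_compl_eq_zero fun x hx => ?_
  rw [image_eq_zero_of_notMem_tsupport fun h' => hx (h h'), formInner_zero_right]

theorem isWeakD_of_contDiff {p : E n → Form n k} (hp : ContDiff ℝ (⊤ : ℕ∞) p)
    (hm : MemL2 U (extDeriv p)) : IsWeakD U p (extDeriv p) := by
  refine ⟨hm, fun φ hφ => ?_⟩
  rw [l2Inner_eq_integral_of_tsupport_subset hφ.codiff.2.2,
    l2Inner_eq_integral_of_tsupport_subset hφ.2.2,
    integral_formInner_codiff hp hφ.1 (Or.inr hφ.2.1)]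

theorem isWeakCodiff_of_contDiff {p : E n → Form n (k + 1)} (hp : ContDiff ℝ (⊤ : ℕ∞) p)
    (hm : MemL2 U (codiff p)) : IsWeakCodiff U p (codiff p) := by
  refine ⟨hm, fun φ hφ => ?_⟩
  rw [l2Inner_eq_integral_of_tsupport_subset hφ.extDeriv.2.2,
    l2Inner_eq_integral_of_tsupport_subset hφ.2.2]
  simp only [formInner_comm (p _), formInner_comm (codiff p _)]
  exact (integral_formInner_codiff hφ.1 hp (Or.inl hφ.2.1)).symm

/-! ### Uniqueness of weak derivatives -/

/-- Testing with `g dx^I` for scalar bump functions `g` reduces the claim to the fundamental lemma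
for each coefficient. -/
theorem MemL2.ae_eq_zero_of_forall_test {u : E n → Form n k} (hU : IsOpen U) (hu : MemL2 U u)
    (h : ∀ φ, IsTestForm U φ → l2Inner U u φ = 0) : u =ᵐ[volume.restrict U] 0 := by
  have hI : ∀ I : Fin k ↪o Fin n, ∀ᵐ x ∂volume.restrict U, x ∈ U → vec n k (u x) I = 0 := by
    intro I
    have hloc : LocallyIntegrableOn (fun x => vec n k (u x) I) U (volume.restrict U) := by
      have : MemLp (fun x => vec n k (u x) I) 2 (volume.restrict U) :=
        (EuclideanSpace.proj (𝕜 := ℝ) I).comp_memLp' hu.memLp_vec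
      exact (this.locallyIntegrable (by norm_num)).locallyIntegrableOn _
    refine hU.ae_eq_zero_of_integral_contDiff_smul_eq_zero hloc fun g hg hgc hgs => ?_
    have hsub : tsupport (fun x => g x • dxForm I) ⊆ tsupport g :=
      closure_mono fun x hx hgx => hx (by simp [hgx])
    have := h (fun x => g x • dxForm I) ⟨hg.smul contDiff_const,
      hgc.of_isClosed_subset (isClosed_tsupport _) hsub, hsub.trans hgs⟩
    rw [← this, l2Inner]
    refine integral_congr_ae (Filter.Eventually.of_forall fun x => ?_)
    change g x • vec n k (u x) I = formInner (u x) (g x • dxForm I)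
    rw [formInner_smul_right, formInner_comm, formInner_dxForm_left]
    rfl
  filter_upwards [ae_all_iff.2 hI, ae_restrict_mem hU.measurableSet] with x hx hxU
  apply (vec n k).injective
  ext I
  simpa using hx I hxU

theorem ae_eq_of_forall_test {u v : E n → Form n k} (hU : IsOpen U) (hu : MemL2 U u)
    (hv : MemL2 U v) (h : ∀ φ, IsTestForm U φ → l2Inner U u φ = l2Inner U v φ) :
    u =ᵐ[volume.restrict U] v := by
  have := (hu.sub hv).ae_eq_zero_of_forall_test hU fun φ hφ => by
    rw [l2Inner_sub_left hu hv hφ.memL2, h φ hφ, sub_self]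
  filter_upwards [this] with x hx
  exact sub_eq_zero.1 hx

theorem IsWeakD.ae_eq {u : E n → Form n k} {ξ ξ' : E n → Form n (k + 1)} (hU : IsOpen U)
    (h : IsWeakD U u ξ) (h' : IsWeakD U u ξ') : ξ =ᵐ[volume.restrict U] ξ' :=
  ae_eq_of_forall_test hU h.1 h'.1 fun φ hφ => by rw [← h.2 φ hφ, h'.2 φ hφ]

theorem IsWeakCodiff.ae_eq {u : E n → Form n (k + 1)} {ζ ζ' : E n → Form n k} (hU : IsOpen U)
    (h : IsWeakCodiff U u ζ) (h' : IsWeakCodiff U u ζ') : ζ =ᵐ[volume.restrict U] ζ' :=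
  ae_eq_of_forall_test hU h.1 h'.1 fun φ hφ => by rw [← h.2 φ hφ, h'.2 φ hφ]

theorem IsWeakD.weakD {u : E n → Form n k} {ξ : E n → Form n (k + 1)} (h : IsWeakD U u ξ) :
    IsWeakD U u (weakD U u) := by
  have h' : ∃ ξ, IsWeakD U u ξ := ⟨ξ, h⟩
  rw [HodgeFEM.weakD, dif_pos h']
  exact h'.choose_spec

theorem IsWeakCodiff.weakCodiff {u : E n → Form n (k + 1)} {ζ : E n → Form n k}
    (h : IsWeakCodiff U u ζ) : IsWeakCodiff U u (weakCodiff U u) := by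
  have h' : ∃ ζ, IsWeakCodiff U u ζ := ⟨ζ, h⟩
  rw [HodgeFEM.weakCodiff, dif_pos h']
  exact h'.choose_spec

theorem MemHd.isWeakD {u : E n → Form n k} (h : MemHd U u) : IsWeakD U u (weakD U u) :=
  h.2.choose_spec.weakD

theorem MemHdelta.isWeakCodiff {u : E n → Form n (k + 1)} (h : MemHdelta U u) :
    IsWeakCodiff U u (weakCodiff U u) :=
  h.2.choose_spec.weakCodiff

theorem IsWeakD.mono {u : E n → Form n k} {ξ : E n → Form n (k + 1)} (h : IsWeakD U u ξ)
    (hVU : V ⊆ U) : IsWeakD V u ξ := by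
  refine ⟨h.1.mono hVU, fun φ hφ => ?_⟩
  have := h.2 φ (hφ.mono hVU)
  rwa [l2Inner_eq_integral_of_tsupport_subset (hφ.mono hVU).codiff.2.2,
    l2Inner_eq_integral_of_tsupport_subset (hφ.mono hVU).2.2,
    ← l2Inner_eq_integral_of_tsupport_subset hφ.codiff.2.2,
    ← l2Inner_eq_integral_of_tsupport_subset hφ.2.2] at this

theorem IsWeakCodiff.mono {u : E n → Form n (k + 1)} {ζ : E n → Form n k}
    (h : IsWeakCodiff U u ζ) (hVU : V ⊆ U) : IsWeakCodiff V u ζ := by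
  refine ⟨h.1.mono hVU, fun φ hφ => ?_⟩
  have := h.2 φ (hφ.mono hVU)
  rwa [l2Inner_eq_integral_of_tsupport_subset (hφ.mono hVU).extDeriv.2.2,
    l2Inner_eq_integral_of_tsupport_subset (hφ.mono hVU).2.2,
    ← l2Inner_eq_integral_of_tsupport_subset hφ.extDeriv.2.2,
    ← l2Inner_eq_integral_of_tsupport_subset hφ.2.2] at this

theorem IsWeakD.congr {u u' : E n → Form n k} {ξ ξ' : E n → Form n (k + 1)} (h : IsWeakD U u ξ)
    (hu : u =ᵐ[volume.restrict U] u') (hξ : ξ =ᵐ[volume.restrict U] ξ') : IsWeakD U u' ξ' := by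
  refine ⟨h.1.congr hξ, fun φ hφ => ?_⟩
  rw [← l2Inner_congr hu Filter.EventuallyEq.rfl, ← l2Inner_congr hξ Filter.EventuallyEq.rfl,
    h.2 φ hφ]

theorem IsWeakCodiff.congr {u u' : E n → Form n (k + 1)} {ζ ζ' : E n → Form n k}
    (h : IsWeakCodiff U u ζ) (hu : u =ᵐ[volume.restrict U] u')
    (hζ : ζ =ᵐ[volume.restrict U] ζ') : IsWeakCodiff U u' ζ' := by
  refine ⟨h.1.congr hζ, fun φ hφ => ?_⟩
  rw [← l2Inner_congr hu Filter.EventuallyEq.rfl, ← l2Inner_congr hζ Filter.EventuallyEq.rfl,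
    h.2 φ hφ]

theorem IsWeakD.add {u u' : E n → Form n k} {ξ ξ' : E n → Form n (k + 1)} (h : IsWeakD U u ξ)
    (h' : IsWeakD U u' ξ') (hu : MemL2 U u) (hu' : MemL2 U u') :
    IsWeakD U (u + u') (ξ + ξ') := by
  refine ⟨h.1.add h'.1, fun φ hφ => ?_⟩
  rw [l2Inner_add_left hu hu' hφ.codiff.memL2, l2Inner_add_left h.1 h'.1 hφ.memL2, h.2 φ hφ,
    h'.2 φ hφ]

theorem IsWeakD.sub {u u' : E n → Form n k} {ξ ξ' : E n → Form n (k + 1)} (h : IsWeakD U u ξ)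
    (h' : IsWeakD U u' ξ') (hu : MemL2 U u) (hu' : MemL2 U u') :
    IsWeakD U (u - u') (ξ - ξ') := by
  refine ⟨h.1.sub h'.1, fun φ hφ => ?_⟩
  rw [l2Inner_sub_left hu hu' hφ.codiff.memL2, l2Inner_sub_left h.1 h'.1 hφ.memL2, h.2 φ hφ,
    h'.2 φ hφ]

theorem IsWeakCodiff.add {u u' : E n → Form n (k + 1)} {ζ ζ' : E n → Form n k}
    (h : IsWeakCodiff U u ζ) (h' : IsWeakCodiff U u' ζ') (hu : MemL2 U u) (hu' : MemL2 U u') :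
    IsWeakCodiff U (u + u') (ζ + ζ') := by
  refine ⟨h.1.add h'.1, fun φ hφ => ?_⟩
  rw [l2Inner_add_left hu hu' hφ.extDeriv.memL2, l2Inner_add_left h.1 h'.1 hφ.memL2, h.2 φ hφ,
    h'.2 φ hφ]

theorem IsWeakCodiff.sub {u u' : E n → Form n (k + 1)} {ζ ζ' : E n → Form n k}
    (h : IsWeakCodiff U u ζ) (h' : IsWeakCodiff U u' ζ') (hu : MemL2 U u) (hu' : MemL2 U u') :
    IsWeakCodiff U (u - u') (ζ - ζ') := by
  refine ⟨h.1.sub h'.1, fun φ hφ => ?_⟩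
  rw [l2Inner_sub_left hu hu' hφ.extDeriv.memL2, l2Inner_sub_left h.1 h'.1 hφ.memL2, h.2 φ hφ,
    h'.2 φ hφ]

end Smooth

/-! ### Adjoint relations between Hilbert spaces -/

section Adjoint

variable {X Y Z : Type*} [NormedAddCommGroup X] [InnerProductSpace ℝ X]
  [NormedAddCommGroup Y] [InnerProductSpace ℝ Y] [NormedAddCommGroup Z] [InnerProductSpace ℝ Z]

/-- `(u, ξ)` belongs to the adjoint of the linear relation `S`. -/
def IsAdjoint (S : Submodule ℝ (WithLp 2 (X × Y))) (u : Y) (ξ : X) : Prop :=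
  ∀ p ∈ S, inner ℝ u p.snd = inner ℝ ξ p.fst

theorem IsAdjoint.sub {S : Submodule ℝ (WithLp 2 (X × Y))} {u u' : Y} {ξ ξ' : X}
    (h : IsAdjoint S u ξ) (h' : IsAdjoint S u' ξ') : IsAdjoint S (u - u') (ξ - ξ') :=
  fun p hp => by rw [inner_sub_left, inner_sub_left, h p hp, h' p hp]

theorem IsAdjoint.closure {S : Submodule ℝ (WithLp 2 (X × Y))} {u : Y} {ξ : X}
    (h : IsAdjoint S u ξ) : IsAdjoint S.topologicalClosure u ξ := by
  have hcl : IsClosed {p : WithLp 2 (X × Y) | inner ℝ u p.snd = inner ℝ ξ p.fst} := by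
    refine isClosed_eq ?_ ?_
    · exact continuous_const.inner (WithLp.prod_continuous_ofLp 2 X Y).snd
    · exact continuous_const.inner (WithLp.prod_continuous_ofLp 2 X Y).fst
  intro p hp
  exact closure_minimal (fun q hq => h q hq) hcl hp

/-- A closed linear relation is its own double adjoint. -/
theorem mem_of_forall_isAdjoint [CompleteSpace X] [CompleteSpace Y]
    {S : Submodule ℝ (WithLp 2 (X × Y))} (hS : IsClosed (S : Set (WithLp 2 (X × Y)))) {x : X}
    {y : Y} (h : ∀ u ξ, IsAdjoint S u ξ → inner ℝ u y = inner ℝ ξ x) :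
    WithLp.toLp 2 (x, y) ∈ S := by
  have : CompleteSpace S := hS.completeSpace_coe
  rw [← Submodule.orthogonal_orthogonal S, Submodule.mem_orthogonal]
  intro q hq
  rw [Submodule.mem_orthogonal] at hq
  -- Orthogonality of `q` to `S` says exactly that `(q.snd, -q.fst)` lies in the adjoint relation.
  -- The claim is then `S = S^⊥⊥`.
  have h1 : IsAdjoint S q.snd (-q.fst) := by
    intro p hp
    have := hq p hp
    rw [WithLp.prod_inner_apply] at this
    change inner ℝ p.fst q.fst + inner ℝ p.snd q.snd = 0 at this
    rw [inner_neg_left]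
    linarith [real_inner_comm p.snd q.snd, real_inner_comm p.fst q.fst]
  have h2 := h _ _ h1
  rw [inner_neg_left] at h2
  rw [WithLp.prod_inner_apply]
  change inner ℝ q.fst x + inner ℝ q.snd y = 0
  linarith

/-- In a Hilbert complex, the weak solution of the Hodge Laplace problem with datum `g` splits the
right-hand side. -/
theorem exists_adjoint_of_hodge_weak [CompleteSpace X] [CompleteSpace Y] [CompleteSpace Z]
    {S : Submodule ℝ (WithLp 2 (Y × Z))} (hS : IsClosed (S : Set (WithLp 2 (Y × Z))))
    {S' : Submodule ℝ (WithLp 2 (X × Y))} (hS' : IsClosed (S' : Set (WithLp 2 (X × Y))))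
    (hcomplex : ∀ p ∈ S', WithLp.toLp 2 (p.snd, (0 : Z)) ∈ S)
    {ξ : X} {ζ : Z} {g : Y}
    (hw : ∀ μ μ' μ'', IsAdjoint S' μ μ' → WithLp.toLp 2 (μ, μ'') ∈ S →
      inner ℝ ξ μ' + inner ℝ ζ μ'' = inner ℝ g μ) :
    (∃ a, WithLp.toLp 2 (ξ, a) ∈ S') ∧ ∃ b, IsAdjoint S ζ b := by
  constructor
  -- Here `K` is the kernel of `S` (closed codifferential), which contains the range of `S'`. The
  -- witness `a` is the projection of `g` onto `K`.
  · let K : Submodule ℝ Y :=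
      { carrier := {r | WithLp.toLp 2 (r, (0 : Z)) ∈ S}
        add_mem' := fun {a b} ha hb => by
          have := S.add_mem ha hb
          rwa [← WithLp.toLp_add, Prod.mk_add_mk, add_zero] at this
        zero_mem' := S.zero_mem
        smul_mem' := fun c a ha => by
          have := S.smul_mem c ha
          rwa [← WithLp.toLp_smul, Prod.smul_mk, smul_zero] at this }
    have hK : IsClosed (K : Set Y) :=
      hS.preimage ((WithLp.prod_continuous_toLp 2 Y Z).comp (by fun_prop : Continuous fun r : Y =>
        (r, (0 : Z))))
    have : CompleteSpace K := hK.completeSpace_coe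
    obtain ⟨a, ha, a', ha', hga⟩ := K.exists_add_mem_mem_orthogonal g
    refine ⟨a, mem_of_forall_isAdjoint hS' fun u u' hu => ?_⟩
    obtain ⟨r, hr, b, hb, hub⟩ := K.exists_add_mem_mem_orthogonal u
    -- The part `b` of `u` orthogonal to `K` is orthogonal to the range of `S'`, so the adjoint
    -- sends it to `0`. Thus `r = u - b` has the same image `u'` and lies in the kernel of `S`: an
    -- admissible test element that feels only `ξ`.
    have hb0 : IsAdjoint S' b 0 := by
      intro p hp
      rw [inner_zero_left, real_inner_comm]
      exact (Submodule.mem_orthogonal _ _).1 hb _ (hcomplex p hp)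
    have hr' : IsAdjoint S' r u' := by
      have := hu.sub hb0
      rwa [hub, add_sub_cancel_right, sub_zero] at this
    have h1 := hw r u' 0 hr' hr
    rw [inner_zero_right, add_zero] at h1
    rw [real_inner_comm ξ u', h1, hga, hub, inner_add_left, inner_add_left, real_inner_comm a r,
      (Submodule.mem_orthogonal' _ _).1 ha' r hr, (Submodule.mem_orthogonal' _ _).1 hb a ha]
  -- Now `K` is the kernel of the adjoint of `S'` (closed forms), and the projection of `g` onto `K`
  -- is the image of `ζ`.
  · obtain ⟨K, hKc, hK⟩ : ∃ K : Submodule ℝ Y, IsClosed (K : Set Y) ∧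
        ∀ r, r ∈ K ↔ IsAdjoint S' r 0 := by
      refine ⟨(S'.map (WithLp.sndₗ 2 ℝ X Y))ᗮ, Submodule.isClosed_orthogonal _, fun r => ?_⟩
      rw [Submodule.mem_orthogonal']
      constructor
      · intro h p hp
        rw [inner_zero_left]
        exact h _ ⟨p, hp, rfl⟩
      · rintro h _ ⟨p, hp, rfl⟩
        have := h p hp
        rwa [inner_zero_left] at this
    have : CompleteSpace K := hKc.completeSpace_coe
    obtain ⟨a, ha, a', ha', hga⟩ := K.exists_add_mem_mem_orthogonal g
    refine ⟨a, ?_⟩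
    intro p hp
    obtain ⟨r, hr, b, hb, hub⟩ := K.exists_add_mem_mem_orthogonal p.fst
    -- By the double adjoint it is enough that `b` is orthogonal to every value `σ` of the adjoint
    -- of `S`. These values lie in `K` by the complex property, and `b` is orthogonal to `K`.
    have hb0 : WithLp.toLp 2 (b, (0 : Z)) ∈ S := by
      refine mem_of_forall_isAdjoint hS fun τ σ hτ => ?_
      rw [inner_zero_right]
      symm
      refine (Submodule.mem_orthogonal _ _).1 hb σ ((hK σ).2 fun q hq => ?_)
      have := hτ _ (hcomplex q hq)
      rw [inner_zero_left]
      simpa using this.symm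
    have hr' : WithLp.toLp 2 (r, p.snd) ∈ S := by
      have := S.sub_mem hp hb0
      have h2 : p - WithLp.toLp 2 (b, (0 : Z)) = WithLp.toLp 2 (r, p.snd) := by
        have h3 : p = WithLp.toLp 2 (p.fst, p.snd) := rfl
        rw [h3, ← WithLp.toLp_sub, Prod.mk_sub_mk, sub_zero]
        change WithLp.toLp 2 (p.fst - b, p.snd) = _
        rw [hub, add_sub_cancel_right]
        rfl
      rwa [h2] at this
    have h1 := hw r 0 p.snd ((hK r).1 hr) hr'
    rw [inner_zero_right, zero_add] at h1
    rw [h1, hga, hub, inner_add_left, inner_add_right,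
      (Submodule.mem_orthogonal' _ _).1 ha' r hr, (Submodule.mem_orthogonal _ _).1 hb a ha]

end Adjoint

/-! ### The spaces `H*₀Λᵏ` and regularity of the weak solution -/

section Regularity

variable {n k : ℕ} {U : Set (E n)}

/-- The graph of the codifferential on test forms. -/
def testGraph (U : Set (E n)) (k : ℕ) : Submodule ℝ (WithLp 2 (LTwo U (k + 1) × LTwo U k)) where
  carrier := {p | ∃ φ : E n → Form n (k + 1), IsTestForm U φ ∧
    p = WithLp.toLp 2 (cls U φ, cls U (codiff φ))}
  add_mem' := by
    rintro _ _ ⟨φ, hφ, rfl⟩ ⟨ψ, hψ, rfl⟩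
    refine ⟨φ + ψ, hφ.add hψ, ?_⟩
    rw [cls_add hφ.memL2 hψ.memL2,
      codiff_add (hφ.1.differentiable (by simp)) (hψ.1.differentiable (by simp)),
      cls_add hφ.codiff.memL2 hψ.codiff.memL2]
    rfl
  zero_mem' := by
    refine ⟨0, isTestForm_zero, ?_⟩
    have h : codiff (0 : E n → Form n (k + 1)) = 0 := by
      have := codiff_smul (0 : ℝ) (differentiable_const (0 : Form n (k + 1)) (𝕜 := ℝ) (E := E n))
      simp only [zero_smul] at this
      exact this
    rw [h, cls_zero, cls_zero]
    rfl
  smul_mem' := by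
    rintro c _ ⟨φ, hφ, rfl⟩
    refine ⟨c • φ, hφ.smul c, ?_⟩
    rw [cls_smul c hφ.memL2, codiff_smul c (hφ.1.differentiable (by simp)),
      cls_smul c hφ.codiff.memL2]
    rfl

/-- The graph of the codifferential on `H*₀Λ^{k+1}(U)`. -/
def zeroGraph (U : Set (E n)) (k : ℕ) : Submodule ℝ (WithLp 2 (LTwo U (k + 1) × LTwo U k)) :=
  (testGraph U k).topologicalClosure

theorem isClosed_zeroGraph : IsClosed (zeroGraph U k : Set (WithLp 2 (LTwo U (k + 1) × LTwo U k))) :=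
  Submodule.isClosed_topologicalClosure _

/-- The definition of the weak derivative is adjointness to `codiff` on test forms, and taking the
closure of a relation does not change its adjoint. -/
theorem isWeakD_iff_isAdjoint {u : E n → Form n k} {ξ : E n → Form n (k + 1)} (hu : MemL2 U u)
    (hξ : MemL2 U ξ) : IsWeakD U u ξ ↔ IsAdjoint (zeroGraph U k) (cls U u) (cls U ξ) := by
  constructor
  · intro h
    refine IsAdjoint.closure ?_
    rintro _ ⟨φ, hφ, rfl⟩
    change inner ℝ (cls U u) (cls U (codiff φ)) = inner ℝ (cls U ξ) (cls U φ)
    rw [inner_cls hu hφ.codiff.memL2, inner_cls hξ hφ.memL2, h.2 φ hφ]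
  · intro h
    refine ⟨hξ, fun φ hφ => ?_⟩
    have := h _ (Submodule.le_topologicalClosure _ ⟨φ, hφ, rfl⟩)
    change inner ℝ (cls U u) (cls U (codiff φ)) = inner ℝ (cls U ξ) (cls U φ) at this
    rwa [inner_cls hu hφ.codiff.memL2, inner_cls hξ hφ.memL2] at this

theorem isWeakCodiff_of_mem_zeroGraph {u : E n → Form n (k + 1)} {ζ : E n → Form n k}
    (hu : MemL2 U u) (hζ : MemL2 U ζ) (h : WithLp.toLp 2 (cls U u, cls U ζ) ∈ zeroGraph U k) :
    IsWeakCodiff U u ζ := by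
  refine ⟨hζ, fun φ hφ => ?_⟩
  have h1 : IsWeakD U φ (extDeriv φ) := isWeakD_of_contDiff hφ.1 hφ.extDeriv.memL2
  have h2 := (isWeakD_iff_isAdjoint hφ.memL2 hφ.extDeriv.memL2).1 h1 _ h
  change inner ℝ (cls U φ) (cls U ζ) = inner ℝ (cls U (extDeriv φ)) (cls U u) at h2
  rw [inner_cls hφ.memL2 hζ, inner_cls hφ.extDeriv.memL2 hu] at h2
  rw [l2Inner_comm u, l2Inner_comm ζ, h2]

theorem memHdeltaZero_of_mem_zeroGraph {u : E n → Form n (k + 1)} {ζ : E n → Form n k}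
    (hU : IsOpen U) (hu : MemL2 U u) (hζ : MemL2 U ζ)
    (h : WithLp.toLp 2 (cls U u, cls U ζ) ∈ zeroGraph U k) : MemHdeltaZero U u := by
  have hw := isWeakCodiff_of_mem_zeroGraph hu hζ h
  refine ⟨⟨hu, ζ, hw⟩, fun ε hε => ?_⟩
  have hcl : WithLp.toLp 2 (cls U u, cls U ζ) ∈ closure (testGraph U k : Set (WithLp 2 (LTwo U (k + 1) × LTwo U k))) := h
  obtain ⟨_, ⟨φ, hφ, rfl⟩, hd⟩ := Metric.mem_closure_iff.1 hcl (ε / 2) (by positivity)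
  refine ⟨φ, hφ, ?_⟩
  have hw' := hw.weakCodiff
  -- `weakCodiff` is a chosen representative. On an open set uniqueness identifies its class with
  -- that of `ζ`.
  have hζ' : cls U (weakCodiff U u) = cls U ζ :=
    (cls_eq_cls_iff hw'.1 hζ).2 (hw'.ae_eq hU hw)
  rw [← norm_cls (hu.sub hφ.memL2), ← norm_cls (hw'.1.sub hφ.codiff.memL2),
    cls_sub hu hφ.memL2, cls_sub hw'.1 hφ.codiff.memL2, hζ']
  rw [dist_eq_norm, ← WithLp.toLp_sub, Prod.mk_sub_mk] at hd
  have h1 := WithLp.norm_fst_le _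
    (WithLp.toLp 2 (cls U u - cls U φ, cls U ζ - cls U (codiff φ)))
  have h2 := WithLp.norm_snd_le _
    (WithLp.toLp 2 (cls U u - cls U φ, cls U ζ - cls U (codiff φ)))
  change ‖cls U u - cls U φ‖ ≤ _ at h1
  change ‖cls U ζ - cls U (codiff φ)‖ ≤ _ at h2
  linarith

theorem MemHdeltaZero.mem_zeroGraph {u : E n → Form n (k + 1)} (h : MemHdeltaZero U u) :
    WithLp.toLp 2 (cls U u, cls U (weakCodiff U u)) ∈ zeroGraph U k := by
  have hw := h.1.isWeakCodiff
  have hu := h.1.1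
  change _ ∈ closure (testGraph U k : Set (WithLp 2 (LTwo U (k + 1) × LTwo U k)))
  refine Metric.mem_closure_iff.2 fun ε hε => ?_
  obtain ⟨φ, hφ, hlt⟩ := h.2 ε hε
  refine ⟨_, ⟨φ, hφ, rfl⟩, ?_⟩
  rw [← norm_cls (hu.sub hφ.memL2), ← norm_cls (hw.1.sub hφ.codiff.memL2),
    cls_sub hu hφ.memL2, cls_sub hw.1 hφ.codiff.memL2] at hlt
  rw [dist_eq_norm, ← WithLp.toLp_sub, Prod.mk_sub_mk]
  refine lt_of_le_of_lt ?_ hlt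
  rw [WithLp.prod_norm_eq_of_L2]
  change √(‖cls U u - cls U φ‖ ^ 2 + ‖cls U (weakCodiff U u) - cls U (codiff φ)‖ ^ 2) ≤ _
  refine Real.sqrt_le_iff.2 ⟨by positivity, ?_⟩
  nlinarith [norm_nonneg (cls U u - cls U φ),
    norm_nonneg (cls U (weakCodiff U u) - cls U (codiff φ))]

theorem memHdeltaZero_zero (hU : IsOpen U) : MemHdeltaZero U (0 : E n → Form n (k + 1)) := by
  refine memHdeltaZero_of_mem_zeroGraph hU memL2_zero (memL2_zero (k := k)) ?_
  rw [cls_zero, cls_zero]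
  exact (zeroGraph U k).zero_mem

/-- Integration by parts without boundary term for `u ∈ HΛᵏ` and `η ∈ H*₀Λ^{k+1}`. -/
theorem l2Inner_weakCodiff {u : E n → Form n k} {η : E n → Form n (k + 1)} (hu : MemHd U u)
    (hη : MemHdeltaZero U η) : l2Inner U u (weakCodiff U η) = l2Inner U (weakD U u) η := by
  have h := (isWeakD_iff_isAdjoint hu.1 hu.isWeakD.1).1 hu.isWeakD _ hη.mem_zeroGraph
  rw [← inner_cls hu.1 hη.1.isWeakCodiff.1, ← inner_cls hu.isWeakD.1 hη.1.1]
  exact h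

/-- On test forms `δδ = 0` follows by duality from `dd = 0`. The property then passes to the
closure. -/
theorem zeroGraph_complex (hU : IsOpen U) :
    ∀ p ∈ zeroGraph U (k + 1), WithLp.toLp 2 (p.snd, (0 : LTwo U k)) ∈ zeroGraph U k := by
  have h1 : ∀ p ∈ testGraph U (k + 1), WithLp.toLp 2 (p.snd, (0 : LTwo U k)) ∈ zeroGraph U k := by
    rintro _ ⟨φ, hφ, rfl⟩
    refine Submodule.le_topologicalClosure _ ⟨codiff φ, hφ.codiff, ?_⟩
    have h2 : codiff (codiff φ) =ᵐ[volume.restrict U] 0 := by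
      refine hφ.codiff.codiff.memL2.ae_eq_zero_of_forall_test hU fun ψ hψ => ?_
      rw [l2Inner_comm, l2Inner_eq_integral_of_tsupport_subset hφ.codiff.codiff.2.2,
        integral_formInner_codiff hψ.1 hφ.codiff.1 (Or.inl hψ.2.1),
        integral_formInner_codiff hψ.extDeriv.1 hφ.1 (Or.inl hψ.extDeriv.2.1),
        extDeriv_extDeriv hψ.1 (by simpa using WithTop.coe_le_coe.2 (le_top : (2 : ℕ∞) ≤ ⊤))]
      simp [formInner_zero_left]
    rw [(cls_eq_cls_iff hφ.codiff.codiff.memL2 memL2_zero).2 h2, cls_zero]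
    rfl
  have hcl : IsClosed {p : WithLp 2 (LTwo U (k + 2) × LTwo U (k + 1)) |
      WithLp.toLp 2 (p.snd, (0 : LTwo U k)) ∈ zeroGraph U k} :=
    isClosed_zeroGraph.preimage ((WithLp.prod_continuous_toLp 2 _ _).comp
      ((WithLp.prod_continuous_ofLp 2 _ _).snd.prodMk continuous_const))
  intro p hp
  exact closure_minimal (fun q hq => h1 q hq) hcl hp

theorem weakD_isWeakD_of_isAdjoint {u : E n → Form n k} {b : LTwo U (k + 1)} (hu : MemL2 U u)
    (h : IsAdjoint (zeroGraph U k) (cls U u) b) : MemHd U u := by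
  obtain ⟨ξ, hξ, rfl⟩ := exists_cls_eq b
  exact ⟨hu, ξ, (isWeakD_iff_isAdjoint hu hξ).2 h⟩

/-- The weak equation with datum `f - ω` is the hypothesis of `exists_adjoint_of_hodge_weak`, where
`S'` and `S` are the codifferentials with zero boundary condition in the two consecutive degrees. -/
theorem IsSolution.regularity {m : ℕ} {Ω : Set (E n)} (hΩ : IsOpen Ω)
    {f ω : E n → Form n (m + 1)} (hf : MemL2 Ω f) (h : IsSolution Ω f ω) :
    MemHdeltaZero Ω (weakD Ω ω) ∧ MemHd Ω (weakCodiff Ω ω) := by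
  obtain ⟨hd, hδ, heq⟩ := h
  have hdω := hd.isWeakD
  have hδω := hδ.1.isWeakCodiff
  have key := exists_adjoint_of_hodge_weak (S := zeroGraph Ω m) isClosed_zeroGraph
    (S' := zeroGraph Ω (m + 1)) isClosed_zeroGraph (zeroGraph_complex hΩ)
    (ξ := cls Ω (weakD Ω ω)) (ζ := cls Ω (weakCodiff Ω ω)) (g := cls Ω (f - ω)) ?_
  · obtain ⟨⟨a, ha⟩, b, hb⟩ := key
    refine ⟨?_, weakD_isWeakD_of_isAdjoint hδω.1 hb⟩
    obtain ⟨a', ha', rfl⟩ := exists_cls_eq a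
    exact memHdeltaZero_of_mem_zeroGraph hΩ hdω.1 ha' ha
  · intro μ μ' μ'' hμ hμ'
    obtain ⟨μ, hm, rfl⟩ := exists_cls_eq μ
    obtain ⟨μ', hm', rfl⟩ := exists_cls_eq μ'
    obtain ⟨μ'', hm'', rfl⟩ := exists_cls_eq μ''
    have h1 : IsWeakD Ω μ μ' := (isWeakD_iff_isAdjoint hm hm').2 hμ
    have h2 : MemHdeltaZero Ω μ := memHdeltaZero_of_mem_zeroGraph hΩ hm hm'' hμ'
    have h3 := isWeakCodiff_of_mem_zeroGraph hm hm'' hμ'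
    have h4 := heq μ ⟨hm, _, h1⟩ h2
    rw [inner_cls hdω.1 hm', inner_cls hδω.1 hm'', inner_cls (hf.sub hd.1) hm,
      l2Inner_sub_left hf hd.1 hm, ← h4,
      l2Inner_congr Filter.EventuallyEq.rfl (h1.weakD.ae_eq hΩ h1),
      l2Inner_congr Filter.EventuallyEq.rfl (h3.weakCodiff.ae_eq hΩ h3)]
    ring

/-- The strong form `f = ω + δ d ω + d δ ω` of the equation, tested with `w ∈ L²`. -/
theorem IsSolution.l2Inner_eq {m : ℕ} {Ω : Set (E n)} (hΩ : IsOpen Ω)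
    {f ω : E n → Form n (m + 1)} (hf : MemL2 Ω f) (h : IsSolution Ω f ω)
    {w : E n → Form n (m + 1)} (hw : MemL2 Ω w) :
    l2Inner Ω f w = l2Inner Ω ω w + l2Inner Ω (weakCodiff Ω (weakD Ω ω)) w
      + l2Inner Ω (weakD Ω (weakCodiff Ω ω)) w := by
  obtain ⟨h1, h2⟩ := h.regularity hΩ hf
  obtain ⟨hd, hδ, heq⟩ := h
  have hdω := hd.isWeakD
  have hδω := hδ.1.isWeakCodiff
  have hδd := h1.1.isWeakCodiff
  have hdδ := h2.isWeakD
  -- Test forms are admissible in the weak equation and determine `L²` forms, so the strong equation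
  -- holds almost everywhere. It may then be paired with any `w ∈ L²`, in particular with a
  -- discontinuous discrete form.
  have key : f =ᵐ[volume.restrict Ω]
      ω + weakCodiff Ω (weakD Ω ω) + weakD Ω (weakCodiff Ω ω) := by
    refine ae_eq_of_forall_test hΩ hf ((hd.1.add hδd.1).add hdδ.1) fun φ hφ => ?_
    have e1 : IsWeakD Ω φ (extDeriv φ) := isWeakD_of_contDiff hφ.1 hφ.extDeriv.memL2
    have e2 : IsWeakCodiff Ω φ (codiff φ) := isWeakCodiff_of_contDiff hφ.1 hφ.codiff.memL2
    have e3 : MemHdeltaZero Ω φ := memHdeltaZero_of_mem_zeroGraph hΩ hφ.memL2 hφ.codiff.memL2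
      (Submodule.le_topologicalClosure _ ⟨φ, hφ, rfl⟩)
    have e4 := heq φ ⟨hφ.memL2, _, e1⟩ e3
    rw [l2Inner_congr Filter.EventuallyEq.rfl (e1.weakD.ae_eq hΩ e1),
      l2Inner_congr Filter.EventuallyEq.rfl (e2.weakCodiff.ae_eq hΩ e2), hδd.2 φ hφ,
      hdδ.2 φ hφ] at e4
    rw [l2Inner_add_left (hd.1.add hδd.1) hdδ.1 hφ.memL2, l2Inner_add_left hd.1 hδd.1 hφ.memL2]
    linarith
  rw [l2Inner_congr key Filter.EventuallyEq.rfl, l2Inner_add_left (hd.1.add hδd.1) hdδ.1 hw,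
    l2Inner_add_left hd.1 hδd.1 hw]

end Regularity

/-! ### Forms with polynomial coefficients -/

section Polynomial

variable {n k : ℕ}

/-- The constant form. -/
def constForm {n k : ℕ} (α : Form n k) : E n → Form n k := fun _ => α

/-- The Koszul form `ι_{x - c} α`. -/
def koszulForm {n k : ℕ} (c : E n) (α : Form n (k + 1)) : E n → Form n k :=
  fun x => contract (x - c) α

/-- The form `(x - c)^♭ ∧ β`. -/
def wedgeForm {n k : ℕ} (c : E n) (β : Form n k) : E n → Form n (k + 1) :=
  fun x => flatWedge (x - c) β

/-- The quadratic form on `T` whose exterior derivative is `2 (x - c)^♭ ∧ q`. -/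
def quadForm {n k : ℕ} (T : Affine.Simplex ℝ (E n) n) (q : Form n k) : E n → Form n k :=
  fun x => ∑ I : Fin k ↪o Fin n, (coeff q I * ∑ j ∈ (Finset.univ.map I.toEmbedding)ᶜ,
    ((x j - center T j) ^ 2 - secondMoment T j)) • dxForm I

/-- `v ↦ v^♭ ∧ β` as a continuous linear map. -/
def flatWedgeLeft {n k : ℕ} (β : Form n k) : E n →L[ℝ] Form n (k + 1) :=
  LinearMap.toContinuousLinearMap
    { toFun := fun v => flatWedge v β
      map_add' := fun v w => flatWedge_add_left v w β
      map_smul' := fun c v => flatWedge_smul_left c v β }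

theorem flatWedgeLeft_apply (β : Form n k) (v : E n) : flatWedgeLeft β v = flatWedge v β := rfl

theorem koszulForm_eq (c : E n) (α : Form n (k + 1)) :
    koszulForm c α = fun x => α.curryLeft (x - c) := rfl

theorem wedgeForm_eq (c : E n) (β : Form n k) :
    wedgeForm c β = fun x => flatWedgeLeft β (x - c) := rfl

theorem contDiff_constForm (α : Form n k) : ContDiff ℝ (⊤ : ℕ∞) (constForm α) := contDiff_const

theorem contDiff_koszulForm (c : E n) (α : Form n (k + 1)) :
    ContDiff ℝ (⊤ : ℕ∞) (koszulForm c α) := by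
  rw [koszulForm_eq]
  fun_prop

theorem contDiff_wedgeForm (c : E n) (β : Form n k) :
    ContDiff ℝ (⊤ : ℕ∞) (wedgeForm c β) := by
  rw [wedgeForm_eq]
  fun_prop

theorem contDiff_quadForm (T : Affine.Simplex ℝ (E n) n) (q : Form n k) :
    ContDiff ℝ (⊤ : ℕ∞) (quadForm T q) := by
  unfold quadForm
  fun_prop

theorem fderiv_koszulForm (c : E n) (α : Form n (k + 1)) (x : E n) :
    fderiv ℝ (koszulForm c α) x = α.curryLeft := by
  have : HasFDerivAt (koszulForm c α) (α.curryLeft.comp (ContinuousLinearMap.id ℝ (E n))) x :=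
    α.curryLeft.hasFDerivAt.comp x ((hasFDerivAt_id x).sub_const c)
  rw [this.fderiv]
  rfl

theorem fderiv_wedgeForm (c : E n) (β : Form n k) (x : E n) :
    fderiv ℝ (wedgeForm c β) x = flatWedgeLeft β := by
  have : HasFDerivAt (wedgeForm c β) ((flatWedgeLeft β).comp (ContinuousLinearMap.id ℝ (E n))) x :=
    (flatWedgeLeft β).hasFDerivAt.comp x ((hasFDerivAt_id x).sub_const c)
  rw [this.fderiv]
  rfl

/-! ### Derivatives of the four kinds of polynomial forms. -/

theorem extDeriv_constForm (α : Form n k) : extDeriv (constForm α) = 0 := by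
  ext1 x
  rw [extDeriv_eq_sum]
  refine Finset.sum_eq_zero fun i _ => ?_
  have : fderiv ℝ (constForm α) x = 0 := fderiv_const_apply α
  rw [this]
  exact (flatWedgeCLM k (stdVec n i)).map_zero

theorem codiff_constForm (α : Form n (k + 1)) : codiff (constForm α) = 0 := by
  ext1 x
  have : fderiv ℝ (constForm α) x = 0 := fderiv_const_apply α
  rw [codiff, this]
  exact neg_eq_zero.2 (Finset.sum_eq_zero fun i _ => (contractCLM k (stdVec n i)).map_zero)

theorem extDeriv_koszulForm (c : E n) (α : Form n (k + 1)) :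
    extDeriv (koszulForm c α) = ((k : ℝ) + 1) • constForm α := by
  ext1 x
  rw [extDeriv, fderiv_koszulForm, ContinuousAlternatingMap.alternatizeUncurryFin_curryLeft]
  change _ = ((k : ℝ) + 1) • α
  rw [← Nat.cast_succ, Nat.cast_smul_eq_nsmul]

theorem codiff_koszulForm (c : E n) (α : Form n (k + 2)) : codiff (koszulForm c α) = 0 := by
  ext1 x
  rw [codiff]
  refine neg_eq_zero.2 (Finset.sum_eq_zero fun i _ => ?_)
  rw [fderiv_koszulForm]
  exact contract_contract_self _ _

theorem extDeriv_wedgeForm (c : E n) (β : Form n k) : extDeriv (wedgeForm c β) = 0 := by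
  ext1 x
  rw [extDeriv_eq_sum]
  refine Finset.sum_eq_zero fun i _ => ?_
  rw [fderiv_wedgeForm]
  exact flatWedge_flatWedge_self _ _

theorem codiff_wedgeForm (c : E n) (β : Form n k) :
    codiff (wedgeForm c β) = (-((n : ℝ) - k)) • constForm β := by
  ext1 x
  rw [codiff, fderiv_wedgeForm]
  change -∑ i, contract (stdVec n i) (flatWedge (stdVec n i) β) = (-((n : ℝ) - k)) • β
  rw [sum_contract_flatWedge]
  module

theorem fderiv_quadForm (T : Affine.Simplex ℝ (E n) n) (q : Form n k) (x : E n) (i : Fin n) :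
    fderiv ℝ (quadForm T q) x (stdVec n i) = ∑ I : Fin k ↪o Fin n, coeff q I •
      (if i ∈ range I then (0 : ℝ) else 2 * (x i - center T i)) • dxForm I := by
  simp only [smul_smul]
  have hj : ∀ j : Fin n, HasFDerivAt (fun x : E n => (x j - center T j) ^ 2 - secondMoment T j)
      ((2 * (x j - center T j)) • (EuclideanSpace.proj (𝕜 := ℝ) j : E n →L[ℝ] ℝ)) x := by
    intro j
    have h1 : HasFDerivAt (fun x : E n => x j) (EuclideanSpace.proj (𝕜 := ℝ) j : E n →L[ℝ] ℝ) x :=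
      (EuclideanSpace.proj (𝕜 := ℝ) j : E n →L[ℝ] ℝ).hasFDerivAt
    simpa using ((h1.sub_const (center T j)).pow 2).sub_const (secondMoment T j)
  have hI : HasFDerivAt (quadForm T q) (∑ I : Fin k ↪o Fin n,
      (coeff q I • ∑ j ∈ (Finset.univ.map I.toEmbedding)ᶜ, (2 * (x j - center T j)) •
        (EuclideanSpace.proj (𝕜 := ℝ) j : E n →L[ℝ] ℝ)).smulRight (dxForm I)) x := by
    unfold quadForm
    refine HasFDerivAt.fun_sum fun I _ => ?_
    exact ((HasFDerivAt.fun_sum fun j _ => hj j).const_mul (coeff q I)).smul_const (dxForm I)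
  rw [hI.fderiv, sum_apply]
  refine Finset.sum_congr rfl fun I _ => ?_
  rw [ContinuousLinearMap.smulRight_apply, smul_apply, sum_apply, smul_eq_mul]
  congr 2
  have h2 : ∀ j, ((2 * (x j - center T j)) • (EuclideanSpace.proj (𝕜 := ℝ) j : E n →L[ℝ] ℝ))
      (stdVec n i) = if j = i then 2 * (x i - center T i) else 0 := by
    intro j
    split_ifs with h
    · subst h
      simp [stdVec]
    · simp [stdVec, h]
  rw [Finset.sum_congr rfl fun j _ => h2 j, Finset.sum_ite_eq']
  by_cases h : i ∈ range I
  · rw [if_pos h, if_neg]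
    obtain ⟨b, hb⟩ := h
    simp [← hb]
  · rw [if_neg h, if_pos]
    simpa using h

/-- The squares omitted for `j ∈ I` would contribute `dx^j ∧ dx^I = 0`, so the result is that of
differentiating `|x - c|² q`. -/
theorem extDeriv_quadForm (T : Affine.Simplex ℝ (E n) n) (q : Form n k) :
    extDeriv (quadForm T q) = (2 : ℝ) • wedgeForm (center T) q := by
  ext1 x
  rw [extDeriv_eq_sum]
  simp only [fderiv_quadForm]
  have h1 : ∀ i : Fin n, flatWedge (stdVec n i) (∑ I : Fin k ↪o Fin n, coeff q I •
      (if i ∈ range I then (0 : ℝ) else 2 * (x i - center T i)) • dxForm I) =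
      (2 * (x i - center T i)) • flatWedge (stdVec n i) q := by
    intro i
    conv_rhs => rw [← sum_coeff_smul_dxForm q]
    rw [← flatWedgeCLM_apply, ← flatWedgeCLM_apply, map_sum, map_sum, Finset.smul_sum]
    refine Finset.sum_congr rfl fun I _ => ?_
    split_ifs with h
    · obtain ⟨b, rfl⟩ := h
      simp [flatWedge_dxForm_of_mem, map_smul, flatWedgeCLM_apply]
      exact (flatWedgeCLM k _).map_zero
    · rw [map_smul, map_smul, map_smul, smul_comm]
  rw [Finset.sum_congr rfl fun i _ => h1 i]
  change _ = (2 : ℝ) • flatWedgeLeft q (x - center T)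
  rw [← sum_smul_stdVec (x - center T), map_sum, Finset.smul_sum]
  refine Finset.sum_congr rfl fun i _ => ?_
  rw [map_smul, smul_smul]
  rfl

/-- For `i ∈ I` the coefficient of `dx^I` does not depend on `x_i`, and for `i ∉ I` contraction with
`e_i` kills `dx^I`. The enrichment thus enlarges the range of `d` without disturbing `δ`. -/
theorem codiff_quadForm (T : Affine.Simplex ℝ (E n) n) (q : Form n (k + 1)) :
    codiff (quadForm T q) = 0 := by
  ext1 x
  rw [codiff]
  refine neg_eq_zero.2 (Finset.sum_eq_zero fun i _ => ?_)
  rw [fderiv_quadForm, ← contractCLM_apply, map_sum]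
  refine Finset.sum_eq_zero fun I _ => ?_
  split_ifs with h
  · simp
  · rw [map_smul, map_smul, contractCLM_apply, contract_dxForm_of_notMem I i h, smul_zero,
      smul_zero]

theorem coeff_quadForm (T : Affine.Simplex ℝ (E n) n) (q : Form n k) (x : E n)
    (J : Fin k ↪o Fin n) : coeff (quadForm T q x) J =
      coeff q J * ∑ j ∈ (Finset.univ.map J.toEmbedding)ᶜ,
        ((x j - center T j) ^ 2 - secondMoment T j) := by
  rw [← formInner_dxForm_left, quadForm, formInner_sum_right]
  have h : ∀ I : Fin k ↪o Fin n, formInner (dxForm J) ((coeff q I *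
      ∑ j ∈ (Finset.univ.map I.toEmbedding)ᶜ,
        ((x j - center T j) ^ 2 - secondMoment T j)) • dxForm I) =
      if I = J then coeff q J * ∑ j ∈ (Finset.univ.map J.toEmbedding)ᶜ,
        ((x j - center T j) ^ 2 - secondMoment T j) else 0 := by
    intro I
    rw [formInner_smul_right, formInner_dxForm_left,
      coeff_dxForm]
    split_ifs with h
    · rw [h, mul_one]
    · simp
  rw [Finset.sum_congr rfl fun I _ => h I]
  simp

/-! ### Parametrisation of the polynomial spaces. -/

theorem constForm_mem (α : Form n k) : constForm α ∈ constForms n k :=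
  Submodule.subset_span ⟨α, rfl⟩

theorem koszulForm_mem (c : E n) (α : Form n (k + 1)) : koszulForm c α ∈ koszulForms n k c :=
  Submodule.subset_span ⟨α, rfl⟩

theorem wedgeForm_mem (c : E n) (β : Form n k) : wedgeForm c β ∈ starKoszulStarForms n k c :=
  Submodule.subset_span ⟨β, rfl⟩

theorem quadForm_mem (T : Affine.Simplex ℝ (E n) n) (q : Form n k) :
    quadForm T q ∈ quadForms k T := by
  have h : quadForm T q = ∑ I : Fin k ↪o Fin n, coeff q I • fun x : E n =>
      (∑ j ∈ (Finset.univ.map I.toEmbedding)ᶜ,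
        ((x j - center T j) ^ 2 - secondMoment T j)) • dxForm I := by
    funext x
    rw [Finset.sum_apply]
    exact Finset.sum_congr rfl fun I _ => mul_smul _ _ _
  rw [h]
  exact Submodule.sum_mem _ fun I _ => Submodule.smul_mem _ _ (Submodule.subset_span ⟨I, rfl⟩)

theorem exists_constForm_eq {p : E n → Form n k} (h : p ∈ constForms n k) :
    ∃ α, p = constForm α := by
  induction h using Submodule.span_induction with
  | mem p hp => obtain ⟨α, rfl⟩ := hp; exact ⟨α, rfl⟩
  | zero => exact ⟨0, rfl⟩
  | add p q _ _ hp hq =>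
    obtain ⟨α, rfl⟩ := hp
    obtain ⟨β, rfl⟩ := hq
    exact ⟨α + β, rfl⟩
  | smul a p _ hp => obtain ⟨α, rfl⟩ := hp; exact ⟨a • α, rfl⟩

theorem exists_koszulForm_eq {c : E n} {p : E n → Form n k} (h : p ∈ koszulForms n k c) :
    ∃ α, p = koszulForm c α := by
  induction h using Submodule.span_induction with
  | mem p hp => obtain ⟨α, rfl⟩ := hp; exact ⟨α, rfl⟩
  | zero => exact ⟨0, rfl⟩
  | add p q _ _ hp hq =>
    obtain ⟨α, rfl⟩ := hp
    obtain ⟨β, rfl⟩ := hq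
    exact ⟨α + β, rfl⟩
  | smul a p _ hp => obtain ⟨α, rfl⟩ := hp; exact ⟨a • α, rfl⟩

theorem wedgeForm_add (c : E n) (α β : Form n k) :
    wedgeForm c (α + β) = wedgeForm c α + wedgeForm c β :=
  funext fun _ => flatWedge_add_right _ _ _

theorem wedgeForm_smul (c : E n) (a : ℝ) (β : Form n k) :
    wedgeForm c (a • β) = a • wedgeForm c β :=
  funext fun _ => flatWedge_smul_right _ _ _

theorem exists_wedgeForm_eq {c : E n} {p : E n → Form n (k + 1)}
    (h : p ∈ starKoszulStarForms n k c) : ∃ β, p = wedgeForm c β := by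
  induction h using Submodule.span_induction with
  | mem p hp => obtain ⟨α, rfl⟩ := hp; exact ⟨α, rfl⟩
  | zero => exact ⟨0, funext fun x => ((flatWedgeCLM k (x - c)).map_zero).symm⟩
  | add p q _ _ hp hq =>
    obtain ⟨α, rfl⟩ := hp
    obtain ⟨β, rfl⟩ := hq
    exact ⟨α + β, (wedgeForm_add c α β).symm⟩
  | smul a p _ hp => obtain ⟨α, rfl⟩ := hp; exact ⟨a • α, (wedgeForm_smul c a α).symm⟩

/-- Members of `P₁⁻Λᵏ`, recentred at `c`. -/
theorem exists_eq_of_mem_trimmed (c : E n) {p : E n → Form n k} (h : p ∈ trimmed n k) :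
    ∃ τ γ, p = constForm τ + koszulForm c γ := by
  obtain ⟨a, ha, b, hb, rfl⟩ := Submodule.mem_sup.1 h
  obtain ⟨α, rfl⟩ := exists_constForm_eq ha
  obtain ⟨γ, rfl⟩ := exists_koszulForm_eq hb
  refine ⟨α + contract c γ, γ, funext fun x => ?_⟩
  simp only [Pi.add_apply, constForm, koszulForm, contract_sub_left, sub_zero]
  abel

/-- Members of `P₁^{*,-}Λ^{k+1}`, recentred at `c`. -/
theorem exists_eq_of_mem_trimmedStar (c : E n) {p : E n → Form n (k + 1)}
    (h : p ∈ trimmedStar n k) : ∃ η γ, p = constForm η + wedgeForm c γ := by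
  obtain ⟨a, ha, b, hb, rfl⟩ := Submodule.mem_sup.1 h
  obtain ⟨α, rfl⟩ := exists_constForm_eq ha
  obtain ⟨γ, rfl⟩ := exists_wedgeForm_eq hb
  refine ⟨α + flatWedge c γ, γ, funext fun x => ?_⟩
  simp only [Pi.add_apply, constForm, wedgeForm, ← flatWedgeLeft_apply, map_sub, sub_zero]
  abel

end Polynomial

/-! ### Geometry of a simplex -/

section Geometry

variable {n k : ℕ} (T : Affine.Simplex ℝ (E n) n)

theorem isCompact_body : IsCompact (body T) := (Set.finite_range _).isCompact_convexHull (𝕜 := ℝ)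

theorem convex_body : Convex ℝ (body T) := convex_convexHull ℝ _

theorem isOpen_cell : IsOpen (cell T) := isOpen_interior

theorem cell_subset_body : cell T ⊆ body T := interior_subset

theorem ae_eq_cell_body : cell T =ᵐ[volume] body T :=
  interior_ae_eq_of_null_frontier ((convex_body T).addHaar_frontier volume)

theorem volume_cell_lt_top : volume (cell T) < ⊤ :=
  (measure_mono (cell_subset_body T)).trans_lt (isCompact_body T).measure_lt_top

instance : IsFiniteMeasure (volume.restrict (cell T)) :=
  ⟨by rw [Measure.restrict_apply_univ]; exact volume_cell_lt_top T⟩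

/-- The volume of a simplex. -/
def cellVolume : ℝ := volume.real (cell T)

variable {T}

theorem integrableOn_cell {F : Type*} [NormedAddCommGroup F] {f : E n → F} (hf : Continuous f) :
    IntegrableOn f (cell T) :=
  (hf.continuousOn.integrableOn_compact (isCompact_body T)).mono_set (cell_subset_body T)

theorem memL2_cell {u : E n → Form n k} (hu : Continuous u) : MemL2 (cell T) u := by
  obtain ⟨C, hC⟩ := (isCompact_body T).exists_bound_of_continuousOn hu.continuousOn
  refine MemLp.of_bound hu.aestronglyMeasurable C ?_
  filter_upwards [ae_restrict_mem (isOpen_cell T).measurableSet] with x hx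
  exact hC x (cell_subset_body T hx)

theorem cellVolume_pos (h : (cell T).Nonempty) : 0 < cellVolume T :=
  ENNReal.toReal_pos ((isOpen_cell T).measure_pos volume h).ne' (volume_cell_lt_top T).ne

theorem norm_sub_le_diam {x y : E n} (hx : x ∈ body T) (hy : y ∈ body T) :
    ‖x - y‖ ≤ Metric.diam (body T) := by
  rw [← dist_eq_norm]
  exact Metric.dist_le_diam_of_mem (isCompact_body T).isBounded hx hy

theorem neZero_restrict_cell (h : (cell T).Nonempty) : NeZero (volume.restrict (cell T)) :=
  ⟨fun h0 => ((isOpen_cell T).measure_pos volume h).ne' (Measure.restrict_eq_zero.1 h0)⟩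

theorem center_mem_body (h : (cell T).Nonempty) : center T ∈ body T := by
  have := neZero_restrict_cell h
  refine (convex_body T).average_mem (isCompact_body T).isClosed ?_ (integrableOn_cell continuous_id)
  filter_upwards [ae_restrict_mem (isOpen_cell T).measurableSet] with x hx
  exact cell_subset_body T hx

theorem norm_sub_center_le (h : (cell T).Nonempty) {x : E n} (hx : x ∈ cell T) :
    ‖x - center T‖ ≤ Metric.diam (body T) :=
  norm_sub_le_diam (cell_subset_body T hx) (center_mem_body h)

theorem sq_sub_center_le (h : (cell T).Nonempty) {x : E n} (hx : x ∈ cell T) (j : Fin n) :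
    (x j - center T j) ^ 2 ≤ Metric.diam (body T) ^ 2 := by
  have h1 : |(x - center T) j| ≤ ‖x - center T‖ := PiLp.norm_apply_le (x - center T) j
  have h2 := h1.trans (norm_sub_center_le h hx)
  rw [← sq_abs]
  exact pow_le_pow_left₀ (abs_nonneg _) h2 2

theorem secondMoment_mem_Icc (h : (cell T).Nonempty) (j : Fin n) :
    secondMoment T j ∈ Icc 0 (Metric.diam (body T) ^ 2) := by
  have := neZero_restrict_cell h
  refine (convex_Icc _ _).average_mem isClosed_Icc ?_ (integrableOn_cell (by fun_prop))
  filter_upwards [ae_restrict_mem (isOpen_cell T).measurableSet] with x hx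
  exact ⟨sq_nonneg _, sq_sub_center_le h hx j⟩

theorem cellVolume_nonneg : 0 ≤ cellVolume T := measureReal_nonneg

/-- The centre is the mean of `x` over the simplex. This makes Koszul and wedge forms orthogonal to
constants, while subtracting `secondMoment` does the same for the quadratic forms. -/
theorem integral_continuousLinearMap_sub_center (l : E n →L[ℝ] ℝ) :
    ∫ x in cell T, l (x - center T) = 0 := by
  rw [l.integral_comp_comm (integrableOn_cell (f := fun x : E n => x - center T) (by fun_prop))]
  have : ∫ x in cell T, (x - center T) = 0 := MeasureTheory.integral_sub_average _ _
  rw [this, map_zero]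

theorem l2Inner_constForm (α β : Form n k) :
    l2Inner (cell T) (constForm α) (constForm β) = cellVolume T * formInner α β := by
  simp [l2Inner, constForm, cellVolume]

theorem l2Norm_constForm (α : Form n k) :
    l2Norm (cell T) (constForm α) = √(cellVolume T) * ‖vec n k α‖ := by
  rw [l2Norm, l2Inner_constForm, formInner_self, Real.sqrt_mul cellVolume_nonneg,
    Real.sqrt_sq (norm_nonneg _)]

theorem l2Inner_constForm_koszulForm (α : Form n k) (γ : Form n (k + 1)) :
    l2Inner (cell T) (constForm α) (koszulForm (center T) γ) = 0 := by
  let l : E n →L[ℝ] ℝ :=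
    ((innerSL ℝ (vec n k α)).comp (vec n k : Form n k →L[ℝ] _)).comp γ.curryLeft
  rw [← integral_continuousLinearMap_sub_center (T := T) l]
  refine integral_congr_ae (Filter.Eventually.of_forall fun x => ?_)
  exact formInner_eq_inner _ _

theorem l2Inner_constForm_wedgeForm (α : Form n (k + 1)) (γ : Form n k) :
    l2Inner (cell T) (constForm α) (wedgeForm (center T) γ) = 0 := by
  let l : E n →L[ℝ] ℝ :=
    ((innerSL ℝ (vec n (k + 1) α)).comp (vec n (k + 1) : Form n (k + 1) →L[ℝ] _)).comp
      (flatWedgeLeft γ)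
  rw [← integral_continuousLinearMap_sub_center (T := T) l]
  refine integral_congr_ae (Filter.Eventually.of_forall fun x => ?_)
  exact formInner_eq_inner _ _

theorem l2Inner_constForm_quadForm (α q : Form n k) :
    l2Inner (cell T) (constForm α) (quadForm T q) = 0 := by
  have h1 : ∀ x, formInner (constForm α x) (quadForm T q x) =
      ∑ J : Fin k ↪o Fin n, ∑ j ∈ (Finset.univ.map J.toEmbedding)ᶜ, (coeff α J * coeff q J) *
        ((x j - center T j) ^ 2 - secondMoment T j) := by
    intro x
    rw [formInner]
    refine Finset.sum_congr rfl fun J _ => ?_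
    rw [coeff_quadForm, ← mul_assoc, Finset.mul_sum]
    rfl
  rw [l2Inner]
  simp only [h1]
  rw [integral_finsetSum _ fun J _ => integrableOn_cell (by fun_prop)]
  refine Finset.sum_eq_zero fun J _ => ?_
  rw [integral_finsetSum _ fun j _ => integrableOn_cell (by fun_prop)]
  refine Finset.sum_eq_zero fun j _ => ?_
  rw [integral_const_mul]
  have : ∫ x in cell T, ((x j - center T j) ^ 2 - secondMoment T j) = 0 :=
    MeasureTheory.integral_sub_average _ _
  rw [this, mul_zero]

/-! ### Upper bounds with the right powers of the diameter. -/

theorem l2Norm_cell_le {u : E n → Form n k} {M : ℝ} (hM : 0 ≤ M) (hu : Continuous u)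
    (h : ∀ x ∈ cell T, ‖vec n k (u x)‖ ≤ M) : l2Norm (cell T) u ≤ M * √(cellVolume T) := by
  refine Real.sqrt_le_iff.2 ⟨by positivity, ?_⟩
  rw [mul_pow, Real.sq_sqrt cellVolume_nonneg]
  have hu' : Continuous fun x => formInner (u x) (u x) := by
    simp only [formInner_self]
    fun_prop
  have h1 : l2Inner (cell T) u u ≤ ∫ _ in cell T, M ^ 2 := by
    refine setIntegral_mono_on (integrableOn_cell hu') (integrableOn_cell continuous_const)
      (isOpen_cell T).measurableSet fun x hx => ?_
    rw [formInner_self]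
    exact pow_le_pow_left₀ (norm_nonneg _) (h x hx) 2
  refine h1.trans (le_of_eq ?_)
  simp [cellVolume, mul_comm]

theorem l2Norm_koszulForm_le (h : (cell T).Nonempty) (α : Form n (k + 1)) :
    l2Norm (cell T) (koszulForm (center T) α) ≤
      √n * Metric.diam (body T) * (√(cellVolume T) * ‖vec n (k + 1) α‖) := by
  have hd : 0 ≤ Metric.diam (body T) := Metric.diam_nonneg
  refine (l2Norm_cell_le (M := √n * Metric.diam (body T) * ‖vec n (k + 1) α‖) (by positivity)
    (contDiff_koszulForm _ _).continuous fun x hx => ?_).trans (le_of_eq (by ring))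
  refine (norm_contract_le _ _).trans ?_
  gcongr
  exact norm_sub_center_le h hx

theorem l2Norm_wedgeForm_le (h : (cell T).Nonempty) (β : Form n k) :
    l2Norm (cell T) (wedgeForm (center T) β) ≤
      √n * Metric.diam (body T) * (√(cellVolume T) * ‖vec n k β‖) := by
  have hd : 0 ≤ Metric.diam (body T) := Metric.diam_nonneg
  refine (l2Norm_cell_le (M := √n * Metric.diam (body T) * ‖vec n k β‖) (by positivity)
    (contDiff_wedgeForm _ _).continuous fun x hx => ?_).trans (le_of_eq (by ring))
  refine (norm_flatWedge_le _ _).trans ?_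
  gcongr
  exact norm_sub_center_le h hx

theorem l2Norm_quadForm_le (h : (cell T).Nonempty) (q : Form n k) :
    l2Norm (cell T) (quadForm T q) ≤
      n * Metric.diam (body T) ^ 2 * (√(cellVolume T) * ‖vec n k q‖) := by
  set d := Metric.diam (body T) with hd
  refine (l2Norm_cell_le (M := n * d ^ 2 * ‖vec n k q‖) (by positivity)
    (contDiff_quadForm _ _).continuous fun x hx => ?_).trans (le_of_eq (by ring))
  refine abs_le_of_sq_le_sq' ?_ (by positivity) |>.2
  rw [mul_pow, ← formInner_self, ← formInner_self, formInner, formInner, Finset.mul_sum]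
  refine Finset.sum_le_sum fun J _ => ?_
  rw [coeff_quadForm]
  set s := ∑ j ∈ (Finset.univ.map J.toEmbedding)ᶜ, ((x j - center T j) ^ 2 - secondMoment T j)
  have hs : |s| ≤ n * d ^ 2 := by
    refine (Finset.abs_sum_le_sum_abs _ _).trans ?_
    have h1 : ∀ j ∈ (Finset.univ.map J.toEmbedding)ᶜ,
        |(x j - center T j) ^ 2 - secondMoment T j| ≤ d ^ 2 := by
      intro j _
      have h2 := sq_sub_center_le h hx j
      obtain ⟨h3, h4⟩ := secondMoment_mem_Icc h j
      rw [abs_le]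
      constructor <;> nlinarith [sq_nonneg (x j - center T j)]
    refine (Finset.sum_le_card_nsmul _ _ _ h1).trans ?_
    rw [nsmul_eq_mul]
    gcongr
    simpa using Finset.card_le_univ (Finset.univ.map J.toEmbedding)ᶜ
  have hs2 : s ^ 2 ≤ (n * d ^ 2) ^ 2 := sq_le_sq' (abs_le.1 hs).1 (abs_le.1 hs).2
  calc coeff q J * s * (coeff q J * s) = s ^ 2 * (coeff q J * coeff q J) := by ring
    _ ≤ _ := by
      gcongr
      exact mul_self_nonneg _

end Geometry

/-! ### Coercivity of the quadratic bubbles -/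

section Coercivity

variable {n k : ℕ} {T : Affine.Simplex ℝ (E n) n}

theorem norm_sq_add_sub_ge {F : Type*} [NormedAddCommGroup F] [InnerProductSpace ℝ F] (a b : F) :
    2 * ‖b‖ ^ 2 ≤ ‖a + b‖ ^ 2 + ‖a - b‖ ^ 2 := by
  have := parallelogram_law_with_norm ℝ a b
  nlinarith [norm_nonneg a]

theorem setIntegral_closedBall_add {f : E n → ℝ} (x v : E n) (r : ℝ) :
    ∫ z in Metric.closedBall x r, f (z + v) = ∫ z in Metric.closedBall (x + v) r, f z := by
  rw [← integral_indicator Metric.isClosed_closedBall.measurableSet,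
    ← integral_indicator Metric.isClosed_closedBall.measurableSet,
    ← integral_add_right_eq_self (fun z => (Metric.closedBall (x + v) r).indicator f z) v]
  refine integral_congr_ae (Filter.Eventually.of_forall fun z => ?_)
  simp only [indicator, Metric.mem_closedBall, dist_add_right]

/-- The form is affine in `x` with linear part `v ↦ v^♭ ∧ q`. Comparing its values at `z ± (ρ/2)
e_i`, the parallelogram law removes the unknown value at `z`. For `z` in the ball of radius `ρ/2`
both points stay in the inscribed ball. -/
theorem ball_mul_norm_sq_le_wedgeForm {x₀ : E n} {ρ : ℝ} (hρ : 0 < ρ)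
    (hball : Metric.closedBall x₀ ρ ⊆ body T) (q : Form n k) (i : Fin n) :
    volume.real (Metric.closedBall (0 : E n) (ρ / 2)) *
      ((ρ / 2) ^ 2 * ‖vec n (k + 1) (flatWedge (stdVec n i) q)‖ ^ 2) ≤
      l2Norm (cell T) (wedgeForm (center T) q) ^ 2 := by
  set g : E n → ℝ := fun x => ‖vec n (k + 1) (wedgeForm (center T) q x)‖ ^ 2 with hg
  have hgc : Continuous g := by
    have := (contDiff_wedgeForm (center T) q).continuous
    fun_prop
  have hX : l2Norm (cell T) (wedgeForm (center T) q) ^ 2 = ∫ x in body T, g x := by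
    rw [← l2Inner_self, l2Inner, ← setIntegral_congr_set (ae_eq_cell_body T)]
    simp only [formInner_self, hg]
  have hint : ∀ y : E n, IntegrableOn g (Metric.closedBall y (ρ / 2)) := fun y =>
    hgc.continuousOn.integrableOn_compact (isCompact_closedBall y _)
  have hnorm : ‖(ρ / 2) • stdVec n i‖ = ρ / 2 := by
    rw [norm_smul, stdVec, PiLp.norm_single, norm_one, mul_one, Real.norm_eq_abs,
      abs_of_pos (by positivity)]
  have hle : ∀ v : E n, ‖v‖ = ρ / 2 →
      ∫ z in Metric.closedBall x₀ (ρ / 2), g (z + v) ≤ ∫ x in body T, g x := by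
    intro v hv
    rw [setIntegral_closedBall_add]
    refine setIntegral_mono_set (hgc.continuousOn.integrableOn_compact (isCompact_body T))
      (Filter.Eventually.of_forall fun x => by positivity) (LE.le.eventuallyLE ?_)
    refine (Metric.closedBall_subset_closedBall' ?_).trans hball
    rw [dist_eq_norm, add_sub_cancel_left, hv]
    linarith
  have h1 := hle _ hnorm
  have h2 := hle (-((ρ / 2) • stdVec n i)) (by rw [norm_neg, hnorm])
  have h3 : ∫ _ in Metric.closedBall x₀ (ρ / 2),
      2 * ((ρ / 2) ^ 2 * ‖vec n (k + 1) (flatWedge (stdVec n i) q)‖ ^ 2) ≤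
      ∫ z in Metric.closedBall x₀ (ρ / 2),
        (g (z + (ρ / 2) • stdVec n i) + g (z + -((ρ / 2) • stdVec n i))) := by
    refine setIntegral_mono ?_ ?_ fun z => ?_
    · exact continuous_const.continuousOn.integrableOn_compact (isCompact_closedBall _ _)
    · exact (by fun_prop : Continuous fun z => g (z + (ρ / 2) • stdVec n i)
        + g (z + -((ρ / 2) • stdVec n i))).continuousOn.integrableOn_compact
        (isCompact_closedBall _ _)
    · have h4 : ∀ v : E n, wedgeForm (center T) q (z + v) =
          wedgeForm (center T) q z + flatWedge v q := by
        intro v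
        simp only [wedgeForm]
        rw [add_sub_right_comm, flatWedge_add_left]
      simp only [hg, h4]
      have h5 : flatWedge (-((ρ / 2) • stdVec n i)) q = -flatWedge ((ρ / 2) • stdVec n i) q := by
        rw [← flatWedgeLeft_apply, map_neg, flatWedgeLeft_apply]
      rw [h5, map_add, map_add, map_neg, ← sub_eq_add_neg]
      refine le_trans (le_of_eq ?_) (norm_sq_add_sub_ge _ _)
      rw [flatWedge_smul_left, map_smul, norm_smul, Real.norm_eq_abs, mul_pow, sq_abs]
  have hv : ∀ v : E n, IntegrableOn (fun z => g (z + v)) (Metric.closedBall x₀ (ρ / 2)) := fun v =>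
    (by fun_prop : Continuous fun z => g (z + v)).continuousOn.integrableOn_compact
      (isCompact_closedBall _ _)
  rw [integral_add (hv _) (hv _), setIntegral_const, smul_eq_mul] at h3
  have h6 : volume.real (Metric.closedBall x₀ (ρ / 2)) =
      volume.real (Metric.closedBall (0 : E n) (ρ / 2)) := by
    simp only [Measure.real, Measure.addHaar_closedBall_center]
  rw [h6] at h3
  rw [hX]
  linarith

/-- The simplex lies in the ball about `x₀` of radius `diam ≤ σρ = 2σ · (ρ/2)`, a dilation of the
half-radius ball by `2σ`. -/
theorem cellVolume_le {x₀ : E n} {ρ σ : ℝ} (hρ : 0 < ρ)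
    (hball : Metric.closedBall x₀ ρ ⊆ body T) (hσ : Metric.diam (body T) ≤ σ * ρ) :
    cellVolume T ≤ (2 * σ) ^ n * volume.real (Metric.closedBall (0 : E n) (ρ / 2)) := by
  have hx₀ : x₀ ∈ body T := hball (Metric.mem_closedBall_self hρ.le)
  have hσ0 : 0 ≤ σ := by
    have : 0 ≤ σ * ρ := Metric.diam_nonneg.trans hσ
    exact nonneg_of_mul_nonneg_left this hρ
  have hsub : cell T ⊆ Metric.closedBall x₀ (2 * σ * (ρ / 2)) := by
    intro x hx
    rw [Metric.mem_closedBall]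
    refine (Metric.dist_le_diam_of_mem (isCompact_body T).isBounded
      (cell_subset_body T hx) hx₀).trans (hσ.trans (le_of_eq (by ring)))
  have h1 : cellVolume T ≤ volume.real (Metric.closedBall x₀ (2 * σ * (ρ / 2))) :=
    measureReal_mono hsub (isCompact_closedBall _ _).measure_lt_top.ne
  refine h1.trans (le_of_eq ?_)
  rw [Measure.real, Measure.addHaar_closedBall_mul volume x₀ (by positivity) (by positivity),
    ENNReal.toReal_mul, ENNReal.toReal_ofReal (by positivity)]
  simp [Measure.real]

/-- Summing the previous bound over all directions `e_i` recovers `(n - k)|q|²`, which controls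
`|q|²` because `k < n`. Shape regularity exchanges `ρ` for the diameter and the small ball for the
whole simplex. -/
theorem diam_mul_norm_le_wedgeForm (hkn : k + 1 ≤ n) {x₀ : E n} {ρ σ : ℝ} (hρ : 0 < ρ)
    (hball : Metric.closedBall x₀ ρ ⊆ body T) (hσ : Metric.diam (body T) ≤ σ * ρ)
    (q : Form n k) :
    Metric.diam (body T) * (√(cellVolume T) * ‖vec n k q‖) ≤
      √(4 * n * σ ^ 2 * (2 * |σ|) ^ n) * l2Norm (cell T) (wedgeForm (center T) q) := by
  set X := l2Norm (cell T) (wedgeForm (center T) q) with hX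
  set W := volume.real (Metric.closedBall (0 : E n) (ρ / 2)) with hW
  set d := Metric.diam (body T) with hd
  have hσ0 : 0 ≤ σ := by
    have : 0 ≤ σ * ρ := Metric.diam_nonneg.trans hσ
    exact nonneg_of_mul_nonneg_left this hρ
  rw [abs_of_nonneg hσ0]
  have hV0 : 0 ≤ cellVolume T := cellVolume_nonneg
  have hV : cellVolume T ≤ (2 * σ) ^ n * W := cellVolume_le hρ hball hσ
  have hd0 : 0 ≤ d := Metric.diam_nonneg
  have hW0 : 0 ≤ W := measureReal_nonneg
  have h1 : W * ((ρ / 2) ^ 2 * ‖vec n k q‖ ^ 2) ≤ n * X ^ 2 := by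
    have h2 : ∑ i : Fin n, W * ((ρ / 2) ^ 2 * ‖vec n (k + 1) (flatWedge (stdVec n i) q)‖ ^ 2) ≤
        ∑ _i : Fin n, X ^ 2 :=
      Finset.sum_le_sum fun i _ => ball_mul_norm_sq_le_wedgeForm hρ hball q i
    rw [← Finset.mul_sum, ← Finset.mul_sum, sum_norm_sq_flatWedge_stdVec] at h2
    simp only [Finset.sum_const, Finset.card_univ, Fintype.card_fin, nsmul_eq_mul] at h2
    refine le_trans ?_ h2
    have h3 : (1 : ℝ) ≤ (n : ℝ) - k := by
      have : ((k + 1 : ℕ) : ℝ) ≤ n := Nat.cast_le.2 hkn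
      push_cast at this
      linarith
    gcongr
    nlinarith [sq_nonneg ‖vec n k q‖]
  refine abs_le_of_sq_le_sq' ?_ (mul_nonneg (Real.sqrt_nonneg _) l2Norm_nonneg) |>.2
  rw [mul_pow, mul_pow, mul_pow, Real.sq_sqrt hV0, Real.sq_sqrt (by positivity)]
  calc d ^ 2 * (cellVolume T * ‖vec n k q‖ ^ 2)
      ≤ (σ * ρ) ^ 2 * ((2 * σ) ^ n * W * ‖vec n k q‖ ^ 2) := by gcongr
    _ = 4 * σ ^ 2 * (2 * σ) ^ n * (W * ((ρ / 2) ^ 2 * ‖vec n k q‖ ^ 2)) := by ring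
    _ ≤ 4 * σ ^ 2 * (2 * σ) ^ n * (n * X ^ 2) := by gcongr
    _ = 4 * n * σ ^ 2 * (2 * σ) ^ n * X ^ 2 := by ring

end Coercivity

/-! ### The local interpolant -/

section Local

variable {n k : ℕ} {T : Affine.Simplex ℝ (E n) n}

theorem memL2_constForm (α : Form n k) : MemL2 (cell T) (constForm α) :=
  memL2_cell (contDiff_constForm α).continuous

theorem memL2_koszulForm (c : E n) (α : Form n (k + 1)) : MemL2 (cell T) (koszulForm c α) :=
  memL2_cell (contDiff_koszulForm c α).continuous

theorem memL2_wedgeForm (c : E n) (β : Form n k) : MemL2 (cell T) (wedgeForm c β) :=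
  memL2_cell (contDiff_wedgeForm c β).continuous

theorem memL2_quadForm (q : Form n k) : MemL2 (cell T) (quadForm T q) :=
  memL2_cell (contDiff_quadForm T q).continuous

variable (T k) in
/-- Constant forms in `L²(T)`. -/
def constCls : Form n k →ₗ[ℝ] LTwo (cell T) k where
  toFun α := cls (cell T) (constForm α)
  map_add' α β := cls_add (memL2_constForm α) (memL2_constForm β)
  map_smul' c α := cls_smul c (memL2_constForm α)

variable (T k) in
/-- Koszul forms in `L²(T)`. -/
def koszulCls : Form n (k + 1) →ₗ[ℝ] LTwo (cell T) k where
  toFun α := cls (cell T) (koszulForm (center T) α)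
  map_add' α β := cls_add (memL2_koszulForm _ α) (memL2_koszulForm _ β)
  map_smul' c α := cls_smul c (memL2_koszulForm _ α)

variable (T k) in
/-- The forms `(x - c)^♭ ∧ β` in `L²(T)`. -/
def wedgeCls : Form n k →ₗ[ℝ] LTwo (cell T) (k + 1) where
  toFun α := cls (cell T) (wedgeForm (center T) α)
  map_add' α β := by
    rw [wedgeForm_add]
    exact cls_add (memL2_wedgeForm _ α) (memL2_wedgeForm _ β)
  map_smul' c α := by
    rw [wedgeForm_smul]
    exact cls_smul c (memL2_wedgeForm _ α)

theorem norm_constCls (α : Form n k) :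
    ‖constCls k T α‖ = √(cellVolume T) * ‖vec n k α‖ := by
  rw [← l2Norm_constForm, ← norm_cls (memL2_constForm α)]
  rfl

theorem inner_constCls_koszulCls (α : Form n k) (γ : Form n (k + 1)) :
    inner ℝ (constCls k T α) (koszulCls k T γ) = 0 := by
  rw [← l2Inner_constForm_koszulForm (T := T) α γ,
    ← inner_cls (memL2_constForm α) (memL2_koszulForm _ γ)]
  rfl

theorem inner_constCls_wedgeCls (α : Form n (k + 1)) (γ : Form n k) :
    inner ℝ (constCls (k + 1) T α) (wedgeCls k T γ) = 0 := by
  rw [← l2Inner_constForm_wedgeForm (T := T) α γ,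
    ← inner_cls (memL2_constForm α) (memL2_wedgeForm _ γ)]
  rfl

theorem inner_constCls_quadForm (α q : Form n k) :
    inner ℝ (constCls k T α) (cls (cell T) (quadForm T q)) = 0 := by
  rw [← l2Inner_constForm_quadForm (T := T) α q,
    ← inner_cls (memL2_constForm α) (memL2_quadForm q)]
  rfl

/-- An injective map pulls the inner product back to a positive definite form. Each coefficient of
the local interpolant is obtained this way, with `c` the factor produced by differentiation. -/
theorem exists_inner_map_eq {F : Type*} [NormedAddCommGroup F] [InnerProductSpace ℝ F]
    (A : Form n k →ₗ[ℝ] F) (hA : ∀ q, A q = 0 → q = 0) (l : Form n k →ₗ[ℝ] ℝ) {c : ℝ}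
    (hc : c ≠ 0) : ∃ q, ∀ γ, c * inner ℝ (A q) (A γ) = l γ := by
  obtain ⟨q, hq⟩ := exists_form_of_posDef ((innerₗ F).compl₁₂ A A)
    (fun q h => hA q (inner_self_eq_zero.1 h)) (c⁻¹ • l)
  refine ⟨q, fun γ => ?_⟩
  have : inner ℝ (A q) (A γ) = c⁻¹ * l γ := hq γ
  rw [this, mul_inv_cancel_left₀ hc]

theorem extDeriv_add_fun {p q : E n → Form n k} (hp : ContDiff ℝ (⊤ : ℕ∞) p)
    (hq : ContDiff ℝ (⊤ : ℕ∞) q) : extDeriv (p + q) = extDeriv p + extDeriv q :=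
  funext fun x => extDeriv_add (hp.differentiable (by simp) x) (hq.differentiable (by simp) x)

theorem codiff_add_fun {p q : E n → Form n (k + 1)} (hp : ContDiff ℝ (⊤ : ℕ∞) p)
    (hq : ContDiff ℝ (⊤ : ℕ∞) q) : codiff (p + q) = codiff p + codiff q :=
  codiff_add (hp.differentiable (by simp)) (hq.differentiable (by simp))

/-- The general member of the enriched trimmed space. -/
def enrichedForm {m : ℕ} (T : Affine.Simplex ℝ (E n) n) (μ : Form n (m + 1)) (α : Form n (m + 2))
    (β : Form n m) (q : Form n (m + 1)) : E n → Form n (m + 1) :=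
  constForm μ + koszulForm (center T) α + wedgeForm (center T) β + quadForm T q

variable {m : ℕ} (μ : Form n (m + 1)) (α : Form n (m + 2)) (β : Form n m) (q : Form n (m + 1))

theorem contDiff_enrichedForm : ContDiff ℝ (⊤ : ℕ∞) (enrichedForm T μ α β q) :=
  (((contDiff_constForm μ).add (contDiff_koszulForm _ α)).add (contDiff_wedgeForm _ β)).add
    (contDiff_quadForm T q)

theorem enrichedForm_mem : enrichedForm T μ α β q ∈ enriched m T :=
  Submodule.add_mem_sup (Submodule.add_mem_sup (Submodule.add_mem_sup (constForm_mem μ)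
    (koszulForm_mem _ α)) (wedgeForm_mem _ β)) (quadForm_mem T q)

theorem extDeriv_enrichedForm : extDeriv (enrichedForm T μ α β q) =
    ((m : ℝ) + 2) • constForm α + (2 : ℝ) • wedgeForm (center T) q := by
  have h1 := contDiff_constForm μ
  have h2 := contDiff_koszulForm (center T) α
  have h3 := contDiff_wedgeForm (center T) β
  have h12 : ContDiff ℝ (⊤ : ℕ∞) (constForm μ + koszulForm (center T) α) := h1.add h2
  have h123 : ContDiff ℝ (⊤ : ℕ∞) (constForm μ + koszulForm (center T) α +
    wedgeForm (center T) β) := h12.add h3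
  rw [enrichedForm, extDeriv_add_fun h123 (contDiff_quadForm T q),
    extDeriv_add_fun h12 h3, extDeriv_add_fun h1 h2, extDeriv_constForm,
    extDeriv_koszulForm, extDeriv_wedgeForm, extDeriv_quadForm, zero_add, add_zero]
  push_cast
  congr 2
  ring

theorem codiff_enrichedForm : codiff (enrichedForm T μ α β q) =
    (-((n : ℝ) - m)) • constForm β := by
  have h1 := contDiff_constForm μ
  have h2 := contDiff_koszulForm (center T) α
  have h3 := contDiff_wedgeForm (center T) β
  have h12 : ContDiff ℝ (⊤ : ℕ∞) (constForm μ + koszulForm (center T) α) := h1.add h2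
  have h123 : ContDiff ℝ (⊤ : ℕ∞) (constForm μ + koszulForm (center T) α +
    wedgeForm (center T) β) := h12.add h3
  rw [enrichedForm, codiff_add_fun h123 (contDiff_quadForm T q),
    codiff_add_fun h12 h3, codiff_add_fun h1 h2, codiff_constForm,
    codiff_koszulForm, codiff_wedgeForm, codiff_quadForm, zero_add, zero_add, add_zero]

theorem cls_enrichedForm : cls (cell T) (enrichedForm T μ α β q) =
    constCls (m + 1) T μ + koszulCls (m + 1) T α + wedgeCls m T β +
      cls (cell T) (quadForm T q) := by
  have h1 : MemL2 (cell T) (constForm μ) := memL2_constForm μ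
  have h2 := memL2_koszulForm (T := T) (center T) α
  have h3 := memL2_wedgeForm (T := T) (center T) β
  rw [enrichedForm, cls_add ((h1.add h2).add h3) (memL2_quadForm q), cls_add (h1.add h2) h3,
    cls_add h1 h2]
  rfl

theorem cls_extDeriv_enrichedForm : cls (cell T) (extDeriv (enrichedForm T μ α β q)) =
    ((m : ℝ) + 2) • constCls (m + 2) T α + (2 : ℝ) • wedgeCls (m + 1) T q := by
  rw [extDeriv_enrichedForm, cls_add ((memL2_constForm α).smul _)
    ((memL2_wedgeForm _ q).smul _), cls_smul _ (memL2_constForm α),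
    cls_smul _ (memL2_wedgeForm _ q)]
  rfl

theorem cls_codiff_enrichedForm : cls (cell T) (codiff (enrichedForm T μ α β q)) =
    (-((n : ℝ) - m)) • constCls m T β := by
  rw [codiff_enrichedForm, cls_smul _ (memL2_constForm β)]
  rfl

/-- Only the constant part survives, and `d` and `δ` of Whitney forms are constant on a simplex.
Hence the terms `(p, δη)` and `(p, dτ)` involve `μ` alone. -/
theorem inner_constCls_enrichedForm (γ : Form n (m + 1)) :
    inner ℝ (cls (cell T) (enrichedForm T μ α β q)) (constCls (m + 1) T γ) =
      inner ℝ (constCls (m + 1) T μ) (constCls (m + 1) T γ) := by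
  rw [cls_enrichedForm, real_inner_comm, inner_add_right, inner_add_right, inner_add_right,
    inner_constCls_koszulCls, inner_constCls_wedgeCls, inner_constCls_quadForm, real_inner_comm]
  ring

theorem cls_trimmedStar (η : Form n (m + 2)) (γ : Form n (m + 1)) :
    cls (cell T) (constForm η + wedgeForm (center T) γ) =
      constCls (m + 2) T η + wedgeCls (m + 1) T γ :=
  cls_add (memL2_constForm η) (memL2_wedgeForm _ γ)

theorem codiff_trimmedStar (c : E n) (η : Form n (m + 2)) (γ : Form n (m + 1)) :
    codiff (constForm η + wedgeForm c γ) = (-((n : ℝ) - m - 1)) • constForm γ := by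
  rw [codiff_add_fun (contDiff_constForm η) (contDiff_wedgeForm _ γ), codiff_constForm,
    codiff_wedgeForm, zero_add]
  push_cast
  congr 1
  ring

theorem extDeriv_trimmed (c : E n) (τ : Form n m) (γ : Form n (m + 1)) :
    extDeriv (constForm τ + koszulForm c γ) = ((m : ℝ) + 1) • constForm γ := by
  rw [extDeriv_add_fun (contDiff_constForm τ) (contDiff_koszulForm _ γ), extDeriv_constForm,
    extDeriv_koszulForm, zero_add]

end Local

/-- From `c x² ≤ a x` with `c ≥ 1` and `a, x ≥ 0` one gets `c x ≤ a`. -/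
theorem mul_le_of_mul_sq_le {c x a : ℝ} (ha : 0 ≤ a) (hx : 0 ≤ x)
    (h : c * x ^ 2 ≤ a * x) : c * x ≤ a := by
  rcases hx.eq_or_lt with rfl | hx
  · simpa using ha
  · refine le_of_mul_le_mul_right ?_ hx
    linarith [h, sq x]

theorem interpolant_bound_aux {u ξ ζ S R L : ℝ} (hu : 0 ≤ u) (hξ : 0 ≤ ξ) (hζ : 0 ≤ ζ)
    (hS : 0 ≤ S) (hR : 0 ≤ R) (hL : 0 ≤ L) :
    u + S * ζ + S * ξ + S * ζ + R * (ξ + L * ζ) + (ξ + 2 * (ξ + L * ζ)) + ζ ≤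
      (4 + 2 * S + (R + 2) * (1 + L)) * (u + ξ + ζ) := by
  have h : (4 + 2 * S + (R + 2) * (1 + L)) * (u + ξ + ζ) -
      (u + S * ζ + S * ξ + S * ζ + R * (ξ + L * ζ) + (ξ + 2 * (ξ + L * ζ)) + ζ) =
      (5 + 2 * S + R + R * L + 2 * L) * u + (3 + S + R * L + 2 * L) * ξ +
        (5 + R) * ζ := by ring
  have h2 : 0 ≤ (5 + 2 * S + R + R * L + 2 * L) * u + (3 + S + R * L + 2 * L) * ξ +
        (5 + R) * ζ := by positivity
  linarith

set_option maxHeartbeats 1000000 in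
/-- The local interpolation problem in the enriched trimmed space is uniformly stable on shape
regular simplices. -/
theorem exists_local_interpolant (n m : ℕ) (hmn : m + 2 ≤ n) (σ D : ℝ) :
    ∃ C : ℝ, 0 ≤ C ∧ ∀ T : Affine.Simplex ℝ (E n) n,
      (∃ (x : E n) (ρ : ℝ), 0 < ρ ∧ Metric.closedBall x ρ ⊆ body T ∧
        Metric.diam (body T) ≤ σ * ρ) → Metric.diam (body T) ≤ D →
      ∀ (u : E n → Form n (m + 1)) (ξ : E n → Form n (m + 2)) (ζ : E n → Form n m),
        MemL2 (cell T) u → MemL2 (cell T) ξ → MemL2 (cell T) ζ →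
        ∃ p ∈ enriched m T, ContDiff ℝ (⊤ : ℕ∞) p ∧
          (∀ η ∈ trimmedStar n (m + 1), l2Inner (cell T) (extDeriv p) η
            - l2Inner (cell T) p (codiff η) = l2Inner (cell T) ξ η
            - l2Inner (cell T) u (codiff η)) ∧
          (∀ τ ∈ trimmed n m, l2Inner (cell T) (codiff p) τ
            - l2Inner (cell T) p (extDeriv τ) = l2Inner (cell T) ζ τ
            - l2Inner (cell T) u (extDeriv τ)) ∧
          l2Norm (cell T) p + l2Norm (cell T) (extDeriv p) + l2Norm (cell T) (codiff p) ≤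
            C * (l2Norm (cell T) u + l2Norm (cell T) ξ + l2Norm (cell T) ζ) := by
  set K : ℝ := √(4 * n * σ ^ 2 * (2 * |σ|) ^ n) with hK
  have hK0 : 0 ≤ K := Real.sqrt_nonneg _
  set L : ℝ := n * √n * K with hL
  have hL0 : 0 ≤ L := by positivity
  refine ⟨4 + 2 * √n * |D| + (n * |D| * K + 2) * (1 + L), by positivity, ?_⟩
  rintro T ⟨x₀, ρ, hρ, hball, hσ⟩ hD u ξ ζ hu hξ hζ
  set d := Metric.diam (body T) with hd
  have hd0 : 0 ≤ d := Metric.diam_nonneg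
  have hdD : d ≤ |D| := hD.trans (le_abs_self D)
  have hne : (cell T).Nonempty := ⟨x₀, interior_mono hball
    (by rw [interior_closedBall _ hρ.ne']; exact Metric.mem_ball_self hρ)⟩
  -- In positive dimension the inscribed ball contains points at distance `ρ`. Positivity of `d`
  -- turns the coercivity estimate into injectivity of `wedgeCls`.
  have hdpos : 0 < d := by
    have hn : Nontrivial (E n) := by
      have : Nonempty (Fin n) := ⟨⟨0, by omega⟩⟩
      infer_instance
    obtain ⟨v, hv⟩ := exists_norm_eq (E n) hρ.le
    have h1 : x₀ + v ∈ body T := hball (by simp [hv])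
    have h2 := norm_sub_le_diam h1 (hball (Metric.mem_closedBall_self hρ.le))
    rw [add_sub_cancel_left, hv] at h2
    linarith
  have hV : 0 < cellVolume T := cellVolume_pos hne
  have hsV : 0 < √(cellVolume T) := Real.sqrt_pos.2 hV
  have hn1 : (0 : ℝ) ≤ (n : ℝ) - m - 1 := by
    have : ((m + 2 : ℕ) : ℝ) ≤ n := Nat.cast_le.2 hmn
    push_cast at this
    linarith
  have hm0 : (0 : ℝ) ≤ m := Nat.cast_nonneg m
  -- injectivity
  have hc : ∀ {j : ℕ} (γ : Form n j), constCls j T γ = 0 → γ = 0 := by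
    intro j γ h
    have := norm_constCls (T := T) γ
    rw [h, norm_zero, eq_comm, mul_eq_zero, or_iff_right hsV.ne', norm_eq_zero] at this
    exact (vec n j).map_eq_zero_iff.1 this
  have hcoer : ∀ q : Form n (m + 1), d * ‖constCls (m + 1) T q‖ ≤ K * ‖wedgeCls (m + 1) T q‖ := by
    intro q
    have := diam_mul_norm_le_wedgeForm (T := T) (k := m + 1) (by omega) hρ hball hσ q
    rw [← norm_cls (memL2_wedgeForm _ q)] at this
    rw [norm_constCls]
    exact this
  have hw : ∀ q : Form n (m + 1), wedgeCls (m + 1) T q = 0 → q = 0 := by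
    intro q h
    have h1 := hcoer q
    rw [h, norm_zero, mul_zero] at h1
    have h2 : ‖constCls (m + 1) T q‖ ≤ 0 := nonpos_of_mul_nonpos_right h1 hdpos
    exact hc q (norm_le_zero_iff.1 h2)
  have hkos : ∀ {j : ℕ} (γ : Form n (j + 1)), ‖koszulCls j T γ‖ ≤
      √n * d * ‖constCls (j + 1) T γ‖ := by
    intro j γ
    have := l2Norm_koszulForm_le hne γ
    rw [← norm_cls (memL2_koszulForm _ γ)] at this
    rw [norm_constCls]
    exact this
  have hwed : ∀ {j : ℕ} (γ : Form n j), ‖wedgeCls j T γ‖ ≤ √n * d * ‖constCls j T γ‖ := by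
    intro j γ
    have := l2Norm_wedgeForm_le hne γ
    rw [← norm_cls (memL2_wedgeForm _ γ)] at this
    rw [norm_constCls]
    exact this
  have hquad : ∀ γ : Form n (m + 1), ‖cls (cell T) (quadForm T γ)‖ ≤
      n * d ^ 2 * ‖constCls (m + 1) T γ‖ := by
    intro γ
    have := l2Norm_quadForm_le hne γ
    rw [← norm_cls (memL2_quadForm γ)] at this
    rw [norm_constCls]
    exact this
  -- the data
  set Fu := cls (cell T) u with hFu
  set Fξ := cls (cell T) ξ with hFξ
  set Fζ := cls (cell T) ζ with hFζ
  -- The orthogonalities make the system triangular: constant `η` fix `α`, constant `τ` fix `β`, and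
  -- the Koszul part of `τ` fixes `μ`. The wedge part of `η` then fixes `q`, the known `μ` being
  -- eliminated; this produces the term in `ζ` with factor `(n - m - 1)/(m + 1)`.
  obtain ⟨α, hα⟩ := exists_inner_map_eq (constCls (m + 2) T) hc
    ((innerₗ _ Fξ).comp (constCls (m + 2) T)) (c := (m : ℝ) + 2) (by positivity)
  obtain ⟨β, hβ⟩ := exists_inner_map_eq (constCls m T) hc
    ((innerₗ _ Fζ).comp (constCls m T)) (c := -((n : ℝ) - m)) (by linarith)
  obtain ⟨μ, hμ⟩ := exists_inner_map_eq (constCls (m + 1) T) hc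
    (((m : ℝ) + 1) • (innerₗ _ Fu).comp (constCls (m + 1) T) -
      (innerₗ _ Fζ).comp (koszulCls m T)) (c := (m : ℝ) + 1) (by positivity)
  obtain ⟨q, hq⟩ := exists_inner_map_eq (wedgeCls (m + 1) T) hw
    ((innerₗ _ Fξ).comp (wedgeCls (m + 1) T) +
      (((n : ℝ) - m - 1) / (m + 1)) • (innerₗ _ Fζ).comp (koszulCls m T)) (c := 2) two_ne_zero
  replace hα : ∀ γ, ((m : ℝ) + 2) * inner ℝ (constCls (m + 2) T α) (constCls (m + 2) T γ) =
    inner ℝ Fξ (constCls (m + 2) T γ) := hα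
  replace hβ : ∀ γ, -((n : ℝ) - m) * inner ℝ (constCls m T β) (constCls m T γ) =
    inner ℝ Fζ (constCls m T γ) := hβ
  replace hμ : ∀ γ, ((m : ℝ) + 1) * inner ℝ (constCls (m + 1) T μ) (constCls (m + 1) T γ) =
    ((m : ℝ) + 1) * inner ℝ Fu (constCls (m + 1) T γ) - inner ℝ Fζ (koszulCls m T γ) := hμ
  replace hq : ∀ γ, 2 * inner ℝ (wedgeCls (m + 1) T q) (wedgeCls (m + 1) T γ) =
    inner ℝ Fξ (wedgeCls (m + 1) T γ) +
      (((n : ℝ) - m - 1) / (m + 1)) * inner ℝ Fζ (koszulCls m T γ) := hq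
  have hp := contDiff_enrichedForm (T := T) μ α β q
  have hpm : MemL2 (cell T) (enrichedForm T μ α β q) := memL2_cell hp.continuous
  have hdpm : MemL2 (cell T) (extDeriv (enrichedForm T μ α β q)) :=
    memL2_cell (contDiff_extDeriv hp).continuous
  have hδpm : MemL2 (cell T) (codiff (enrichedForm T μ α β q)) :=
    memL2_cell (contDiff_codiff hp).continuous
  refine ⟨enrichedForm T μ α β q, enrichedForm_mem μ α β q, hp, ?_, ?_, ?_⟩
  · intro η hη
    obtain ⟨η, γ, rfl⟩ := exists_eq_of_mem_trimmedStar (center T) hη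
    have h1 : MemL2 (cell T) (constForm η + wedgeForm (center T) γ) :=
      (memL2_constForm η).add (memL2_wedgeForm _ γ)
    have h2 : MemL2 (cell T) ((-((n : ℝ) - m - 1)) • constForm γ) := (memL2_constForm γ).smul _
    rw [codiff_trimmedStar, ← inner_cls hdpm h1, ← inner_cls hpm h2, ← inner_cls hξ h1,
      ← inner_cls hu h2, cls_smul _ (memL2_constForm γ), cls_trimmedStar,
      cls_extDeriv_enrichedForm]
    have h3 : cls (cell T) (constForm γ) = constCls (m + 1) T γ := rfl
    rw [h3, inner_smul_right, inner_smul_right, inner_constCls_enrichedForm]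
    simp only [inner_add_left, inner_add_right, real_inner_smul_left]
    rw [inner_constCls_wedgeCls, real_inner_comm _ (wedgeCls (m + 1) T q),
      inner_constCls_wedgeCls, mul_zero, mul_zero]
    have e1 := hα η
    have e2 := hμ γ
    have e3 := hq γ
    have e4 : inner ℝ (constCls (m + 1) T μ) (constCls (m + 1) T γ) =
        inner ℝ Fu (constCls (m + 1) T γ) - inner ℝ Fζ (koszulCls m T γ) / (m + 1) := by
      field_simp
      linarith
    rw [e4, e1, e3]
    ring
  · intro τ hτ
    obtain ⟨τ, γ, rfl⟩ := exists_eq_of_mem_trimmed (center T) hτ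
    have h1 : MemL2 (cell T) (constForm τ + koszulForm (center T) γ) :=
      (memL2_constForm τ).add (memL2_koszulForm _ γ)
    have h2 : MemL2 (cell T) (((m : ℝ) + 1) • constForm γ) := (memL2_constForm γ).smul _
    rw [extDeriv_trimmed, ← inner_cls hδpm h1, ← inner_cls hpm h2, ← inner_cls hζ h1,
      ← inner_cls hu h2, cls_smul _ (memL2_constForm γ),
      cls_add (memL2_constForm τ) (memL2_koszulForm _ γ), cls_codiff_enrichedForm]
    have h3 : cls (cell T) (constForm γ) = constCls (m + 1) T γ := rfl
    have h4 : cls (cell T) (constForm τ) = constCls m T τ := rfl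
    have h5 : cls (cell T) (koszulForm (center T) γ) = koszulCls m T γ := rfl
    rw [h3, h4, h5, inner_smul_right, inner_smul_right, inner_constCls_enrichedForm]
    simp only [inner_add_right, real_inner_smul_left]
    rw [inner_constCls_koszulCls, mul_zero, hβ τ, hμ γ]
    ring
  · rw [← norm_cls hpm, ← norm_cls hdpm, ← norm_cls hδpm, ← norm_cls hu, ← norm_cls hξ,
      ← norm_cls hζ, cls_enrichedForm, cls_extDeriv_enrichedForm, cls_codiff_enrichedForm,
      ← hFu, ← hFξ, ← hFζ]
    have hs : 0 ≤ √(n : ℝ) := Real.sqrt_nonneg _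
    have nu : 0 ≤ ‖Fu‖ := norm_nonneg _
    have nξ : 0 ≤ ‖Fξ‖ := norm_nonneg _
    have nζ : 0 ≤ ‖Fζ‖ := norm_nonneg _
    -- Each coefficient is bounded by testing its defining equation with itself.
    have bα : ((m : ℝ) + 2) * ‖constCls (m + 2) T α‖ ≤ ‖Fξ‖ := by
      refine mul_le_of_mul_sq_le nξ (norm_nonneg _) ?_
      rw [← real_inner_self_eq_norm_sq, hα]
      exact real_inner_le_norm _ _
    have bβ : ((n : ℝ) - m) * ‖constCls m T β‖ ≤ ‖Fζ‖ := by
      refine mul_le_of_mul_sq_le nζ (norm_nonneg _) ?_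
      have := hβ β
      rw [real_inner_self_eq_norm_sq] at this
      have h2 := abs_le.1 (abs_real_inner_le_norm Fζ (constCls m T β))
      linarith [h2.1]
    have bμ : ‖constCls (m + 1) T μ‖ ≤ ‖Fu‖ + √n * d * ‖Fζ‖ := by
      have h1 : ((m : ℝ) + 1) * ‖constCls (m + 1) T μ‖ ≤
          ((m : ℝ) + 1) * ‖Fu‖ + √n * d * ‖Fζ‖ := by
        refine mul_le_of_mul_sq_le (by positivity) (norm_nonneg _) ?_
        rw [← real_inner_self_eq_norm_sq, hμ]
        have h2 := real_inner_le_norm Fu (constCls (m + 1) T μ)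
        have h3 := (abs_le.1 (abs_real_inner_le_norm Fζ (koszulCls m T μ))).1
        have h4 := mul_le_mul_of_nonneg_left (hkos μ) nζ
        have h5 := mul_le_mul_of_nonneg_left h2 (by positivity : (0 : ℝ) ≤ m + 1)
        linarith
      have h6 : 0 ≤ √n * d * ‖Fζ‖ := by positivity
      have h7 : ((m : ℝ) + 1) * ‖constCls (m + 1) T μ‖ ≤
          ((m : ℝ) + 1) * (‖Fu‖ + √n * d * ‖Fζ‖) := by nlinarith
      exact le_of_mul_le_mul_left h7 (by positivity)
    set X := ‖wedgeCls (m + 1) T q‖ with hX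
    have hX0 : 0 ≤ X := norm_nonneg _
    have bX : X ≤ ‖Fξ‖ + L * ‖Fζ‖ := by
      have h1 : 2 * X ≤ ‖Fξ‖ + L * ‖Fζ‖ := by
        refine mul_le_of_mul_sq_le (by positivity) hX0 ?_
        rw [hX, ← real_inner_self_eq_norm_sq, hq, ← hX]
        have h2 := real_inner_le_norm Fξ (wedgeCls (m + 1) T q)
        -- The Koszul form supplies one factor `d`, exactly what the coercivity estimate needs to
        -- bound it by `X`. No inverse power of the diameter appears.
        have h3 : inner ℝ Fζ (koszulCls m T q) ≤ ‖Fζ‖ * (√n * (K * X)) := by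
          refine (real_inner_le_norm _ _).trans (mul_le_mul_of_nonneg_left ?_ nζ)
          refine (hkos q).trans ?_
          rw [mul_assoc]
          exact mul_le_mul_of_nonneg_left (hcoer q) hs
        have h4 : ((n : ℝ) - m - 1) / (m + 1) ≤ n := by
          rw [div_le_iff₀ (by positivity)]
          nlinarith [mul_nonneg (Nat.cast_nonneg (α := ℝ) n) hm0]
        have h5 : ((n : ℝ) - m - 1) / (m + 1) * inner ℝ Fζ (koszulCls m T q) ≤
            n * (‖Fζ‖ * (√n * (K * X))) :=
          (mul_le_mul_of_nonneg_left h3 (by positivity)).trans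
            (mul_le_mul_of_nonneg_right h4 (by positivity))
        rw [hL]
        linarith
      linarith
    have nα := norm_nonneg (constCls (m + 2) T α)
    have nβ := norm_nonneg (constCls m T β)
    have bα' : ‖constCls (m + 2) T α‖ ≤ ‖Fξ‖ := by nlinarith
    have bβ' : ‖constCls m T β‖ ≤ ‖Fζ‖ := by nlinarith
    have b1 : ‖constCls (m + 1) T μ + koszulCls (m + 1) T α + wedgeCls m T β +
        cls (cell T) (quadForm T q)‖ ≤ ‖Fu‖ + √n * |D| * ‖Fζ‖ + √n * |D| * ‖Fξ‖ +
          √n * |D| * ‖Fζ‖ + n * |D| * K * (‖Fξ‖ + L * ‖Fζ‖) := by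
      refine (norm_add_le _ _).trans (add_le_add ((norm_add_le _ _).trans (add_le_add
        ((norm_add_le _ _).trans (add_le_add ?_ ?_)) ?_)) ?_)
      · refine bμ.trans ?_
        gcongr
      · refine (hkos α).trans ?_
        gcongr
      · refine (hwed β).trans ?_
        gcongr
      -- Of the two powers of the diameter, one is absorbed by coercivity and the other is bounded
      -- by `|D|`.
      · refine (hquad q).trans ?_
        calc n * d ^ 2 * ‖constCls (m + 1) T q‖ = n * d * (d * ‖constCls (m + 1) T q‖) := by ring
          _ ≤ n * |D| * (K * (‖Fξ‖ + L * ‖Fζ‖)) := by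
            exact mul_le_mul (by gcongr) ((hcoer q).trans (mul_le_mul_of_nonneg_left bX hK0))
              (by positivity) (by positivity)
          _ = _ := by ring
    have b2 : ‖((m : ℝ) + 2) • constCls (m + 2) T α + (2 : ℝ) • wedgeCls (m + 1) T q‖ ≤
        ‖Fξ‖ + 2 * (‖Fξ‖ + L * ‖Fζ‖) := by
      refine (norm_add_le _ _).trans (add_le_add ?_ ?_)
      · rw [norm_smul, Real.norm_eq_abs, abs_of_nonneg (by positivity)]
        exact bα
      · rw [norm_smul, Real.norm_eq_abs, abs_of_nonneg (by positivity)]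
        gcongr
    have b3 : ‖(-((n : ℝ) - m)) • constCls m T β‖ ≤ ‖Fζ‖ := by
      rw [norm_smul, norm_neg, Real.norm_eq_abs, abs_of_nonneg (by linarith)]
      exact bβ
    have b4 := interpolant_bound_aux nu nξ nζ (by positivity : 0 ≤ √(n : ℝ) * |D|)
      (by positivity : 0 ≤ n * |D| * K) hL0
    have b5 : 4 + 2 * √(n : ℝ) * |D| + (n * |D| * K + 2) * (1 + L) =
      4 + 2 * (√(n : ℝ) * |D|) + (n * |D| * K + 2) * (1 + L) := by ring
    rw [b5]
    exact (add_le_add (add_le_add b1 b2) b3).trans b4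

/-! ### Broken spaces on a subdivision -/

theorem memLp_restrict_biUnion {X F ι : Type*} [MeasurableSpace X] [NormedAddCommGroup F]
    {ν : Measure X} {f : X → F} {p : ENNReal} {s : ι → Set X} (t : Finset ι)
    (hs : ∀ i ∈ t, MeasurableSet (s i)) (h : ∀ i ∈ t, MemLp f p (ν.restrict (s i))) :
    MemLp f p (ν.restrict (⋃ i ∈ t, s i)) := by
  classical
  induction t using Finset.induction_on with
  | empty => simp
  | insert a t ha ih =>
    have hm : MeasurableSet (⋃ i ∈ t, s i) :=
      t.measurableSet_biUnion fun i hi => hs i (Finset.mem_insert_of_mem hi)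
    have hma := hs a (Finset.mem_insert_self a t)
    have h1 := ih (fun i hi => hs i (Finset.mem_insert_of_mem hi))
      fun i hi => h i (Finset.mem_insert_of_mem hi)
    have h2 : MemLp f p (ν.restrict (s a \ ⋃ i ∈ t, s i)) :=
      (h a (Finset.mem_insert_self a t)).mono_measure (Measure.restrict_mono sdiff_le le_rfl)
    rw [Finset.set_biUnion_insert, ← memLp_indicator_iff_restrict (hma.union hm), union_comm,
      ← union_sdiff_self, indicator_union_of_disjoint disjoint_sdiff_right]
    exact ((memLp_indicator_iff_restrict hm).2 h1).add
      ((memLp_indicator_iff_restrict (hma.diff hm)).2 h2)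

section Broken

variable {n k m : ℕ} {Ω : Set (E n)} (𝒢 : Subdivision Ω)

/-- The closed simplices differ from the open ones by frontiers of convex sets, which are null. -/
theorem Subdivision.iUnion_cell_ae_eq :
    (⋃ T ∈ 𝒢.cells, cell T) =ᵐ[volume] Ω := by
  have h1 : (⋃ T ∈ 𝒢.cells, cell T) =ᵐ[volume] ⋃ T ∈ 𝒢.cells, body T :=
    Filter.EventuallyEq.countable_bUnion 𝒢.cells.countable_toSet fun T _ => ae_eq_cell_body T
  have h2 : (⋃ T ∈ 𝒢.cells, cell T) ≤ᵐ[volume] Ω :=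
    LE.le.eventuallyLE (iUnion₂_subset 𝒢.cell_subset)
  have h3 : Ω ≤ᵐ[volume] ⋃ T ∈ 𝒢.cells, body T := LE.le.eventuallyLE 𝒢.covers
  exact h2.antisymm (h3.trans h1.symm.le)

theorem Subdivision.restrict_eq :
    volume.restrict Ω = volume.restrict (⋃ T ∈ 𝒢.cells, cell T) :=
  (Measure.restrict_congr_set 𝒢.iUnion_cell_ae_eq).symm

theorem Subdivision.ae_restrict_iff {p : E n → Prop} :
    (∀ᵐ x ∂volume.restrict Ω, p x) ↔ ∀ T ∈ 𝒢.cells, ∀ᵐ x ∂volume.restrict (cell T), p x := by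
  rw [𝒢.restrict_eq]
  exact ae_restrict_biUnion_finset_iff _ _ _

/-- The form which equals `p T` on the open simplex `T`. -/
def Subdivision.glue (p : Affine.Simplex ℝ (E n) n → E n → Form n k) : E n → Form n k :=
  ∑ T ∈ 𝒢.cells, (cell T).indicator (p T)

theorem Subdivision.glue_eqOn (p : Affine.Simplex ℝ (E n) n → E n → Form n k)
    {T : Affine.Simplex ℝ (E n) n} (hT : T ∈ 𝒢.cells) : EqOn (𝒢.glue p) (p T) (cell T) := by
  intro x hx
  rw [glue, Finset.sum_apply, Finset.sum_eq_single_of_mem T hT, indicator_of_mem hx]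
  intro S hS hST
  exact indicator_of_notMem (fun hxS => disjoint_left.1 (𝒢.disjoint S hS T hT hST) hxS hx) _

theorem ae_eq_of_eqOn_cell {T : Affine.Simplex ℝ (E n) n} {u v : E n → Form n k}
    (h : EqOn u v (cell T)) : u =ᵐ[volume.restrict (cell T)] v :=
  h.aeEq_restrict (isOpen_cell T).measurableSet

theorem Subdivision.memL2_iff {u : E n → Form n k} :
    MemL2 Ω u ↔ ∀ T ∈ 𝒢.cells, MemL2 (cell T) u := by
  constructor
  · exact fun h T hT => h.mono (𝒢.cell_subset T hT)
  · intro h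
    unfold MemL2 at *
    rw [𝒢.restrict_eq]
    exact memLp_restrict_biUnion _ (fun T _ => (isOpen_cell T).measurableSet) h

theorem Subdivision.l2Inner_eq_sum {u v : E n → Form n k} (hu : MemL2 Ω u) (hv : MemL2 Ω v) :
    l2Inner Ω u v = ∑ T ∈ 𝒢.cells, l2Inner (cell T) u v := by
  rw [l2Inner, 𝒢.restrict_eq]
  refine integral_biUnion_finset _ (fun T _ => (isOpen_cell T).measurableSet)
    (fun S hS T hT hne => 𝒢.disjoint S hS T hT hne) fun T hT => ?_
  exact (hu.mono (𝒢.cell_subset T hT)).integrable_formInner (hv.mono (𝒢.cell_subset T hT))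

theorem Subdivision.l2Norm_sq_eq_sum {u : E n → Form n k} (hu : MemL2 Ω u) :
    l2Norm Ω u ^ 2 = ∑ T ∈ 𝒢.cells, l2Norm (cell T) u ^ 2 := by
  simp only [← l2Inner_self]
  exact 𝒢.l2Inner_eq_sum hu hu

/-- `u` is square integrable with piecewise weak exterior derivative `ξ` and piecewise weak
codifferential `ζ`. -/
def Subdivision.HasBroken (u : E n → Form n (m + 1)) (ξ : E n → Form n (m + 2))
    (ζ : E n → Form n m) : Prop :=
  ∀ T ∈ 𝒢.cells, MemL2 (cell T) u ∧ IsWeakD (cell T) u ξ ∧ IsWeakCodiff (cell T) u ζ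

variable {𝒢} {u u' : E n → Form n (m + 1)} {ξ ξ' : E n → Form n (m + 2)} {ζ ζ' : E n → Form n m}

theorem Subdivision.HasBroken.memL2 (h : 𝒢.HasBroken u ξ ζ) : MemL2 Ω u :=
  𝒢.memL2_iff.2 fun T hT => (h T hT).1

theorem Subdivision.HasBroken.memL2_d (h : 𝒢.HasBroken u ξ ζ) : MemL2 Ω ξ :=
  𝒢.memL2_iff.2 fun T hT => (h T hT).2.1.1

theorem Subdivision.HasBroken.memL2_codiff (h : 𝒢.HasBroken u ξ ζ) : MemL2 Ω ζ :=
  𝒢.memL2_iff.2 fun T hT => (h T hT).2.2.1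

theorem Subdivision.HasBroken.add (h : 𝒢.HasBroken u ξ ζ) (h' : 𝒢.HasBroken u' ξ' ζ') :
    𝒢.HasBroken (u + u') (ξ + ξ') (ζ + ζ') := fun T hT =>
  ⟨(h T hT).1.add (h' T hT).1, (h T hT).2.1.add (h' T hT).2.1 (h T hT).1 (h' T hT).1,
    (h T hT).2.2.add (h' T hT).2.2 (h T hT).1 (h' T hT).1⟩

theorem Subdivision.HasBroken.sub (h : 𝒢.HasBroken u ξ ζ) (h' : 𝒢.HasBroken u' ξ' ζ') :
    𝒢.HasBroken (u - u') (ξ - ξ') (ζ - ζ') := fun T hT =>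
  ⟨(h T hT).1.sub (h' T hT).1, (h T hT).2.1.sub (h' T hT).2.1 (h T hT).1 (h' T hT).1,
    (h T hT).2.2.sub (h' T hT).2.2 (h T hT).1 (h' T hT).1⟩

/-- `brokenD` is assembled from chosen representatives and need not be additive pointwise.
Calculations use `HasBroken` data, and this identity transfers them back. -/
theorem Subdivision.HasBroken.brokenD_ae_eq (h : 𝒢.HasBroken u ξ ζ) :
    𝒢.brokenD u =ᵐ[volume.restrict Ω] ξ := by
  refine 𝒢.ae_restrict_iff.2 fun T hT => ?_
  have h1 := ae_eq_of_eqOn_cell (𝒢.glue_eqOn (fun T => weakD (cell T) u) hT)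
  exact h1.trans ((h T hT).2.1.weakD.ae_eq (isOpen_cell T) (h T hT).2.1)

theorem Subdivision.HasBroken.brokenCodiff_ae_eq (h : 𝒢.HasBroken u ξ ζ) :
    𝒢.brokenCodiff u =ᵐ[volume.restrict Ω] ζ := by
  refine 𝒢.ae_restrict_iff.2 fun T hT => ?_
  have h1 := ae_eq_of_eqOn_cell (𝒢.glue_eqOn (fun T => weakCodiff (cell T) u) hT)
  exact h1.trans ((h T hT).2.2.weakCodiff.ae_eq (isOpen_cell T) (h T hT).2.2)

theorem Subdivision.hasBroken_glue (p : Affine.Simplex ℝ (E n) n → E n → Form n (m + 1))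
    (hp : ∀ T ∈ 𝒢.cells, ContDiff ℝ (⊤ : ℕ∞) (p T)) :
    𝒢.HasBroken (𝒢.glue p) (𝒢.glue fun T => extDeriv (p T)) (𝒢.glue fun T => codiff (p T)) := by
  intro T hT
  have e1 := ae_eq_of_eqOn_cell (𝒢.glue_eqOn p hT)
  have e2 := ae_eq_of_eqOn_cell (𝒢.glue_eqOn (fun T => extDeriv (p T)) hT)
  have e3 := ae_eq_of_eqOn_cell (𝒢.glue_eqOn (fun T => codiff (p T)) hT)
  refine ⟨(memL2_cell (hp T hT).continuous).congr e1.symm, ?_, ?_⟩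
  · exact (isWeakD_of_contDiff (hp T hT) (memL2_cell
      (contDiff_extDeriv (hp T hT)).continuous)).congr e1.symm e2.symm
  · exact (isWeakCodiff_of_contDiff (hp T hT) (memL2_cell
      (contDiff_codiff (hp T hT)).continuous)).congr e1.symm e3.symm

theorem contDiff_of_mem_enriched {T : Affine.Simplex ℝ (E n) n} {p : E n → Form n (m + 1)}
    (hp : p ∈ enriched m T) : ContDiff ℝ (⊤ : ℕ∞) p := by
  obtain ⟨p₁, h₁, r, hr, rfl⟩ := Submodule.mem_sup.1 hp
  obtain ⟨p₂, h₂, s, hs, rfl⟩ := Submodule.mem_sup.1 h₁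
  obtain ⟨p₃, h₃, q, hq, rfl⟩ := Submodule.mem_sup.1 h₂
  clear hp h₁ h₂
  obtain ⟨α, rfl⟩ := exists_constForm_eq h₃
  obtain ⟨β, rfl⟩ := exists_koszulForm_eq hq
  obtain ⟨γ, rfl⟩ := exists_wedgeForm_eq hs
  refine (((contDiff_constForm α).add (contDiff_koszulForm _ β)).add
    (contDiff_wedgeForm _ γ)).add ?_
  induction hr using Submodule.span_induction with
  | mem p hp =>
    obtain ⟨I, rfl⟩ := hp
    fun_prop
  | zero => exact contDiff_const
  | add p q _ _ hp hq => exact hp.add hq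
  | smul a p _ hp => exact contDiff_const.smul hp

theorem Subdivision.exists_hasBroken (hu : u ∈ 𝒢.enrichedSpace m) :
    ∃ ξ ζ, 𝒢.HasBroken u ξ ζ := by
  choose! p hp hup using hu
  have h := 𝒢.hasBroken_glue p fun T hT => contDiff_of_mem_enriched (hp T hT)
  refine ⟨𝒢.glue fun T => extDeriv (p T), 𝒢.glue fun T => codiff (p T), fun T hT => ?_⟩
  have e : 𝒢.glue p =ᵐ[volume.restrict (cell T)] u :=
    ae_eq_of_eqOn_cell fun x hx => by rw [𝒢.glue_eqOn p hT hx, hup T hT hx]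
  exact ⟨(h T hT).1.congr e, (h T hT).2.1.congr e .rfl, (h T hT).2.2.congr e .rfl⟩

theorem hasBroken_of_isWeak (hu : MemL2 Ω u) (hd : IsWeakD Ω u ξ) (hδ : IsWeakCodiff Ω u ζ) :
    𝒢.HasBroken u ξ ζ := fun T hT =>
  ⟨hu.mono (𝒢.cell_subset T hT), hd.mono (𝒢.cell_subset T hT), hδ.mono (𝒢.cell_subset T hT)⟩

theorem Subdivision.piecewise_add {S : Affine.Simplex ℝ (E n) n → Submodule ℝ (E n → Form n k)}
    {u v : E n → Form n k} (hu : u ∈ 𝒢.piecewise S) (hv : v ∈ 𝒢.piecewise S) :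
    u + v ∈ 𝒢.piecewise S := by
  intro T hT
  obtain ⟨p, hp, hup⟩ := hu T hT
  obtain ⟨q, hq, hvq⟩ := hv T hT
  exact ⟨p + q, (S T).add_mem hp hq, fun x hx => by simp [hup hx, hvq hx]⟩

theorem Subdivision.piecewise_sub {S : Affine.Simplex ℝ (E n) n → Submodule ℝ (E n → Form n k)}
    {u v : E n → Form n k} (hu : u ∈ 𝒢.piecewise S) (hv : v ∈ 𝒢.piecewise S) :
    u - v ∈ 𝒢.piecewise S := by
  intro T hT
  obtain ⟨p, hp, hup⟩ := hu T hT
  obtain ⟨q, hq, hvq⟩ := hv T hT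
  exact ⟨p - q, (S T).sub_mem hp hq, fun x hx => by simp [hup hx, hvq hx]⟩

theorem Subdivision.zero_mem_piecewise
    {S : Affine.Simplex ℝ (E n) n → Submodule ℝ (E n → Form n k)} :
    (0 : E n → Form n k) ∈ 𝒢.piecewise S :=
  fun T _ => ⟨0, (S T).zero_mem, fun _ _ => rfl⟩

/-- Membership in the nonconforming space, in terms of the broken derivatives. -/
theorem Subdivision.HasBroken.mem_femSpace_iff (h : 𝒢.HasBroken u ξ ζ) :
    u ∈ 𝒢.femSpace m ↔ u ∈ 𝒢.enrichedSpace m ∧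
      (∀ η ∈ 𝒢.whitneyStarZero (m + 1), l2Inner Ω ξ η = l2Inner Ω u (weakCodiff Ω η)) ∧
      (∀ τ ∈ 𝒢.whitney m, l2Inner Ω ζ τ = l2Inner Ω u (weakD Ω τ)) := by
  simp only [femSpace, mem_ofPred_eq, sub_eq_zero, l2Inner_congr h.brokenD_ae_eq .rfl,
    l2Inner_congr h.brokenCodiff_ae_eq .rfl]

theorem Subdivision.sub_mem_femSpace (hu : u ∈ 𝒢.femSpace m) (hu' : u' ∈ 𝒢.femSpace m) :
    u - u' ∈ 𝒢.femSpace m := by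
  obtain ⟨ξ, ζ, h⟩ := 𝒢.exists_hasBroken hu.1
  obtain ⟨ξ', ζ', h'⟩ := 𝒢.exists_hasBroken hu'.1
  obtain ⟨h1, h2, h3⟩ := h.mem_femSpace_iff.1 hu
  obtain ⟨h1', h2', h3'⟩ := h'.mem_femSpace_iff.1 hu'
  refine (h.sub h').mem_femSpace_iff.2 ⟨𝒢.piecewise_sub h1 h1', fun η hη => ?_, fun τ hτ => ?_⟩
  · rw [l2Inner_sub_left h.memL2_d h'.memL2_d hη.2.1.1,
      l2Inner_sub_left h.memL2 h'.memL2 hη.2.1.isWeakCodiff.1, h2 η hη, h2' η hη]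
  · rw [l2Inner_sub_left h.memL2_codiff h'.memL2_codiff hτ.2.1,
      l2Inner_sub_left h.memL2 h'.memL2 hτ.2.isWeakD.1, h3 τ hτ, h3' τ hτ]

end Broken

/-! ### The global quasi-interpolation estimate -/

section Global

variable {n m : ℕ} {Ω : Set (E n)} {𝒢 : Subdivision Ω}

/-- Squaring and summing over simplices uses `(a + b + c)² ≤ 3(a² + b² + c²)`. The resulting factor
`√3` is rounded up to `2`. -/
theorem l2Norm_le_of_cells {k : ℕ} {P : E n → Form n k} {u : E n → Form n (m + 1)}
    {ξ : E n → Form n (m + 2)} {ζ : E n → Form n m} {C : ℝ} (hC : 0 ≤ C) (hP : MemL2 Ω P)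
    (hu : MemL2 Ω u) (hξ : MemL2 Ω ξ) (hζ : MemL2 Ω ζ)
    (h : ∀ T ∈ 𝒢.cells, l2Norm (cell T) P ≤
      C * (l2Norm (cell T) u + l2Norm (cell T) ξ + l2Norm (cell T) ζ)) :
    l2Norm Ω P ≤ 2 * C * (l2Norm Ω u + l2Norm Ω ξ + l2Norm Ω ζ) := by
  have nu := l2Norm_nonneg (U := Ω) (u := u)
  have nξ := l2Norm_nonneg (U := Ω) (u := ξ)
  have nζ := l2Norm_nonneg (U := Ω) (u := ζ)
  refine abs_le_of_sq_le_sq' ?_ (by positivity) |>.2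
  have h1 : l2Norm Ω P ^ 2 ≤
      3 * C ^ 2 * (l2Norm Ω u ^ 2 + l2Norm Ω ξ ^ 2 + l2Norm Ω ζ ^ 2) := by
    rw [𝒢.l2Norm_sq_eq_sum hP, 𝒢.l2Norm_sq_eq_sum hu, 𝒢.l2Norm_sq_eq_sum hξ,
      𝒢.l2Norm_sq_eq_sum hζ, ← Finset.sum_add_distrib, ← Finset.sum_add_distrib, Finset.mul_sum]
    refine Finset.sum_le_sum fun T hT => ?_
    refine (pow_le_pow_left₀ l2Norm_nonneg (h T hT) 2).trans ?_
    rw [mul_pow, mul_comm 3, mul_assoc]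
    refine mul_le_mul_of_nonneg_left ?_ (sq_nonneg C)
    nlinarith [sq_nonneg (l2Norm (cell T) u - l2Norm (cell T) ξ),
      sq_nonneg (l2Norm (cell T) u - l2Norm (cell T) ζ),
      sq_nonneg (l2Norm (cell T) ξ - l2Norm (cell T) ζ)]
  refine h1.trans ?_
  rw [mul_pow, mul_pow]
  have h2 : l2Norm Ω u ^ 2 + l2Norm Ω ξ ^ 2 + l2Norm Ω ζ ^ 2 ≤
      (l2Norm Ω u + l2Norm Ω ξ + l2Norm Ω ζ) ^ 2 := by
    nlinarith [mul_nonneg nu nξ, mul_nonneg nu nζ, mul_nonneg nξ nζ]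
  have h3 := mul_le_mul_of_nonneg_left h2 (sq_nonneg C)
  have h4 : 0 ≤ C ^ 2 * (l2Norm Ω u + l2Norm Ω ξ + l2Norm Ω ζ) ^ 2 := by positivity
  linarith

/-- Forms of `HΛᵏ ∩ H*₀Λᵏ` are approximated by the nonconforming space as well as by the broken
enriched space. -/
theorem exists_femSpace_approx (n m : ℕ) (hmn : m + 2 ≤ n) (σ D : ℝ) :
    ∃ C : ℝ, 0 ≤ C ∧ ∀ (Ω : Set (E n)), IsOpen Ω → ∀ 𝒢 : Subdivision Ω,
      𝒢.ShapeRegular σ → 𝒢.DiamLE D → ∀ ω : E n → Form n (m + 1), MemHd Ω ω →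
        MemHdeltaZero Ω ω → ∀ μ ∈ 𝒢.enrichedSpace m, ∃ v ∈ 𝒢.femSpace m,
          l2Norm Ω (ω - v) + l2Norm Ω (𝒢.brokenD (ω - v)) + l2Norm Ω (𝒢.brokenCodiff (ω - v)) ≤
            C * (l2Norm Ω (ω - μ) + l2Norm Ω (𝒢.brokenD (ω - μ))
              + l2Norm Ω (𝒢.brokenCodiff (ω - μ))) := by
  obtain ⟨C, hC, hloc⟩ := exists_local_interpolant n m hmn σ D
  -- The `1` comes from `ω - μ`, and `2C` from each of the three norms of the correction.
  refine ⟨1 + 6 * C, by positivity, fun Ω hΩ 𝒢 hσ hD ω hω hω0 μ hμ => ?_⟩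
  have tω : 𝒢.HasBroken ω (weakD Ω ω) (weakCodiff Ω ω) :=
    hasBroken_of_isWeak hω.1 hω.isWeakD hω0.1.isWeakCodiff
  obtain ⟨ξ, ζ, tμ⟩ := 𝒢.exists_hasBroken hμ
  have te := tω.sub tμ
  -- The local interpolant is applied to the error `ω - μ`, so the correction is bounded by that
  -- error.
  have hloc' : ∀ T ∈ 𝒢.cells, _ := fun T hT =>
    hloc T (hσ T hT) (hD T hT) (ω - μ) (weakD Ω ω - ξ) (weakCodiff Ω ω - ζ) (te T hT).1
      (te T hT).2.1.1 (te T hT).2.2.1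
  choose! p hpm hpc hpA hpB hpn using hloc'
  have tP := 𝒢.hasBroken_glue p hpc
  have tv := tμ.add tP
  have tev := tω.sub tv
  have e1 : ∀ T ∈ 𝒢.cells, 𝒢.glue p =ᵐ[volume.restrict (cell T)] p T := fun T hT =>
    ae_eq_of_eqOn_cell (𝒢.glue_eqOn p hT)
  have e2 : ∀ T ∈ 𝒢.cells, (𝒢.glue fun T => extDeriv (p T)) =ᵐ[volume.restrict (cell T)]
      extDeriv (p T) := fun T hT => ae_eq_of_eqOn_cell (𝒢.glue_eqOn (fun T => extDeriv (p T)) hT)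
  have e3 : ∀ T ∈ 𝒢.cells, (𝒢.glue fun T => codiff (p T)) =ᵐ[volume.restrict (cell T)]
      codiff (p T) := fun T hT => ae_eq_of_eqOn_cell (𝒢.glue_eqOn (fun T => codiff (p T)) hT)
  refine ⟨μ + 𝒢.glue p, tv.mem_femSpace_iff.2 ⟨𝒢.piecewise_add hμ fun T hT =>
    ⟨p T, hpm T hT, 𝒢.glue_eqOn p hT⟩, fun η hη => ?_, fun τ hτ => ?_⟩, ?_⟩
  · have wη := hη.2.1.isWeakCodiff
    -- The correction has the same defect against `η` as `ω - μ`. As `ω` has defect zero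
    -- (`l2Inner_weakCodiff`), adding the correction to `μ` cancels the defect of `μ`.
    have key : l2Inner Ω (𝒢.glue fun T => extDeriv (p T)) η
        - l2Inner Ω (𝒢.glue p) (weakCodiff Ω η) =
        l2Inner Ω (weakD Ω ω - ξ) η - l2Inner Ω (ω - μ) (weakCodiff Ω η) := by
      rw [𝒢.l2Inner_eq_sum tP.memL2_d hη.2.1.1, 𝒢.l2Inner_eq_sum tP.memL2 wη.1,
        𝒢.l2Inner_eq_sum te.memL2_d hη.2.1.1, 𝒢.l2Inner_eq_sum te.memL2 wη.1,
        ← Finset.sum_sub_distrib, ← Finset.sum_sub_distrib]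
      refine Finset.sum_congr rfl fun T hT => ?_
      obtain ⟨r, hr, hηr⟩ := hη.1 T hT
      have hrc : ContDiff ℝ (⊤ : ℕ∞) r := by
        obtain ⟨a, b, rfl⟩ := exists_eq_of_mem_trimmedStar (0 : E n) hr
        exact (contDiff_constForm a).add (contDiff_wedgeForm _ b)
      have a1 : η =ᵐ[volume.restrict (cell T)] r := ae_eq_of_eqOn_cell hηr
      -- Weak derivatives on `Ω` restrict to the open simplex, where they are the classical ones of
      -- the polynomial.
      have a2 : weakCodiff Ω η =ᵐ[volume.restrict (cell T)] codiff r :=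
        ((wη.mono (𝒢.cell_subset T hT)).congr a1 .rfl).ae_eq (isOpen_cell T)
          (isWeakCodiff_of_contDiff hrc (memL2_cell (contDiff_codiff hrc).continuous))
      rw [l2Inner_congr (e2 T hT) a1, l2Inner_congr (e1 T hT) a2, l2Inner_congr .rfl a1,
        l2Inner_congr .rfl a2]
      exact hpA T hT r hr
    have h0 := l2Inner_weakCodiff hω hη.2
    rw [l2Inner_sub_left tω.memL2_d tμ.memL2_d hη.2.1.1,
      l2Inner_sub_left tω.memL2 tμ.memL2 wη.1] at key
    rw [l2Inner_add_left tμ.memL2_d tP.memL2_d hη.2.1.1,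
      l2Inner_add_left tμ.memL2 tP.memL2 wη.1]
    linarith
  · have wτ := hτ.2.isWeakD
    have key : l2Inner Ω (𝒢.glue fun T => codiff (p T)) τ
        - l2Inner Ω (𝒢.glue p) (weakD Ω τ) =
        l2Inner Ω (weakCodiff Ω ω - ζ) τ - l2Inner Ω (ω - μ) (weakD Ω τ) := by
      rw [𝒢.l2Inner_eq_sum tP.memL2_codiff hτ.2.1, 𝒢.l2Inner_eq_sum tP.memL2 wτ.1,
        𝒢.l2Inner_eq_sum te.memL2_codiff hτ.2.1, 𝒢.l2Inner_eq_sum te.memL2 wτ.1,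
        ← Finset.sum_sub_distrib, ← Finset.sum_sub_distrib]
      refine Finset.sum_congr rfl fun T hT => ?_
      obtain ⟨r, hr, hτr⟩ := hτ.1 T hT
      have hrc : ContDiff ℝ (⊤ : ℕ∞) r := by
        obtain ⟨a, b, rfl⟩ := exists_eq_of_mem_trimmed (0 : E n) hr
        exact (contDiff_constForm a).add (contDiff_koszulForm _ b)
      have a1 : τ =ᵐ[volume.restrict (cell T)] r := ae_eq_of_eqOn_cell hτr
      have a2 : weakD Ω τ =ᵐ[volume.restrict (cell T)] extDeriv r :=
        ((wτ.mono (𝒢.cell_subset T hT)).congr a1 .rfl).ae_eq (isOpen_cell T)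
          (isWeakD_of_contDiff hrc (memL2_cell (contDiff_extDeriv hrc).continuous))
      rw [l2Inner_congr (e3 T hT) a1, l2Inner_congr (e1 T hT) a2, l2Inner_congr .rfl a1,
        l2Inner_congr .rfl a2]
      exact hpB T hT r hr
    have h0 := l2Inner_weakCodiff hτ.2 hω0
    rw [l2Inner_comm, l2Inner_comm (weakD Ω τ)] at h0
    rw [l2Inner_sub_left tω.memL2_codiff tμ.memL2_codiff hτ.2.1,
      l2Inner_sub_left tω.memL2 tμ.memL2 wτ.1] at key
    rw [l2Inner_add_left tμ.memL2_codiff tP.memL2_codiff hτ.2.1,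
      l2Inner_add_left tμ.memL2 tP.memL2 wτ.1]
    linarith
  · rw [l2Norm_congr tev.brokenD_ae_eq, l2Norm_congr tev.brokenCodiff_ae_eq,
      l2Norm_congr te.brokenD_ae_eq, l2Norm_congr te.brokenCodiff_ae_eq]
    have n1 : ∀ T, 0 ≤ l2Norm (cell T) (p T) := fun T => l2Norm_nonneg
    have n2 : ∀ T, 0 ≤ l2Norm (cell T) (extDeriv (p T)) := fun T => l2Norm_nonneg
    have n3 : ∀ T, 0 ≤ l2Norm (cell T) (codiff (p T)) := fun T => l2Norm_nonneg
    have b1 := l2Norm_le_of_cells (𝒢 := 𝒢) hC tP.memL2 te.memL2 te.memL2_d te.memL2_codiff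
      fun T hT => by
        rw [l2Norm_congr (e1 T hT)]
        linarith [hpn T hT, n2 T, n3 T]
    have b2 := l2Norm_le_of_cells (𝒢 := 𝒢) hC tP.memL2_d te.memL2 te.memL2_d te.memL2_codiff
      fun T hT => by
        rw [l2Norm_congr (e2 T hT)]
        linarith [hpn T hT, n1 T, n3 T]
    have b3 := l2Norm_le_of_cells (𝒢 := 𝒢) hC tP.memL2_codiff te.memL2 te.memL2_d
      te.memL2_codiff fun T hT => by
        rw [l2Norm_congr (e3 T hT)]
        linarith [hpn T hT, n1 T, n2 T]
    have c1 := l2Norm_sub_le te.memL2 tP.memL2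
    have c2 := l2Norm_sub_le te.memL2_d tP.memL2_d
    have c3 := l2Norm_sub_le te.memL2_codiff tP.memL2_codiff
    rw [sub_sub] at c1 c2 c3
    linarith

end Global

/-! ### The consistency error and the final estimate -/

theorem sqrt_sum_sq_le_of_le {x y z a b c : ℝ}
    (ha : 0 ≤ a) (hb : 0 ≤ b) (hc : 0 ≤ c) (h : x ^ 2 + y ^ 2 + z ^ 2 ≤ a * x + b * y + c * z) :
    √(x ^ 2 + y ^ 2 + z ^ 2) ≤ a + b + c := by
  set R := √(x ^ 2 + y ^ 2 + z ^ 2) with hR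
  have hR2 : R ^ 2 = x ^ 2 + y ^ 2 + z ^ 2 := Real.sq_sqrt (by positivity)
  have h1 : x ≤ R := Real.le_sqrt_of_sq_le (by nlinarith)
  have h2 : y ≤ R := Real.le_sqrt_of_sq_le (by nlinarith)
  have h3 : z ≤ R := Real.le_sqrt_of_sq_le (by nlinarith)
  have h4 : 1 * R ^ 2 ≤ (a + b + c) * R := by
    nlinarith [mul_le_mul_of_nonneg_left h1 ha, mul_le_mul_of_nonneg_left h2 hb,
      mul_le_mul_of_nonneg_left h3 hc]
  linarith [mul_le_of_mul_sq_le (by positivity : 0 ≤ a + b + c) (Real.sqrt_nonneg _) h4]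

/-- The hypothesis places `(x, y, z)` in the ball with centre `(a, b, c)/2` and radius `|(a, b,
c)|/2`. On that ball `x + y + z` is at most `(a + b + c)/2 + √3 |(a, b, c)|/2`, and `|(a, b, c)| ≤ a
+ b + c`. -/
theorem sum_le_of_le {x y z a b c : ℝ} (ha : 0 ≤ a) (hb : 0 ≤ b) (hc : 0 ≤ c)
    (h : x ^ 2 + y ^ 2 + z ^ 2 ≤ a * x + b * y + c * z) :
    x + y + z ≤ (1 + √3) / 2 * (a + b + c) := by
  have h1 : (x + y + z - (a + b + c) / 2) ^ 2 ≤ (√3 / 2 * (a + b + c)) ^ 2 := by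
    rw [mul_pow, div_pow, Real.sq_sqrt (by norm_num)]
    nlinarith [sq_nonneg ((x - a / 2) - (y - b / 2)), sq_nonneg ((x - a / 2) - (z - c / 2)),
      sq_nonneg ((y - b / 2) - (z - c / 2)), mul_nonneg ha hb, mul_nonneg ha hc, mul_nonneg hb hc]
  have h2 := (abs_le_of_sq_le_sq' h1 (by positivity)).2
  linarith

theorem sqrt_sum_sq_add_le {a b c x y z a' b' c' : ℝ} (ha : 0 ≤ a) (hb : 0 ≤ b) (hc : 0 ≤ c)
    (ha' : 0 ≤ a') (hb' : 0 ≤ b') (hc' : 0 ≤ c')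
    (h1 : a' ≤ a + x) (h2 : b' ≤ b + y)
    (h3 : c' ≤ c + z) :
    √(a' ^ 2 + b' ^ 2 + c' ^ 2) ≤ a + b + c + √(x ^ 2 + y ^ 2 + z ^ 2) := by
  set R := √(x ^ 2 + y ^ 2 + z ^ 2) with hR
  have hR2 : R ^ 2 = x ^ 2 + y ^ 2 + z ^ 2 := Real.sq_sqrt (by positivity)
  have hR0 : 0 ≤ R := Real.sqrt_nonneg _
  have k1 : x ≤ R := Real.le_sqrt_of_sq_le (by nlinarith)
  have k2 : y ≤ R := Real.le_sqrt_of_sq_le (by nlinarith)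
  have k3 : z ≤ R := Real.le_sqrt_of_sq_le (by nlinarith)
  refine Real.sqrt_le_iff.2 ⟨by positivity, ?_⟩
  have m1 := pow_le_pow_left₀ ha' h1 2
  have m2 := pow_le_pow_left₀ hb' h2 2
  have m3 := pow_le_pow_left₀ hc' h3 2
  have l1 := mul_le_mul_of_nonneg_left k1 ha
  have l2 := mul_le_mul_of_nonneg_left k2 hb
  have l3 := mul_le_mul_of_nonneg_left k3 hc
  nlinarith [mul_nonneg ha hb, mul_nonneg ha hc, mul_nonneg hb hc]

/-! ### Passage to the infima. -/

theorem le_mul_iInf_add {ι : Type*} [Nonempty ι] {F : ι → ℝ} {a b c : ℝ} (hc : 0 < c)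
    (h : ∀ i, a ≤ c * F i + b) : a ≤ c * (⨅ i, F i) + b := by
  have h1 : (a - b) / c ≤ ⨅ i, F i := le_ciInf fun i => by
    rw [div_le_iff₀ hc]
    linarith [h i]
  rw [div_le_iff₀ hc] at h1
  linarith

theorem le_mul_iInf_add_mul_iInf_add_mul_iInf {ι₁ ι₂ ι₃ : Type*} [Nonempty ι₁] [Nonempty ι₂]
    [Nonempty ι₃] {F : ι₁ → ℝ} {G : ι₂ → ℝ} {H : ι₃ → ℝ} {a b c d : ℝ} (hb : 0 < b) (hc : 0 < c)
    (hd : 0 < d) (h : ∀ i j l, a ≤ b * F i + (c * G j + d * H l)) :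
    a ≤ b * (⨅ i, F i) + (c * (⨅ j, G j) + d * ⨅ l, H l) := by
  refine le_mul_iInf_add hb fun i => ?_
  rw [add_left_comm]
  refine le_mul_iInf_add hc fun j => ?_
  rw [← add_assoc, add_comm]
  refine le_mul_iInf_add hd fun l => ?_
  linarith [h i j l]

section Strang

variable {n m : ℕ} {Ω : Set (E n)} {𝒢 : Subdivision Ω}

theorem weakCodiff_sub_ae_eq {k : ℕ} {u v : E n → Form n (k + 1)} (hΩ : IsOpen Ω)
    (hu : MemHdelta Ω u) (hv : MemHdelta Ω v) :
    weakCodiff Ω (u - v) =ᵐ[volume.restrict Ω] weakCodiff Ω u - weakCodiff Ω v :=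
  have h := hu.isWeakCodiff.sub hv.isWeakCodiff hu.1 hv.1
  h.weakCodiff.ae_eq hΩ h

theorem weakD_sub_ae_eq {k : ℕ} {u v : E n → Form n k} (hΩ : IsOpen Ω)
    (hu : MemHd Ω u) (hv : MemHd Ω v) :
    weakD Ω (u - v) =ᵐ[volume.restrict Ω] weakD Ω u - weakD Ω v :=
  have h := hu.isWeakD.sub hv.isWeakD hu.1 hv.1
  h.weakD.ae_eq hΩ h

/-- The error equation: for `v`, `η`, `τ` in the three discrete spaces and `w = ωh - v`, the squared
energy norm of `w` is bounded by the approximation and consistency errors. -/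
theorem energy_sq_le (hΩ : IsOpen Ω) {f ω ωh v : E n → Form n (m + 1)} (hf : MemL2 Ω f)
    (hω : IsSolution Ω f ω) (hωh : 𝒢.IsDiscreteSolution f ωh) (hv : v ∈ 𝒢.femSpace m)
    {η : E n → Form n (m + 2)} (hη : η ∈ 𝒢.whitneyStarZero (m + 1)) {τ : E n → Form n m}
    (hτ : τ ∈ 𝒢.whitney m) :
    l2Norm Ω (ωh - v) ^ 2 + l2Norm Ω (𝒢.brokenD (ωh - v)) ^ 2
        + l2Norm Ω (𝒢.brokenCodiff (ωh - v)) ^ 2 ≤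
      (l2Norm Ω (ω - v) + l2Norm Ω (weakCodiff Ω (weakD Ω ω - η))
          + l2Norm Ω (weakD Ω (weakCodiff Ω ω - τ))) * l2Norm Ω (ωh - v)
        + (l2Norm Ω (𝒢.brokenD (ω - v)) + l2Norm Ω (weakD Ω ω - η))
          * l2Norm Ω (𝒢.brokenD (ωh - v))
        + (l2Norm Ω (𝒢.brokenCodiff (ω - v)) + l2Norm Ω (weakCodiff Ω ω - τ))
          * l2Norm Ω (𝒢.brokenCodiff (ωh - v)) := by
  obtain ⟨hd0, hdδ⟩ := hω.regularity hΩ hf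
  have tω : 𝒢.HasBroken ω (weakD Ω ω) (weakCodiff Ω ω) :=
    hasBroken_of_isWeak hω.1.1 hω.1.isWeakD hω.2.1.1.isWeakCodiff
  obtain ⟨ξh, ζh, th⟩ := 𝒢.exists_hasBroken hωh.1.1
  obtain ⟨ξv, ζv, tv⟩ := 𝒢.exists_hasBroken hv.1
  have te := tω.sub tv
  have tw := th.sub tv
  have hwV : ωh - v ∈ 𝒢.femSpace m := 𝒢.sub_mem_femSpace hωh.1 hv
  obtain ⟨-, hwη, hwτ⟩ := tw.mem_femSpace_iff.1 hwV
  have cη := hη.2.1.isWeakCodiff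
  have cτ := hτ.2.isWeakD
  have cdω := hd0.1.isWeakCodiff
  have cδω := hdδ.isWeakD
  have aη := weakCodiff_sub_ae_eq hΩ hd0.1 hη.2.1
  have aτ := weakD_sub_ae_eq hΩ hdδ hτ.2
  have heq := hωh.2 _ hwV
  rw [l2Inner_congr th.brokenD_ae_eq tw.brokenD_ae_eq,
    l2Inner_congr th.brokenCodiff_ae_eq tw.brokenCodiff_ae_eq,
    hω.l2Inner_eq hΩ hf tw.memL2] at heq
  rw [l2Norm_congr tw.brokenD_ae_eq, l2Norm_congr tw.brokenCodiff_ae_eq,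
    l2Norm_congr te.brokenD_ae_eq, l2Norm_congr te.brokenCodiff_ae_eq, l2Norm_congr aη,
    l2Norm_congr aτ]
  -- Since `(d_h w, η) = (w, δη)`, one has `(δdω, w) = (δ(dω - η), w) - (dω - η, d_h w) + (dω, d_h
  -- w)`, and similarly for `dδω` with `τ`. What remains beyond the energy pairing of `ω - v` with
  -- `w` is bounded by Cauchy–Schwarz.
  have h1 := hwη η hη
  have h2 := hwτ τ hτ
  rw [l2Inner_comm, l2Inner_comm (ωh - v)] at h1 h2
  have b1 := (abs_le.1 (l2Inner_le te.memL2 tw.memL2)).2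
  have b2 := (abs_le.1 (l2Inner_le te.memL2_d tw.memL2_d)).2
  have b3 := (abs_le.1 (l2Inner_le te.memL2_codiff tw.memL2_codiff)).2
  have b4 := (abs_le.1 (l2Inner_le (cdω.1.sub cη.1) tw.memL2)).2
  have b5 := (abs_le.1 (l2Inner_le (cδω.1.sub cτ.1) tw.memL2)).2
  have b6 := (abs_le.1 (l2Inner_le (hd0.1.1.sub hη.2.1.1) tw.memL2_d)).1
  have b7 := (abs_le.1 (l2Inner_le (hdδ.1.sub hτ.2.1) tw.memL2_codiff)).1
  rw [l2Inner_sub_left tω.memL2 tv.memL2 tw.memL2] at b1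
  rw [l2Inner_sub_left tω.memL2_d tv.memL2_d tw.memL2_d] at b2
  rw [l2Inner_sub_left tω.memL2_codiff tv.memL2_codiff tw.memL2_codiff] at b3
  rw [l2Inner_sub_left cdω.1 cη.1 tw.memL2] at b4
  rw [l2Inner_sub_left cδω.1 cτ.1 tw.memL2] at b5
  rw [l2Inner_sub_left hd0.1.1 hη.2.1.1 tw.memL2_d] at b6
  rw [l2Inner_sub_left hdδ.1 hτ.2.1 tw.memL2_codiff] at b7
  rw [← l2Inner_self, ← l2Inner_self, ← l2Inner_self]
  have s1 := l2Inner_sub_left th.memL2 tv.memL2 tw.memL2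
  have s2 := l2Inner_sub_left th.memL2_d tv.memL2_d tw.memL2_d
  have s3 := l2Inner_sub_left th.memL2_codiff tv.memL2_codiff tw.memL2_codiff
  linarith

/-- The three brackets in `energy_sq_le` add up to `e + A + B`. The triangle inequality for `ω - ωh
= (ω - v) - (ωh - v)` adds a further `e`. -/
theorem strang_estimate (hΩ : IsOpen Ω) {f ω ωh v : E n → Form n (m + 1)} (hf : MemL2 Ω f)
    (hω : IsSolution Ω f ω) (hωh : 𝒢.IsDiscreteSolution f ωh) (hv : v ∈ 𝒢.femSpace m)
    {η : E n → Form n (m + 2)} (hη : η ∈ 𝒢.whitneyStarZero (m + 1)) {τ : E n → Form n m}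
    (hτ : τ ∈ 𝒢.whitney m) {e A B : ℝ}
    (he : l2Norm Ω (ω - v) + l2Norm Ω (𝒢.brokenD (ω - v)) + l2Norm Ω (𝒢.brokenCodiff (ω - v)) = e)
    (hA : l2Norm Ω (weakD Ω ω - η) + l2Norm Ω (weakCodiff Ω (weakD Ω ω - η)) = A)
    (hB : l2Norm Ω (weakCodiff Ω ω - τ) + l2Norm Ω (weakD Ω (weakCodiff Ω ω - τ)) = B) :
    l2Norm Ω (ω - ωh) + l2Norm Ω (𝒢.brokenD (ω - ωh)) + l2Norm Ω (𝒢.brokenCodiff (ω - ωh)) ≤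
        (1 + (1 + √3) / 2) * e + (1 + √3) / 2 * (A + B) ∧
      √(l2Norm Ω (ω - ωh) ^ 2 + l2Norm Ω (𝒢.brokenD (ω - ωh)) ^ 2
          + l2Norm Ω (𝒢.brokenCodiff (ω - ωh)) ^ 2) ≤ 2 * e + A + B := by
  have key := energy_sq_le hΩ hf hω hωh hv hη hτ
  have tω : 𝒢.HasBroken ω (weakD Ω ω) (weakCodiff Ω ω) :=
    hasBroken_of_isWeak hω.1.1 hω.1.isWeakD hω.2.1.1.isWeakCodiff
  obtain ⟨ξh, ζh, th⟩ := 𝒢.exists_hasBroken hωh.1.1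
  obtain ⟨ξv, ζv, tv⟩ := 𝒢.exists_hasBroken hv.1
  have te := tω.sub tv
  have tw := th.sub tv
  have t1 : l2Norm Ω (ω - ωh) ≤ l2Norm Ω (ω - v) + l2Norm Ω (ωh - v) := by
    have := l2Norm_sub_le te.memL2 tw.memL2
    rwa [sub_sub_sub_cancel_right] at this
  have t2 : l2Norm Ω (𝒢.brokenD (ω - ωh)) ≤
      l2Norm Ω (𝒢.brokenD (ω - v)) + l2Norm Ω (𝒢.brokenD (ωh - v)) := by
    have := l2Norm_sub_le te.memL2_d tw.memL2_d
    rwa [sub_sub_sub_cancel_right, ← l2Norm_congr (tω.sub th).brokenD_ae_eq,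
      ← l2Norm_congr te.brokenD_ae_eq, ← l2Norm_congr tw.brokenD_ae_eq] at this
  have t3 : l2Norm Ω (𝒢.brokenCodiff (ω - ωh)) ≤
      l2Norm Ω (𝒢.brokenCodiff (ω - v)) + l2Norm Ω (𝒢.brokenCodiff (ωh - v)) := by
    have := l2Norm_sub_le te.memL2_codiff tw.memL2_codiff
    rwa [sub_sub_sub_cancel_right, ← l2Norm_congr (tω.sub th).brokenCodiff_ae_eq,
      ← l2Norm_congr te.brokenCodiff_ae_eq, ← l2Norm_congr tw.brokenCodiff_ae_eq] at this
  have p1 := add_nonneg (add_nonneg (l2Norm_nonneg (U := Ω) (u := ω - v))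
    (l2Norm_nonneg (U := Ω) (u := weakCodiff Ω (weakD Ω ω - η))))
    (l2Norm_nonneg (U := Ω) (u := weakD Ω (weakCodiff Ω ω - τ)))
  have p2 := add_nonneg (l2Norm_nonneg (U := Ω) (u := 𝒢.brokenD (ω - v)))
    (l2Norm_nonneg (U := Ω) (u := weakD Ω ω - η))
  have p3 := add_nonneg (l2Norm_nonneg (U := Ω) (u := 𝒢.brokenCodiff (ω - v)))
    (l2Norm_nonneg (U := Ω) (u := weakCodiff Ω ω - τ))
  have c1 := sum_le_of_le p1 p2 p3 key
  have c2 := sqrt_sum_sq_le_of_le p1 p2 p3 key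
  have c3 := sqrt_sum_sq_add_le l2Norm_nonneg l2Norm_nonneg l2Norm_nonneg l2Norm_nonneg
    l2Norm_nonneg l2Norm_nonneg t1 t2 t3
  subst he hA hB
  constructor
  · refine (add_le_add (add_le_add t1 t2) t3).trans ?_
    nlinarith [c1]
  · linarith

theorem Subdivision.nonempty_enrichedSpace : Nonempty (𝒢.enrichedSpace m) :=
  ⟨⟨0, 𝒢.zero_mem_piecewise⟩⟩

theorem Subdivision.nonempty_whitneyStarZero (hΩ : IsOpen Ω) :
    Nonempty (𝒢.whitneyStarZero m) :=
  ⟨⟨0, 𝒢.zero_mem_piecewise, memHdeltaZero_zero hΩ⟩⟩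

theorem Subdivision.nonempty_whitney : Nonempty (𝒢.whitney m) :=
  ⟨⟨0, 𝒢.zero_mem_piecewise, memL2_zero, 0, memL2_zero, fun φ _ => by
    simp [l2Inner, formInner_zero_left]⟩⟩

end Strang

end HodgeFEM

end

/-! ### The main theorem. -/

open HodgeFEM in
theorem mainTheorem1 (n m : ℕ) (hmn : m + 2 ≤ n) (σ D : ℝ) :
    ∃ C : ℝ, 0 < C ∧ ∀ (Ω : Set (E n)), IsOpen Ω → ∀ 𝒢 : Subdivision Ω,
      𝒢.ShapeRegular σ → 𝒢.DiamLE D →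
      ∀ f ω ωh : E n → Form n (m + 1), MemL2 Ω f → IsSolution Ω f ω →
        𝒢.IsDiscreteSolution f ωh →
        (MemHdeltaZero Ω (weakD Ω ω) ∧ MemHd Ω (weakCodiff Ω ω)) ∧
        l2Norm Ω (ω - ωh) + l2Norm Ω (𝒢.brokenD (ω - ωh)) + l2Norm Ω (𝒢.brokenCodiff (ω - ωh))
          ≤ C * 𝒢.enrichedError ω
            + (1 + √3) / 2 * (𝒢.whitneyStarZeroError (weakD Ω ω)
              + 𝒢.whitneyError (weakCodiff Ω ω)) ∧
        √(l2Norm Ω (ω - ωh) ^ 2 + l2Norm Ω (𝒢.brokenD (ω - ωh)) ^ 2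
            + l2Norm Ω (𝒢.brokenCodiff (ω - ωh)) ^ 2)
          ≤ C * 𝒢.enrichedError ω + 𝒢.whitneyStarZeroError (weakD Ω ω)
            + 𝒢.whitneyError (weakCodiff Ω ω) := by
  obtain ⟨C, hC, happrox⟩ := exists_femSpace_approx n m hmn σ D
  set κ : ℝ := (1 + √3) / 2 with hκ
  have h3 : (1 : ℝ) ≤ √3 := Real.one_le_sqrt.2 (by norm_num)
  have hκ1 : 1 ≤ κ := by rw [hκ]; linarith
  have hC' : 0 < (1 + κ) * C + 1 := by positivity
  -- The factor `1 + κ` serves the sum of norms and, because `κ ≥ 1`, also covers the `2` in the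
  -- energy estimate. The summand `1` keeps the constant positive even if `C = 0`, as the passage to
  -- infima requires.
  refine ⟨(1 + κ) * C + 1, hC', fun Ω hΩ 𝒢 hσ hD f ω ωh hf hω hωh =>
    ⟨hω.regularity hΩ hf, ?_⟩⟩
  have := 𝒢.nonempty_enrichedSpace (m := m)
  have := 𝒢.nonempty_whitneyStarZero (m := m + 1) hΩ
  have := 𝒢.nonempty_whitney (m := m)
  have key : ∀ (μ : 𝒢.enrichedSpace m) (η : 𝒢.whitneyStarZero (m + 1)) (τ : 𝒢.whitney m),
      l2Norm Ω (ω - ωh) + l2Norm Ω (𝒢.brokenD (ω - ωh)) + l2Norm Ω (𝒢.brokenCodiff (ω - ωh)) ≤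
        ((1 + κ) * C + 1) * (l2Norm Ω (ω - μ.1) + l2Norm Ω (𝒢.brokenD (ω - μ.1))
          + l2Norm Ω (𝒢.brokenCodiff (ω - μ.1)))
        + (κ * (l2Norm Ω (weakD Ω ω - η.1) + l2Norm Ω (weakCodiff Ω (weakD Ω ω - η.1)))
          + κ * (l2Norm Ω (weakCodiff Ω ω - τ.1) + l2Norm Ω (weakD Ω (weakCodiff Ω ω - τ.1)))) ∧
      √(l2Norm Ω (ω - ωh) ^ 2 + l2Norm Ω (𝒢.brokenD (ω - ωh)) ^ 2
            + l2Norm Ω (𝒢.brokenCodiff (ω - ωh)) ^ 2) ≤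
        ((1 + κ) * C + 1) * (l2Norm Ω (ω - μ.1) + l2Norm Ω (𝒢.brokenD (ω - μ.1))
          + l2Norm Ω (𝒢.brokenCodiff (ω - μ.1)))
        + (1 * (l2Norm Ω (weakD Ω ω - η.1) + l2Norm Ω (weakCodiff Ω (weakD Ω ω - η.1)))
          + 1 * (l2Norm Ω (weakCodiff Ω ω - τ.1)
            + l2Norm Ω (weakD Ω (weakCodiff Ω ω - τ.1)))) := by
    intro μ η τ
    obtain ⟨v, hv, hle⟩ := happrox Ω hΩ 𝒢 hσ hD ω hω.1 hω.2.1 μ.1 μ.2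
    have h1 := strang_estimate hΩ hf hω hωh hv η.2 τ.2 rfl rfl rfl
    rw [← hκ] at h1
    have n1 := l2Norm_nonneg (U := Ω) (u := ω - μ.1)
    have n2 := l2Norm_nonneg (U := Ω) (u := 𝒢.brokenD (ω - μ.1))
    have n3 := l2Norm_nonneg (U := Ω) (u := 𝒢.brokenCodiff (ω - μ.1))
    have n4 := mul_nonneg hC (add_nonneg (add_nonneg n1 n2) n3)
    have h2 := mul_le_mul_of_nonneg_left hle (by positivity : (0 : ℝ) ≤ 1 + κ)
    have h4 := mul_le_mul_of_nonneg_right hκ1 n4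
    exact ⟨h1.1.trans (by linarith), h1.2.trans (by linarith)⟩
  have hκ0 : 0 < κ := by linarith
  constructor
  · have h := le_mul_iInf_add_mul_iInf_add_mul_iInf hC' hκ0 hκ0 fun μ η τ => (key μ η τ).1
    rw [← mul_add] at h
    exact h
  · have h := le_mul_iInf_add_mul_iInf_add_mul_iInf hC' one_pos one_pos fun μ η τ => (key μ η τ).2
    rw [one_mul, one_mul, ← add_assoc] at h
    exact h
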